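/- Let $G$ be a compact Lie group with Lie algebra $\mathfrak g$, let $H\subset G$ be a closed subgroup with Lie algebra $\mathfrak h$, and let $\langle\cdot,\cdot\rangle$ be a bi-invariant Riemannian metric on $G$. Let $ds_0^2$ be the induced (normal) metric on $G/H$, i.e. the one for which $\pi:G\to G/H$ is a Riemannian submersion. Let $\mathfrak v=\mathfrak h^{\perp}\subset\mathfrak g$, let $pr_{\mathfrak v}:\mathfrak g\to\mathfrak v$ be the orthogonal projection, and let $\mathrm{ann}_{\mathfrak g}(v)=\{\eta\in\mathfrak g : [\eta,v]=0\}$, $\mathrm{ann}_{\mathfrak h}(v)=\mathrm{ann}_{\mathfrak g}(v)\cap\mathfrak h$. Call $v\in\mathfrak v$ generic if $\dim\mathrm{ann}_{\mathfrak g}(v)$ and $\dim\mathrm{ann}_{\mathfrak h}(v)$ are both minimal among elements of $\mathfrak v$. Let $M=T^*(G/H)$ with $\omega=\sum dp_i\wedge dx^i$, with its Poisson bracket, and with the natural $G$-action, whose moment map is $\Phi:M\to\mathfrak g^*$, $\Phi(q,p)(\xi)=p\big(\tfrac{d}{dt}|_{t=0}\exp(t\xi)q\big)$. Put $\mathcal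 F_1=\Phi^*C^\infty(\mathfrak g^*)\subset C^\infty(M)$, let $\mathcal F_2\subset C^\infty(M)$ be the set of $G$-invariant functions, and let $\mathcal F=\mathcal F_1+\mathcal F_2$. Theorem. The geodesic flow of $ds_0^2$, i.e. the Hamiltonian flow on $M$ of $\tfrac12\sum g^{ij}p_ip_j$, is completely integrable in the non-commutative sense, with $\mathcal F$ as a complete algebra of integrals. Precisely: $\mathcal F$ is a linear space closed under the Poisson bracket; every $f\in\mathcal F$ is constant along the trajectories of the geodesic flow; and there are integers $l,r\ge 0$ with $l+r=\dim M$ and an open dense set $U\subset M$ such that near every point of $U$ there are $f_1,\dots,f_l\in\mathcal F$ whose differentials are linearly independent and span the differentials of all functions in $\mathcal F$, and for which the matrix $(\{f_i,f_j\})$ has corank $r$ (that is, $\mathrm{ddim}\,\mathcal F=l$ and $\mathrm{dind}\,\mathcal F=r$). Generic $v\in\mathfrak v$ exist, and $r=\dim pr_{\mathfrak v}(\mathrm{ann}_{\mathfrak g}(v))$ for every generic $v\in\mathfrak v$. Moreover $U$ is filled by invariant isotropic tori of this dimension: for every $x\in U$, the connected component through $x$ of the common level set $\{y\in M: f(y)=f(x)\text{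 for all }f\in\mathcal F\}$ is contained in $U$, is invariant under the geodesic flow, and is an embedded isotropic torus of dimension $r$. -/

import Mathlib

open Bundle Set Filter Topology
open scoped Manifold ContDiff

noncomputable section

namespace NormalMetric

instance instLEInftyMinSmoothness : ENat.LEInfty (minSmoothness ℝ 3) :=
  ⟨by rw [minSmoothness_of_isRCLikeNormedField]; exact ENat.LEInfty.out⟩

/-! ### The cotangent bundle and its symplectic geometry -/

section Cotangent

variable {F : Type*} [NormedAddCommGroup F] [NormedSpace ℝ F]
  {Q : Type*} [TopologicalSpace Q] [ChartedSpace F Q] [IsManifold 𝓘(ℝ, F) ∞ Q]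

variable (F Q) in
/-- The cotangent bundle `T*Q` of a smooth manifold `Q` modelled on `F`. A point is a pair
`α = ⟨q, p⟩` of a point `q = α.1` of `Q` and a covector `p = α.2` at `q`. -/
abbrev Cotangent : Type _ :=
  TotalSpace (F →L[ℝ] ℝ) (fun q : Q => TangentSpace 𝓘(ℝ, F) q →L[ℝ] Trivial Q ℝ q)

variable (F) in
/-- The model with corners of `T*Q` : `T*Q` is modelled on `F × F*`. -/
abbrev cotModel := (𝓘(ℝ, F)).prod 𝓘(ℝ, F →L[ℝ] ℝ)

variable (F Q) in
/-- The algebra of smooth functions on `T*Q`. -/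
abbrev SmoothFun : Type _ := C^∞⟮cotModel F, Cotangent F Q; ℝ⟯

/-- The covector `p` of a point `α = ⟨q, p⟩` of `T*Q`. -/
def covector (α : Cotangent F Q) : TangentSpace 𝓘(ℝ, F) α.1 →L[ℝ] ℝ := α.2

/-- The differential of a real function on `T*Q`. -/
def differential (f : Cotangent F Q → ℝ) (α : Cotangent F Q) :
    TangentSpace (cotModel F) α →L[ℝ] ℝ :=
  mfderiv (cotModel F) 𝓘(ℝ, ℝ) f α

/-- The Liouville form `θ = p dx` : `θ_α(X) = p (dproj X)` at `α = ⟨q, p⟩`, where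
`proj : T*Q → Q` is the projection. -/
def liouvilleForm (α : Cotangent F Q) : TangentSpace (cotModel F) α →L[ℝ] ℝ :=
  covector α ∘L mfderiv (cotModel F) 𝓘(ℝ, F) (fun β : Cotangent F Q => β.1) α

/-- The exterior derivative of a one-form `θ` on a normed space:
`(dθ)(X, Y) = (D_X θ)(Y) - (D_Y θ)(X)`. -/
def extDerivOneForm {V : Type*} [NormedAddCommGroup V] [NormedSpace ℝ V] (θ : V → V →L[ℝ] ℝ)
    (z : V) : V →L[ℝ] V →L[ℝ] ℝ :=
  fderiv ℝ θ z - (fderiv ℝ θ z).flip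

/-- The Liouville form read in the chart of `T*Q` around `α`. -/
def localLiouvilleForm (α : Cotangent F Q) (z : F × (F →L[ℝ] ℝ)) :
    (F × (F →L[ℝ] ℝ)) →L[ℝ] ℝ :=
  liouvilleForm ((extChartAt (cotModel F) α).symm z) ∘L
    mfderiv 𝓘(ℝ, F × (F →L[ℝ] ℝ)) (cotModel F) (extChartAt (cotModel F) α).symm z

/-- The canonical symplectic form `ω = dθ = dp ∧ dx` of `T*Q` at `α`; the exterior derivative is
computed in the chart around `α`. -/
def symplecticForm (α : Cotangent F Q) :
    TangentSpace (cotModel F) α →L[ℝ] TangentSpace (cotModel F) α →L[ℝ] ℝ :=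
  let dφ : TangentSpace (cotModel F) α →L[ℝ] (F × (F →L[ℝ] ℝ)) :=
    mfderiv (cotModel F) 𝓘(ℝ, F × (F →L[ℝ] ℝ)) (extChartAt (cotModel F) α) α
  ContinuousLinearMap.precomp ℝ dφ ∘L
    extDerivOneForm (localLiouvilleForm α) (extChartAt (cotModel F) α α) ∘L dφ

/-- The Hamiltonian vector field `X_f`, i.e. the vector field with `ω(X_f, ·) = -df`. As
`ω = dp ∧ dx`, these are Hamilton's equations `x' = ∂f/∂p`, `p' = -∂f/∂x`. (`ω_α` is invertible
as a map from tangent vectors to covectors when `Q` is finite dimensional.) -/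
def hamiltonianField (f : Cotangent F Q → ℝ) (α : Cotangent F Q) : TangentSpace (cotModel F) α :=
  (symplecticForm α).inverse (-differential f α)

/-- The Poisson bracket `{f, g} = df(X_g) = ∑ (∂f/∂x ∂g/∂p - ∂g/∂x ∂f/∂p)`. -/
def poissonBracket (f g : Cotangent F Q → ℝ) (α : Cotangent F Q) : ℝ :=
  differential f α (hamiltonianField g α)

/-- `f` is a first integral of the Hamiltonian system with Hamiltonian `Ham`: it is constant along
every trajectory. -/
def IsFirstIntegral (Ham f : Cotangent F Q → ℝ) : Prop :=
  ∀ (γ : ℝ → Cotangent F Q) (a b : ℝ), IsMIntegralCurveOn γ (hamiltonianField Ham) (Ioo a b) →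
    ∀ s ∈ Ioo a b, ∀ t ∈ Ioo a b, f (γ s) = f (γ t)

/-- A set invariant under the Hamiltonian flow of `Ham`. -/
def IsFlowInvariant (Ham : Cotangent F Q → ℝ) (N : Set (Cotangent F Q)) : Prop :=
  ∀ (γ : ℝ → Cotangent F Q) (a b : ℝ), IsMIntegralCurveOn γ (hamiltonianField Ham) (Ioo a b) →
    ∀ s ∈ Ioo a b, γ s ∈ N → ∀ t ∈ Ioo a b, γ t ∈ N

/-- A linear space of functions closed under the Poisson bracket. -/
def IsPoissonClosed (A : Submodule ℝ (SmoothFun F Q)) : Prop :=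
  ∀ f ∈ A, ∀ g ∈ A, ∃ k ∈ A, ∀ α, k α = poissonBracket f g α

/-- Around every point of `U`, one can find exactly `l` independent functions `f₁, …, f_l` in `A`
(the differentials of the other functions in `A` depend on theirs), and the matrix `{f_i, f_j}`
has corank `r`. -/
def HasDimIndexOn (A : Submodule ℝ (SmoothFun F Q)) (U : Set (Cotangent F Q)) (l r : ℕ) : Prop :=
  ∀ α ∈ U, ∃ f : Fin l → SmoothFun F Q, (∀ i, f i ∈ A) ∧ ∀ᶠ β in 𝓝 α,
    LinearIndependent ℝ (fun i => differential (f i) β) ∧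
    (∀ g ∈ A, differential g β ∈ Submodule.span ℝ (range fun i => differential (f i) β)) ∧
    (Matrix.of fun i j => poissonBracket (f i) (f j) β).rank + r = l

/-- `A` is a complete algebra of first integrals of the Hamiltonian system with Hamiltonian `Ham`:
on the open dense set `U` it has differential dimension `l` and differential index `r`, with
`l + r = dim T*Q`. -/
structure IsCompleteAlgebraOfIntegrals (Ham : Cotangent F Q → ℝ)
    (A : Submodule ℝ (SmoothFun F Q)) (U : Set (Cotangent F Q)) (l r : ℕ) : Prop where
  firstIntegral : ∀ f ∈ A, IsFirstIntegral Ham f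
  poissonClosed : IsPoissonClosed A
  isOpen : IsOpen U
  dense : Dense U
  dimIndex : HasDimIndexOn A U l r
  complete : l + r = Module.finrank ℝ (F × (F →L[ℝ] ℝ))

/-- Complete integrability in the non-commutative sense. -/
def IsCompletelyIntegrable (Ham : Cotangent F Q → ℝ) : Prop :=
  ∃ (A : Submodule ℝ (SmoothFun F Q)) (U : Set (Cotangent F Q)) (l r : ℕ),
    IsCompleteAlgebraOfIntegrals Ham A U l r

/-- The common level set through `α` of all functions in `A`. -/
def levelSet (A : Submodule ℝ (SmoothFun F Q)) (α : Cotangent F Q) : Set (Cotangent F Q) :=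
  {β | ∀ f ∈ A, f β = f α}

/-- `N` is an isotropic torus of dimension `r`: the image of a smooth immersion of `ℝ^r` that
identifies exactly the points that differ by `ℤ^r` (hence of an embedding of `ℝ^r / ℤ^r`), on which
the symplectic form vanishes. -/
def IsIsotropicTorus (N : Set (Cotangent F Q)) (r : ℕ) : Prop :=
  ∃ ι : (Fin r → ℝ) → Cotangent F Q,
    ContMDiff 𝓘(ℝ, Fin r → ℝ) (cotModel F) ∞ ι ∧
    (∀ s t, ι s = ι t ↔ ∀ i, ∃ n : ℤ, s i - t i = n) ∧
    range ι = N ∧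
    (∀ s, Function.Injective (mfderiv 𝓘(ℝ, Fin r → ℝ) (cotModel F) ι s)) ∧
    ∀ s u w, symplecticForm (ι s) (mfderiv 𝓘(ℝ, Fin r → ℝ) (cotModel F) ι s u)
      (mfderiv 𝓘(ℝ, Fin r → ℝ) (cotModel F) ι s w) = 0

end Cotangent

/-! ### Riemannian metrics and geodesic flows -/

section Metric

variable {F : Type*} [NormedAddCommGroup F] [NormedSpace ℝ F]
  {Q : Type*} [TopologicalSpace Q] [ChartedSpace F Q] [IsManifold 𝓘(ℝ, F) ∞ Q]

variable (F Q) in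
/-- Smooth Riemannian metrics on `Q`. -/
abbrev Metric : Type _ :=
  ContMDiffRiemannianMetric 𝓘(ℝ, F) ∞ F (fun q : Q => TangentSpace 𝓘(ℝ, F) q)

/-- The kinetic energy `H(q, p) = ½ ∑ gⁱʲ pᵢ pⱼ = ½ p(x')`, where `x'` is the tangent vector with
`g_q(x', ·) = p`. Its Hamiltonian flow on `T*Q` is the geodesic flow of `g`. (`g_q` is invertible
as a map from tangent vectors to covectors when `Q` is finite dimensional.) -/
def kineticEnergy (g : Metric F Q) (α : Cotangent F Q) : ℝ :=
  (1 / 2) * covector α ((g.inner α.1).inverse (covector α))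

end Metric

/-! ### Group actions, the moment map, and the two algebras of functions -/

section Action

variable {E : Type*} [NormedAddCommGroup E] [NormedSpace ℝ E]
  (G : Type*) [TopologicalSpace G] [Group G] [ChartedSpace E G]
  {F : Type*} [NormedAddCommGroup F] [NormedSpace ℝ F]
  {Q : Type*} [TopologicalSpace Q] [ChartedSpace F Q] [IsManifold 𝓘(ℝ, F) ∞ Q] [MulAction G Q]

/-- The infinitesimal action at `q`, i.e. the differential at the identity of the orbit map
`g ↦ g • q`; it sends `ξ` in the Lie algebra to `d/dt exp(tξ) • q` at `t = 0`.
(The tangent space `E` of `G` at `1` is the Lie algebra, and `1 • q = q`.) -/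
def infinitesimalAction (q : Q) : E →L[ℝ] TangentSpace 𝓘(ℝ, F) q :=
  mfderiv 𝓘(ℝ, E) 𝓘(ℝ, F) (fun g : G => g • q) 1

/-- The moment map `Φ : T*Q → 𝔤*` of the natural action on `T*Q`: `Φ(q, p)(ξ) = p(ξ_Q(q))`. -/
def momentMap (α : Cotangent F Q) : E →L[ℝ] ℝ :=
  covector α ∘L infinitesimalAction (E := E) G α.1

variable (E F Q) in
/-- `F₁` : the pull-backs by the moment map of the smooth functions on `𝔤*`. -/
def pullbackAlgebra : Submodule ℝ (SmoothFun F Q) where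
  carrier := {f | ∃ h : (E →L[ℝ] ℝ) → ℝ, ContDiff ℝ ∞ h ∧ ∀ α, f α = h (momentMap G α)}
  add_mem' := by
    rintro f g ⟨h, hh, hf⟩ ⟨k, hk, hg⟩
    exact ⟨fun μ => h μ + k μ, hh.add hk, fun α => by simp [hf, hg]⟩
  zero_mem' := ⟨fun _ => 0, contDiff_const, fun α => by simp⟩
  smul_mem' := by
    rintro c f ⟨h, hh, hf⟩
    exact ⟨fun μ => c * h μ, contDiff_const.mul hh, fun α => by simp [hf]⟩

variable (F Q) in
/-- `F₂` : the smooth functions on `T*Q` invariant under the natural action of `G`, which sends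
the covector `p ∘ (dg)_q` at `q` to the covector `p` at `g • q`. -/
def invariantAlgebra : Submodule ℝ (SmoothFun F Q) where
  carrier := {f | ∀ (g : G) (q : Q) (p : TangentSpace 𝓘(ℝ, F) (g • q) →L[ℝ] ℝ),
    f ⟨q, p ∘L mfderiv 𝓘(ℝ, F) 𝓘(ℝ, F) (fun x : Q => g • x) q⟩ = f ⟨g • q, p⟩}
  add_mem' := by
    intro f g hf hg a q p
    simpa using congrArg₂ (· + ·) (hf a q p) (hg a q p)
  zero_mem' := by intro a q p; simp
  smul_mem' := by
    intro c f hf a q p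
    simpa using congrArg (c * ·) (hf a q p)

end Action

/-! ### Homogeneous spaces and normal metrics -/

section Homogeneous

variable {E : Type*} [NormedAddCommGroup E] [NormedSpace ℝ E]
  {G : Type*} [TopologicalSpace G] [Group G] [ChartedSpace E G]

variable (E) in
/-- The manifold structure on `G ⧸ H` is the standard one: the (unique) smooth structure for which
the projection `G → G ⧸ H` is a smooth submersion. -/
structure IsQuotientStructure (H : Subgroup G) (F : Type*) [NormedAddCommGroup F] [NormedSpace ℝ F]
    [ChartedSpace F (G ⧸ H)] : Prop where
  contMDiff : ContMDiff 𝓘(ℝ, E) 𝓘(ℝ, F) ∞ (QuotientGroup.mk : G → G ⧸ H)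
  submersion : ∀ g : G, Function.Surjective
    (mfderiv 𝓘(ℝ, E) 𝓘(ℝ, F) (QuotientGroup.mk : G → G ⧸ H) g)

variable [LieGroup 𝓘(ℝ, E) ∞ G]

/-- A Riemannian metric on `G` invariant under left and right translations. -/
structure IsBiinvariant (B : Metric E G) : Prop where
  left : ∀ (a x : G) (u w : TangentSpace 𝓘(ℝ, E) x),
    B.inner (a * x) (mfderiv 𝓘(ℝ, E) 𝓘(ℝ, E) (fun y : G => a * y) x u)
      (mfderiv 𝓘(ℝ, E) 𝓘(ℝ, E) (fun y : G => a * y) x w) = B.inner x u w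
  right : ∀ (a x : G) (u w : TangentSpace 𝓘(ℝ, E) x),
    B.inner (x * a) (mfderiv 𝓘(ℝ, E) 𝓘(ℝ, E) (fun y : G => y * a) x u)
      (mfderiv 𝓘(ℝ, E) 𝓘(ℝ, E) (fun y : G => y * a) x w) = B.inner x u w

variable (H : Subgroup G) {F : Type*} [NormedAddCommGroup F] [NormedSpace ℝ F]
  [ChartedSpace F (G ⧸ H)]

/-- The metric `g` on `G ⧸ H` is induced from the metric `B` on `G`: the projection
`G → G ⧸ H` is a Riemannian submersion, i.e. its differential is isometric on the orthogonal
complement of its kernel. -/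
def IsInducedMetric [IsManifold 𝓘(ℝ, F) ∞ (G ⧸ H)] (B : Metric E G) (g : Metric F (G ⧸ H)) :
    Prop :=
  let dπ := fun x : G => mfderiv 𝓘(ℝ, E) 𝓘(ℝ, F) (QuotientGroup.mk : G → G ⧸ H) x
  ∀ (x : G) (u w : TangentSpace 𝓘(ℝ, E) x),
    (∀ k, dπ x k = 0 → B.inner x k u = 0) → (∀ k, dπ x k = 0 → B.inner x k w = 0) →
    g.inner (x : G ⧸ H) (dπ x u) (dπ x w) = B.inner x u w

variable (F) in
/-- The Lie algebra `𝔥` of `H`, as a subspace of the Lie algebra `𝔤 = T₁G` of `G`: the tangent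
space at the identity of the fibre `H` of the submersion `G → G ⧸ H`. -/
def isotropyAlgebra : Submodule ℝ (GroupLieAlgebra 𝓘(ℝ, E) G) :=
  LinearMap.ker (mfderiv 𝓘(ℝ, E) 𝓘(ℝ, F) (QuotientGroup.mk : G → G ⧸ H) 1).toLinearMap

/-- The scalar product on `𝔤 = T₁G` given by the metric `B`. -/
def scalarProduct (B : Metric E G) : LinearMap.BilinForm ℝ (GroupLieAlgebra 𝓘(ℝ, E) G) :=
  LinearMap.mk₂ ℝ (fun u w => B.inner 1 u w) (by simp) (by simp) (by simp) (by simp)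

variable (F) in
/-- The orthogonal complement `𝔳` of `𝔥` in `𝔤`. -/
def complement (B : Metric E G) : Submodule ℝ (GroupLieAlgebra 𝓘(ℝ, E) G) :=
  (scalarProduct B).orthogonal (isotropyAlgebra H F)

theorem isCompl_complement [FiniteDimensional ℝ E] (B : Metric E G) :
    IsCompl (complement H F B) (isotropyAlgebra H F) := by
  have : FiniteDimensional ℝ (GroupLieAlgebra 𝓘(ℝ, E) G) :=
    inferInstanceAs (FiniteDimensional ℝ E)
  refine IsCompl.symm ((LinearMap.BilinForm.isCompl_orthogonal_iff_disjoint ?_).2 ?_)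
  · intro u w h
    exact (B.symm 1 w u).trans h
  · rw [Submodule.disjoint_def]
    intro u hu hu'
    by_contra h
    exact (B.pos 1 u h).ne' (hu' u hu)

/-- The annihilator `ann_𝔤(v) = {η ∈ 𝔤 | [η, v] = 0}`. -/
def ann [FiniteDimensional ℝ E] (v : GroupLieAlgebra 𝓘(ℝ, E) G) : Submodule ℝ (GroupLieAlgebra 𝓘(ℝ, E) G) where
  carrier := {η | ⁅η, v⁆ = 0}
  add_mem' := by
    have := FiniteDimensional.complete ℝ E
    intro a b ha hb
    simp_all
  zero_mem' := by
    have := FiniteDimensional.complete ℝ E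
    simp
  smul_mem' := by
    have := FiniteDimensional.complete ℝ E
    intro c a ha
    simp_all

variable (F) in
/-- `v ∈ 𝔳` is generic: the dimensions of `ann_𝔤(v)` and `ann_𝔥(v) = ann_𝔤(v) ∩ 𝔥` are minimal
among the elements of `𝔳`. -/
def IsGeneric [FiniteDimensional ℝ E] (B : Metric E G) (v : GroupLieAlgebra 𝓘(ℝ, E) G) : Prop :=
  v ∈ complement H F B ∧ ∀ w ∈ complement H F B,
    Module.finrank ℝ (ann v) ≤ Module.finrank ℝ (ann w) ∧
    Module.finrank ℝ ↥(ann v ⊓ isotropyAlgebra H F) ≤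
      Module.finrank ℝ ↥(ann w ⊓ isotropyAlgebra H F)

variable (F) in
/-- The image `pr_𝔳(ann_𝔤(v))` of the annihilator of `v` under the orthogonal projection
`𝔤 → 𝔳`. -/
def prAnn [FiniteDimensional ℝ E] (B : Metric E G) (v : GroupLieAlgebra 𝓘(ℝ, E) G) :
    Submodule ℝ (GroupLieAlgebra 𝓘(ℝ, E) G) :=
  (ann v).map (Submodule.projection _ _ (isCompl_complement H (F := F) B))

end Homogeneous

end NormalMetric

end

/-!
The proof identifies everything with linear algebra in the Lie algebra `𝔤`, by means of the moment
map `Φ`, which the bi-invariant scalar product turns into a map `momentVec` to `𝔤`.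

*First integrals.* The kinetic energy of the normal metric is `½ |Φ|²`
(`kineticEnergy_eq_energyFun`), which is both a function of `Φ` and an invariant function. The
Hamiltonian fields of functions of `Φ` are tangent to the orbits, so `F₁` and `F₂` commute
(`poissonBracket_pullback_invariant`). Hence the energy commutes with `F₁ + F₂`, and `F₁ + F₂` is
closed under the bracket because `F₁` and `F₂` are (`isPoissonClosed_sup`).

*Dimension and index.* Averaging polynomials over a compact group shows that smooth invariant
functions separate orbits (`exists_invariant_separating`, `exists_cotAct_eq`). Where the rank of the
differentials of the functions in `F₂` is locally maximal, a vector `X` killed by all these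
differentials is the velocity of a curve along which `F₂` is constant (`exists_curve_of_mem_kSpace`).
Such a curve lies in an orbit, and so `X` is tangent to the orbit (`exists_cotOrbit_of_curve`). The
set `U` of the regular points (`IsRegPt`) consists of the points whose moment is generic and where the
common kernel of the differentials of `F₂` is the tangent space of the orbit; it is open and dense
(`isOpen_isRegPt`, `dense_isRegPt`). At a regular point `α` with moment `v`, the common kernel of the
differentials of `F₁ + F₂` is the image of the centralizer of `v` under the infinitesimal action
(`IsRegPt.kSpace_eq`). It consists of Hamiltonian fields of components of `Φ`, and so its dimension `r`
is the corank of the matrix of Poisson brackets (`rank_poissonBracket`, `hasDimIndexOn`). The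
stabilizer algebra of `α` is contained in the centralizer of `v`, so `r` is the difference of the two
dimensions; over the base point the stabilizer algebra is the part of the centralizer in `𝔥`, and
`r` is the dimension of the projection of the centralizer to `𝔳` (`finrank_prAnn`).

*Tori.* The level set of `F₁ + F₂` through `α` is the orbit of `α` under the stabilizer of `v` in `G`
(`mem_levelSet_iff`). At a generic point the rank of `ad v` is maximal on `𝔳`. This forces the bracket
of two elements of the centralizer of `v` to be orthogonal to `𝔳` (`IsGen.lieBr_mem_iso`), so that the
orthogonal complement of the stabilizer algebra in the centralizer, `torusAlg`, is abelian
(`IsGenPt.lieBr_torusAlg`). The orbit of `α` under the group which it generates is isotropic and open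
in the level set (`sympl_torus`, `eventually_mem_torus`). Its periods form a discrete group, which
spans because the motions in a compact group are recurrent (`exists_pow_mem_nhds_one`). So the orbit
is a torus of dimension `r`, and the connected component of the level set (`exists_torus`).
Trajectories, being connected, remain in it (`isFlowInvariant_connectedComponentIn`).
-/

open Bundle Set Filter Topology
open scoped Manifold ContDiff

noncomputable section

namespace NormalMetric

set_option linter.unusedSectionVars false

/-! ### Charts and curves in boundaryless manifolds -/

section Charts

variable {V : Type*} [NormedAddCommGroup V] [NormedSpace ℝ V]
  {K : Type*} [TopologicalSpace K] {I : ModelWithCorners ℝ V K} [I.Boundaryless]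
  {M : Type*} [TopologicalSpace M] [ChartedSpace K M] [IsManifold I ∞ M]

theorem contMDiffAt_extChartAt_of_mem {x y : M} (hy : y ∈ (extChartAt I x).source) :
    ContMDiffAt I 𝓘(ℝ, V) ∞ (extChartAt I x) y :=
  contMDiffAt_extChartAt' (by simpa using hy)

theorem contMDiffAt_extChartAt_symm_of_mem {x : M} {z : V} (hz : z ∈ (extChartAt I x).target) :
    ContMDiffAt 𝓘(ℝ, V) I ∞ (extChartAt I x).symm z :=
  (contMDiffOn_extChartAt_symm (n := ∞) x).contMDiffAt ((isOpen_extChartAt_target x).mem_nhds hz)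

theorem mdifferentiableAt_extChartAt_of_mem {x y : M} (hy : y ∈ (extChartAt I x).source) :
    MDifferentiableAt I 𝓘(ℝ, V) (extChartAt I x) y :=
  (contMDiffAt_extChartAt_of_mem hy).mdifferentiableAt (by simp)

theorem mdifferentiableAt_extChartAt_symm_of_mem {x : M} {z : V}
    (hz : z ∈ (extChartAt I x).target) : MDifferentiableAt 𝓘(ℝ, V) I (extChartAt I x).symm z :=
  (contMDiffAt_extChartAt_symm_of_mem hz).mdifferentiableAt (by simp)

theorem eventually_extChartAt_target {x : M} {z : V} (hz : z ∈ (extChartAt I x).target) :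
    ∀ᶠ w in 𝓝 z, w ∈ (extChartAt I x).target :=
  (isOpen_extChartAt_target x).mem_nhds hz

theorem eventually_extChartAt_source {x y : M} (hy : y ∈ (extChartAt I x).source) :
    ∀ᶠ w in 𝓝 y, w ∈ (extChartAt I x).source :=
  (isOpen_extChartAt_source x).mem_nhds hy

theorem mfderiv_extChartAt_symm_apply {x y : M} (hy : y ∈ (extChartAt I x).source)
    (X : TangentSpace I y) :
    mfderiv 𝓘(ℝ, V) I (extChartAt I x).symm (extChartAt I x y)
      (mfderiv I 𝓘(ℝ, V) (extChartAt I x) y X) = X := by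
  have h := mfderivWithin_extChartAt_symm_comp_mfderiv_extChartAt' (I := I) hy
  rw [I.range_eq_univ, mfderivWithin_univ] at h
  exact congrArg (fun L => L X) h

theorem mfderiv_extChartAt_apply {x y : M} (hy : y ∈ (extChartAt I x).source) (Z : V) :
    mfderiv I 𝓘(ℝ, V) (extChartAt I x) y
      (mfderiv 𝓘(ℝ, V) I (extChartAt I x).symm (extChartAt I x y) Z) = Z := by
  have h := mfderiv_extChartAt_comp_mfderivWithin_extChartAt_symm' (I := I) hy
  rw [I.range_eq_univ, mfderivWithin_univ] at h
  exact congrArg (fun L => L Z) h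

end Charts

/-! ### Invariant frames and the bracket of a Lie group -/

section LieGroup

variable {E : Type*} [NormedAddCommGroup E] [NormedSpace ℝ E] [FiniteDimensional ℝ E]
  {G : Type*} [TopologicalSpace G] [Group G] [ChartedSpace E G] [LieGroup 𝓘(ℝ, E) ∞ G]

variable (E G) in
/-- The chart at the identity. -/
abbrev chartOne : PartialEquiv G E := extChartAt 𝓘(ℝ, E) (1 : G)

variable (G) in
/-- Multiplication read in the chart at the identity. -/
def chartMul (z : E × E) : E :=
  chartOne E G ((chartOne E G).symm z.1 * (chartOne E G).symm z.2)

theorem chartOne_mem_target : chartOne E G 1 ∈ (chartOne E G).target := mem_extChartAt_target (1 : G)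

theorem one_mem_source : (1 : G) ∈ (chartOne E G).source := mem_extChartAt_source (1 : G)

theorem chartOne_symm_one : (chartOne E G).symm (chartOne E G 1) = 1 := extChartAt_to_inv (1 : G)

theorem contDiffAt_chartMul {z : E × E} (h1 : z.1 ∈ (chartOne E G).target)
    (h2 : z.2 ∈ (chartOne E G).target)
    (h3 : (chartOne E G).symm z.1 * (chartOne E G).symm z.2 ∈ (chartOne E G).source) :
    ContDiffAt ℝ ∞ (chartMul G) z := by
  rw [← contMDiffAt_iff_contDiffAt]
  have k1 : ContMDiffAt 𝓘(ℝ, E × E) 𝓘(ℝ, E) ∞ (fun z : E × E => (chartOne E G).symm z.1) z :=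
    ContMDiffAt.comp z (contMDiffAt_extChartAt_symm_of_mem h1) contDiff_fst.contMDiff.contMDiffAt
  have k2 : ContMDiffAt 𝓘(ℝ, E × E) 𝓘(ℝ, E) ∞ (fun z : E × E => (chartOne E G).symm z.2) z :=
    ContMDiffAt.comp z (contMDiffAt_extChartAt_symm_of_mem h2) contDiff_snd.contMDiff.contMDiffAt
  exact ContMDiffAt.comp z (contMDiffAt_extChartAt_of_mem h3) (k1.mul k2)

theorem hasMFDerivAt_chartOne_symm :
    HasMFDerivAt 𝓘(ℝ, E) 𝓘(ℝ, E) (chartOne E G).symm (chartOne E G 1)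
      (ContinuousLinearMap.id ℝ E) := by
  have h := (mdifferentiableAt_extChartAt_symm_of_mem (I := 𝓘(ℝ, E))
    (chartOne_mem_target (E := E) (G := G))).hasMFDerivAt
  have h2 := mfderivWithin_range_extChartAt_symm (I := 𝓘(ℝ, E)) (x := (1:G))
  rw [ModelWithCorners.range_eq_univ, mfderivWithin_univ] at h2
  exact h2 ▸ h

theorem hasMFDerivAt_chartOne :
    HasMFDerivAt 𝓘(ℝ, E) 𝓘(ℝ, E) (chartOne E G) (1 : G) (ContinuousLinearMap.id ℝ E) := by
  have h := (mdifferentiableAt_extChartAt_of_mem (I := 𝓘(ℝ, E))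
    (one_mem_source (E := E) (G := G))).hasMFDerivAt
  have h2 := mfderiv_extChartAt_self (I := 𝓘(ℝ, E)) (x := (1:G))
  exact h2 ▸ h

theorem hasMFDerivAt_mul_left (g x : G) :
    HasMFDerivAt 𝓘(ℝ, E) 𝓘(ℝ, E) (fun b : G => g * b) x
      (mfderiv 𝓘(ℝ, E) 𝓘(ℝ, E) (fun b : G => g * b) x) :=
  ((contMDiff_mul_left (I := 𝓘(ℝ, E)) (n := ∞) (a := g)).contMDiffAt.mdifferentiableAt
    (by simp)).hasMFDerivAt

theorem hasMFDerivAt_mul_right (g x : G) :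
    HasMFDerivAt 𝓘(ℝ, E) 𝓘(ℝ, E) (fun b : G => b * g) x
      (mfderiv 𝓘(ℝ, E) 𝓘(ℝ, E) (fun b : G => b * g) x) :=
  ((contMDiff_mul_right (I := 𝓘(ℝ, E)) (n := ∞) (a := g)).contMDiffAt.mdifferentiableAt
    (by simp)).hasMFDerivAt

variable (G) in
/-- The left-invariant frame in the chart at the identity: the differential at the identity of the
left translation by the element with coordinates `x`. -/
def leftFrame (x : E) : E →L[ℝ] E := fderiv ℝ (fun y => chartMul G (x, y)) (chartOne E G 1)

variable (G) in
/-- The right-invariant frame in the chart at the identity: the differential at the identity of the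
right translation by the element with coordinates `x`. -/
def rightFrame (x : E) : E →L[ℝ] E := fderiv ℝ (fun y => chartMul G (y, x)) (chartOne E G 1)

theorem mfderiv_chartOne_mulInvariantVectorField (ξ : GroupLieAlgebra 𝓘(ℝ, E) G) {g : G}
    (hg : g ∈ (chartOne E G).source) :
    mfderiv 𝓘(ℝ, E) 𝓘(ℝ, E) (chartOne E G) g (mulInvariantVectorField ξ g) =
      leftFrame G (chartOne E G g) ξ := by
  have hb : HasMFDerivAt 𝓘(ℝ, E) 𝓘(ℝ, E) (fun b : G => g * b)
      ((chartOne E G).symm (chartOne E G 1))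
      (mfderiv 𝓘(ℝ, E) 𝓘(ℝ, E) (fun b : G => g * b) 1) := by
    rw [chartOne_symm_one]; exact hasMFDerivAt_mul_left g 1
  have hc : HasMFDerivAt 𝓘(ℝ, E) 𝓘(ℝ, E) (chartOne E G)
      (g * (chartOne E G).symm (chartOne E G 1))
      (mfderiv 𝓘(ℝ, E) 𝓘(ℝ, E) (chartOne E G) g) := by
    rw [chartOne_symm_one, mul_one]
    exact (mdifferentiableAt_extChartAt_of_mem hg).hasMFDerivAt
  have h1 := hc.comp (chartOne E G 1) (hb.comp (chartOne E G 1) hasMFDerivAt_chartOne_symm)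
  have h2 : (fun y => chartMul G (chartOne E G g, y)) =
      (chartOne E G) ∘ (fun b : G => g * b) ∘ (chartOne E G).symm := by
    ext y
    simp only [chartMul, Function.comp]
    rw [(chartOne E G).left_inv hg]
  rw [leftFrame, h2, ← mfderiv_eq_fderiv, h1.mfderiv]
  rfl

theorem contDiffAt_leftFrame {x : E} (hx : x ∈ (chartOne E G).target) :
    ContDiffAt ℝ ∞ (leftFrame (E := E) G) x := by
  refine ContDiffAt.fderiv (n := ∞) (f := fun x y => chartMul G (x, y)) (contDiffAt_chartMul hx chartOne_mem_target ?_)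
    contDiffAt_const (by simp)
  simp only
  rw [chartOne_symm_one, mul_one]
  exact (chartOne E G).map_target hx

theorem contDiffAt_rightFrame {x : E} (hx : x ∈ (chartOne E G).target) :
    ContDiffAt ℝ ∞ (rightFrame (E := E) G) x := by
  refine ContDiffAt.fderiv (n := ∞) (f := fun x y => chartMul G (y, x)) ?_
    contDiffAt_const (by simp)
  refine ContDiffAt.comp (g := chartMul G) (f := fun z : E × E => (z.2, z.1)) _
    (contDiffAt_chartMul chartOne_mem_target hx ?_) (contDiff_snd.prodMk contDiff_fst).contDiffAt
  simp only
  rw [chartOne_symm_one, one_mul]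
  exact (chartOne E G).map_target hx

theorem leftFrame_one : leftFrame G (chartOne E G 1) = ContinuousLinearMap.id ℝ E := by
  have : (fun y => chartMul G (chartOne E G 1, y)) =ᶠ[𝓝 (chartOne E G 1)] id := by
    filter_upwards [eventually_extChartAt_target (chartOne_mem_target (E := E) (G := G))] with y hy
    simp only [chartMul]
    rw [chartOne_symm_one, one_mul, (chartOne E G).right_inv hy]; rfl
  rw [leftFrame, this.fderiv_eq, fderiv_id]

theorem rightFrame_one : rightFrame G (chartOne E G 1) = ContinuousLinearMap.id ℝ E := by
  have : (fun y => chartMul G (y, chartOne E G 1)) =ᶠ[𝓝 (chartOne E G 1)] id := by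
    filter_upwards [eventually_extChartAt_target (chartOne_mem_target (E := E) (G := G))] with y hy
    simp only [chartMul]
    rw [chartOne_symm_one, mul_one, (chartOne E G).right_inv hy]; rfl
  rw [rightFrame, this.fderiv_eq, fderiv_id]

/-- Both mixed derivatives are the mixed second derivative of the multiplication. -/
theorem fderiv_rightFrame_swap (ξ η : E) :
    fderiv ℝ (rightFrame (E := E) G) (chartOne E G 1) ξ η =
      fderiv ℝ (leftFrame (E := E) G) (chartOne E G 1) η ξ := by
  set c := chartOne E G 1
  have hc : c ∈ (chartOne E G).target := chartOne_mem_target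
  have hm : ContDiffAt ℝ ∞ (chartMul (E := E) G) (c, c) :=
    contDiffAt_chartMul hc hc (by simp only [c]; rw [chartOne_symm_one, mul_one]; exact one_mem_source)
  have hsymm : IsSymmSndFDerivAt ℝ (chartMul (E := E) G) (c, c) :=
    hm.isSymmSndFDerivAt (by simpa using (ENat.LEInfty.out : (2 : ℕ∞ω) ≤ ∞))
  have hd : ∀ᶠ z in 𝓝 (c, c), DifferentiableAt ℝ (chartMul (E := E) G) z :=
    ((hm.of_le (m := 1) (by simp)).eventually (by simp)).mono fun z hz => hz.differentiableAt (by simp)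
  have hd2 : DifferentiableAt ℝ (fderiv ℝ (chartMul (E := E) G)) (c, c) :=
    (hm.fderiv_right (m := 1) (by norm_cast)).differentiableAt (by simp)
  have hR : ∀ᶠ x in 𝓝 c, rightFrame G x η = fderiv ℝ (chartMul (E := E) G) (c, x) (η, 0) := by
    have : Tendsto (fun x : E => (c, x)) (𝓝 c) (𝓝 (c, c)) :=
      (Continuous.prodMk_right c).tendsto c
    filter_upwards [this.eventually hd] with x hx
    have h1 : HasFDerivAt (fun y => chartMul G (y, x))
      ((fderiv ℝ (chartMul (E := E) G) (c, x)).comp ((ContinuousLinearMap.id ℝ E).prod 0)) c :=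
      HasFDerivAt.comp (g := chartMul G) (f := fun y : E => (y, x)) c hx.hasFDerivAt
        ((hasFDerivAt_id c).prodMk (hasFDerivAt_const x c))
    rw [rightFrame, h1.fderiv]; simp
  have hL : ∀ᶠ x in 𝓝 c, leftFrame G x ξ = fderiv ℝ (chartMul (E := E) G) (x, c) (0, ξ) := by
    have : Tendsto (fun x : E => (x, c)) (𝓝 c) (𝓝 (c, c)) :=
      (Continuous.prodMk_left c).tendsto c
    filter_upwards [this.eventually hd] with x hx
    have h1 : HasFDerivAt (fun y => chartMul G (x, y))
      ((fderiv ℝ (chartMul (E := E) G) (x, c)).comp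
        ((0 : E →L[ℝ] E).prod (ContinuousLinearMap.id ℝ E))) c :=
      HasFDerivAt.comp (g := chartMul G) (f := fun y : E => (x, y)) c hx.hasFDerivAt
        ((hasFDerivAt_const x c).prodMk (hasFDerivAt_id c))
    rw [leftFrame, h1.fderiv]; simp
  have e1 : fderiv ℝ (rightFrame (E := E) G) c ξ η =
      fderiv ℝ (fderiv ℝ (chartMul (E := E) G)) (c, c) (0, ξ) (η, 0) := by
    have h1 : HasFDerivAt (fun x => rightFrame (E := E) G x η)
        ((fderiv ℝ (rightFrame (E := E) G) c).flip η) c := by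
      have := ((contDiffAt_rightFrame hc).differentiableAt (by simp)).hasFDerivAt
      simpa using this.clm_apply (hasFDerivAt_const η c)
    have h2 : HasFDerivAt (fun x => fderiv ℝ (chartMul (E := E) G) (c, x) (η, 0))
        (((fderiv ℝ (fderiv ℝ (chartMul (E := E) G)) (c, c)).comp
          ((0 : E →L[ℝ] E).prod (ContinuousLinearMap.id ℝ E))).flip (η, 0)) c := by
      have := (HasFDerivAt.comp (g := fderiv ℝ (chartMul (E := E) G)) (f := fun y : E => (c, y)) c
        hd2.hasFDerivAt ((hasFDerivAt_const c c).prodMk (hasFDerivAt_id c))).clm_apply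
          (hasFDerivAt_const (η, (0 : E)) c)
      simpa using this
    have := congrArg (fun L => L ξ) ((h1.congr_of_eventuallyEq (hR.mono fun _ h => h.symm)).unique h2)
    simpa using this
  have e2 : fderiv ℝ (leftFrame (E := E) G) c η ξ =
      fderiv ℝ (fderiv ℝ (chartMul (E := E) G)) (c, c) (η, 0) (0, ξ) := by
    have h1 : HasFDerivAt (fun x => leftFrame (E := E) G x ξ)
        ((fderiv ℝ (leftFrame (E := E) G) c).flip ξ) c := by
      have := ((contDiffAt_leftFrame hc).differentiableAt (by simp)).hasFDerivAt
      simpa using this.clm_apply (hasFDerivAt_const ξ c)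
    have h2 : HasFDerivAt (fun x => fderiv ℝ (chartMul (E := E) G) (x, c) (0, ξ))
        (((fderiv ℝ (fderiv ℝ (chartMul (E := E) G)) (c, c)).comp
          ((ContinuousLinearMap.id ℝ E).prod (0 : E →L[ℝ] E))).flip (0, ξ)) c := by
      have := (HasFDerivAt.comp (g := fderiv ℝ (chartMul (E := E) G)) (f := fun y : E => (y, c)) c
        hd2.hasFDerivAt ((hasFDerivAt_id c).prodMk (hasFDerivAt_const c c))).clm_apply
          (hasFDerivAt_const ((0 : E), ξ) c)
      simpa using this
    have := congrArg (fun L => L η) ((h1.congr_of_eventuallyEq (hL.mono fun _ h => h.symm)).unique h2)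
    simpa using this
  rw [e1, e2]
  exact hsymm.eq _ _

/-- The bracket of the Lie algebra is that of left-invariant fields, which are constant
combinations of the left-invariant frame. -/
theorem bracket_eq_fderiv_leftFrame (ξ η : GroupLieAlgebra 𝓘(ℝ, E) G) :
    ⁅ξ, η⁆ = fderiv ℝ (leftFrame (E := E) G) (chartOne E G 1) ξ η -
      fderiv ℝ (leftFrame (E := E) G) (chartOne E G 1) η ξ := by
  set c := chartOne E G 1
  have hc : c ∈ (chartOne E G).target := chartOne_mem_target
  have hV : ∀ ζ : GroupLieAlgebra 𝓘(ℝ, E) G,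
      VectorField.mpullbackWithin 𝓘(ℝ, E) 𝓘(ℝ, E) (chartOne E G).symm (mulInvariantVectorField ζ) univ
        =ᶠ[𝓝 c] fun x => leftFrame G x ζ := by
    intro ζ
    filter_upwards [eventually_extChartAt_target hc] with x hx
    have hs := (chartOne E G).map_target hx
    have h1 := mfderiv_chartOne_mulInvariantVectorField ζ hs
    rw [(chartOne E G).right_inv hx] at h1
    rw [VectorField.mpullbackWithin_apply, mfderivWithin_univ, ← h1]
    have hinv : (mfderiv 𝓘(ℝ, E) 𝓘(ℝ, E) (chartOne E G).symm x).inverse =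
        mfderiv 𝓘(ℝ, E) 𝓘(ℝ, E) (chartOne E G) ((chartOne E G).symm x) := by
      apply ContinuousLinearMap.inverse_eq
      · ext X
        have := mfderiv_extChartAt_symm_apply (I := 𝓘(ℝ, E)) hs X
        rw [(chartOne E G).right_inv hx] at this
        exact this
      · ext X
        have := mfderiv_extChartAt_apply (I := 𝓘(ℝ, E)) hs X
        rw [(chartOne E G).right_inv hx] at this
        exact this
    rw [hinv]
  rw [GroupLieAlgebra.bracket_def, ← VectorField.mlieBracketWithin_univ,
    VectorField.mlieBracketWithin_apply]
  have key : ∀ L : E →L[ℝ] E, L = ContinuousLinearMap.id ℝ E → ∀ w, L.inverse w = w := by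
    rintro L rfl w
    rw [ContinuousLinearMap.inverse_id]; rfl
  refine (key _ mfderiv_extChartAt_self _).trans ?_
  simp only [ModelWithCorners.range_eq_univ, preimage_univ, univ_inter]
  have key2 : ∀ V W V' W' : E → E, V =ᶠ[𝓝 c] V' → W =ᶠ[𝓝 c] W' →
      VectorField.lieBracketWithin ℝ V W univ c =
        fderiv ℝ W' c (V' c) - fderiv ℝ V' c (W' c) := by
    intro V W V' W' h h'
    rw [VectorField.lieBracketWithin_univ, h.lieBracket_vectorField_eq h',
      VectorField.lieBracket_eq]
  refine (key2 _ _ _ _ (hV ξ) (hV η)).trans ?_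
  have hd := ((contDiffAt_leftFrame (E := E) (G := G) hc).differentiableAt (by simp)).hasFDerivAt
  have h1 : ∀ ζ : E, fderiv ℝ (fun x => leftFrame (E := E) G x ζ) c =
      (fderiv ℝ (leftFrame (E := E) G) c).flip ζ := by
    intro ζ
    simpa using (hd.clm_apply (hasFDerivAt_const ζ c)).fderiv
  have hfin : ∀ ξ η : E, fderiv ℝ (fun x => leftFrame (E := E) G x η) c (leftFrame G c ξ) -
      fderiv ℝ (fun x => leftFrame (E := E) G x ξ) c (leftFrame G c η) =
      fderiv ℝ (leftFrame (E := E) G) c ξ η - fderiv ℝ (leftFrame (E := E) G) c η ξ := by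
    intro ξ η
    rw [h1, h1, leftFrame_one]
    rfl
  exact hfin ξ η

end LieGroup

/-! ### Derivatives and velocities in model spaces -/

section Velocity

variable {V : Type*} [NormedAddCommGroup V] [NormedSpace ℝ V]
  {K : Type*} [TopologicalSpace K] (I : ModelWithCorners ℝ V K)
  {M : Type*} [TopologicalSpace M] [ChartedSpace K M]
  {V' : Type*} [NormedAddCommGroup V'] [NormedSpace ℝ V']
  {K' : Type*} [TopologicalSpace K'] (I' : ModelWithCorners ℝ V' K')
  {M' : Type*} [TopologicalSpace M'] [ChartedSpace K' M']
  {V'' : Type*} [NormedAddCommGroup V''] [NormedSpace ℝ V'']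
  {K'' : Type*} [TopologicalSpace K''] (I'' : ModelWithCorners ℝ V'' K'')
  {M'' : Type*} [TopologicalSpace M''] [ChartedSpace K'' M'']

/-- `HasMFDerivAt` for a linear map between the model spaces, which are the underlying types of
the tangent spaces. -/
def HasModelDerivAt (f : M → M') (x : M) (L : V →L[ℝ] V') : Prop := HasMFDerivAt I I' f x L

/-- The derivative as a linear map between the model spaces. -/
def modelDeriv (f : M → M') (x : M) : V →L[ℝ] V' := mfderiv I I' f x

/-- The curve `γ` in a manifold has velocity `X` at time `t`. The velocity is an element of the
model space. -/
def HasVelocity (γ : ℝ → M) (t : ℝ) (X : V) : Prop :=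
  HasModelDerivAt 𝓘(ℝ, ℝ) I γ t ((1 : ℝ →L[ℝ] ℝ).smulRight X)

variable {I I' I''}

theorem _root_.MDifferentiableAt.hasModelDerivAt {f : M → M'} {x : M} (h : MDifferentiableAt I I' f x) :
    HasModelDerivAt I I' f x (modelDeriv I I' f x) := h.hasMFDerivAt

theorem HasModelDerivAt.mdifferentiableAt {f : M → M'} {x : M} {L : V →L[ℝ] V'}
    (h : HasModelDerivAt I I' f x L) : MDifferentiableAt I I' f x := HasMFDerivAt.mdifferentiableAt h

theorem HasModelDerivAt.unique {f : M → M'} {x : M} {L L' : V →L[ℝ] V'}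
    (h : HasModelDerivAt I I' f x L) (h' : HasModelDerivAt I I' f x L') : L = L' :=
  hasMFDerivAt_unique h h'

theorem HasModelDerivAt.modelDeriv_eq {f : M → M'} {x : M} {L : V →L[ℝ] V'}
    (h : HasModelDerivAt I I' f x L) : modelDeriv I I' f x = L :=
  h.mdifferentiableAt.hasModelDerivAt.unique h

theorem HasModelDerivAt.congr {f f' : M → M'} {x : M} {L : V →L[ℝ] V'}
    (h : HasModelDerivAt I I' f x L) (hf : f' =ᶠ[𝓝 x] f) : HasModelDerivAt I I' f' x L :=
  HasMFDerivAt.congr_of_eventuallyEq h hf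

theorem HasModelDerivAt.comp {f : M' → M''} {g : M → M'} {x : M} {L : V' →L[ℝ] V''}
    {L' : V →L[ℝ] V'} {y : M'} (hf : HasModelDerivAt I' I'' f y L) (hy : g x = y)
    (hg : HasModelDerivAt I I' g x L') :
    HasModelDerivAt I I'' (fun z => f (g z)) x (L.comp L') := by
  subst hy; exact HasMFDerivAt.comp x hf hg

theorem hasModelDerivAt_iff {f : V → V'} {x : V} {L : V →L[ℝ] V'} :
    HasModelDerivAt 𝓘(ℝ, V) 𝓘(ℝ, V') f x L ↔ HasFDerivAt f L x :=
  ⟨fun h => hasMFDerivAt_iff_hasFDerivAt.1 h, fun h => hasMFDerivAt_iff_hasFDerivAt.2 h⟩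

theorem hasModelDerivAt_id (x : M) : HasModelDerivAt I I (fun x : M => x) x (.id ℝ V) :=
  hasMFDerivAt_id x

theorem hasModelDerivAt_const (x : M) (y : M') : HasModelDerivAt I I' (fun _ : M => y) x 0 :=
  hasMFDerivAt_const y x

theorem HasModelDerivAt.prodMk {f : M → M'} {g : M → M''} {x : M} {L : V →L[ℝ] V'}
    {L' : V →L[ℝ] V''} (hf : HasModelDerivAt I I' f x L) (hg : HasModelDerivAt I I'' g x L') :
    HasModelDerivAt I (I'.prod I'') (fun z => (f z, g z)) x (L.prod L') :=
  HasMFDerivAt.prodMk hf hg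

theorem hasModelDerivAt_extChartAt [I.Boundaryless] [IsManifold I ∞ M] {x y : M}
    (hy : y ∈ (extChartAt I x).source) :
    HasModelDerivAt I 𝓘(ℝ, V) (extChartAt I x) y (modelDeriv I 𝓘(ℝ, V) (extChartAt I x) y) :=
  _root_.MDifferentiableAt.hasModelDerivAt (mdifferentiableAt_extChartAt_of_mem hy)

theorem hasModelDerivAt_extChartAt_symm [I.Boundaryless] [IsManifold I ∞ M] {x : M} {z : V}
    (hz : z ∈ (extChartAt I x).target) :
    HasModelDerivAt 𝓘(ℝ, V) I (extChartAt I x).symm z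
      (modelDeriv 𝓘(ℝ, V) I (extChartAt I x).symm z) :=
  _root_.MDifferentiableAt.hasModelDerivAt (mdifferentiableAt_extChartAt_symm_of_mem hz)

theorem modelDeriv_symm_modelDeriv [I.Boundaryless] [IsManifold I ∞ M] {x y : M}
    (hy : y ∈ (extChartAt I x).source) (X : V) :
    modelDeriv 𝓘(ℝ, V) I (extChartAt I x).symm (extChartAt I x y)
      (modelDeriv I 𝓘(ℝ, V) (extChartAt I x) y X) = X :=
  mfderiv_extChartAt_symm_apply hy X

theorem modelDeriv_modelDeriv_symm [I.Boundaryless] [IsManifold I ∞ M] {x y : M}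
    (hy : y ∈ (extChartAt I x).source) (X : V) :
    modelDeriv I 𝓘(ℝ, V) (extChartAt I x) y
      (modelDeriv 𝓘(ℝ, V) I (extChartAt I x).symm (extChartAt I x y) X) = X :=
  mfderiv_extChartAt_apply hy X

theorem HasVelocity.comp {γ : ℝ → M} {t : ℝ} {X : V} (h : HasVelocity I γ t X) {f : M → M'}
    {L : V →L[ℝ] V'} {x : M} (hf : HasModelDerivAt I I' f x L) (hx : γ t = x) :
    HasVelocity I' (fun s => f (γ s)) t (L X) := by
  have h2 := HasModelDerivAt.comp hf hx h
  have h3 : (L.comp ((1 : ℝ →L[ℝ] ℝ).smulRight X)) = (1 : ℝ →L[ℝ] ℝ).smulRight (L X) := by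
    ext; simp
  rwa [h3] at h2

theorem hasVelocity_iff_hasDerivAt {γ : ℝ → V} {t : ℝ} {X : V} :
    HasVelocity 𝓘(ℝ, V) γ t X ↔ HasDerivAt γ X t := by
  have h3 : ContinuousLinearMap.toSpanSingleton ℝ X = (1 : ℝ →L[ℝ] ℝ).smulRight X := by ext; simp
  rw [HasVelocity, hasModelDerivAt_iff, hasDerivAt_iff_hasFDerivAt, ← h3]

theorem HasDerivAt.hasVelocity {γ : ℝ → V} {t : ℝ} {X : V} (h : HasDerivAt γ X t) :
    HasVelocity 𝓘(ℝ, V) γ t X := hasVelocity_iff_hasDerivAt.2 h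

theorem HasVelocity.hasDerivAt {γ : ℝ → V} {t : ℝ} {X : V} (h : HasVelocity 𝓘(ℝ, V) γ t X) :
    HasDerivAt γ X t := hasVelocity_iff_hasDerivAt.1 h

theorem HasVelocity.unique {γ : ℝ → M} {t : ℝ} {X Y : V} (h : HasVelocity I γ t X)
    (h' : HasVelocity I γ t Y) : X = Y := by
  have h1 : ((1 : ℝ →L[ℝ] ℝ).smulRight X : ℝ →L[ℝ] V) = (1 : ℝ →L[ℝ] ℝ).smulRight Y :=
    HasModelDerivAt.unique h h'
  simpa using congrArg (fun L => L 1) h1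

theorem HasVelocity.continuousAt {γ : ℝ → M} {t : ℝ} {X : V} (h : HasVelocity I γ t X) :
    ContinuousAt γ t := HasMFDerivAt.continuousAt h

theorem HasVelocity.congr {γ γ' : ℝ → M} {t : ℝ} {X : V} (h : HasVelocity I γ t X)
    (hγ : γ' =ᶠ[𝓝 t] γ) : HasVelocity I γ' t X :=
  HasMFDerivAt.congr_of_eventuallyEq h hγ

theorem hasVelocity_const (x : M) (t : ℝ) : HasVelocity I (fun _ => x) t 0 := by
  have h2 : ((1 : ℝ →L[ℝ] ℝ).smulRight (0 : V) : ℝ →L[ℝ] V) = 0 := by ext; simp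
  unfold HasVelocity
  rw [h2]; exact hasModelDerivAt_const t x

theorem HasVelocity.comp_hasDerivAt {γ : ℝ → M} {t s a : ℝ} {X : V} {f : ℝ → ℝ}
    (hs : f t = s) (h : HasVelocity I γ s X) (hf : HasDerivAt f a t) :
    HasVelocity I (fun u => γ (f u)) t (a • X) := by
  have h1 := (HasDerivAt.hasVelocity hf).comp h hs
  simpa using h1

theorem eq_of_hasVelocity_zero [I.Boundaryless] [IsManifold I ∞ M] [T2Space M] {γ : ℝ → M}
    (h : ∀ t, HasVelocity I γ t 0) (s t : ℝ) : γ s = γ t := by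
  have hloc : IsLocallyConstant γ := by
    rw [IsLocallyConstant.iff_eventually_eq]
    intro t
    have hc : Continuous γ := continuous_iff_continuousAt.2 fun t => (h t).continuousAt
    have hev := hc.continuousAt.eventually
      (eventually_extChartAt_source (I := I) (mem_extChartAt_source (I := I) (γ t)))
    obtain ⟨ε, hε, hball⟩ := Metric.eventually_nhds_iff_ball.1 hev
    have hconst : ∀ u ∈ Metric.ball t ε, extChartAt I (γ t) (γ u) = extChartAt I (γ t) (γ t) := by
      intro u hu
      refine Convex.is_const_of_fderivWithin_eq_zero (convex_ball t ε) (𝕜 := ℝ)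
        (f := fun u => extChartAt I (γ t) (γ u)) ?_ ?_ hu (Metric.mem_ball_self hε)
      · intro w hw
        have h1 := hasVelocity_iff_hasDerivAt.1 ((h w).comp
          (hasModelDerivAt_extChartAt (hball w hw)) rfl)
        exact h1.differentiableAt.differentiableWithinAt
      · intro w hw
        have h1 := hasVelocity_iff_hasDerivAt.1 ((h w).comp
          (hasModelDerivAt_extChartAt (hball w hw)) rfl)
        rw [fderivWithin_of_isOpen Metric.isOpen_ball hw]
        have h2 := h1.hasFDerivAt.fderiv
        rw [h2]; ext; simp
    filter_upwards [Metric.ball_mem_nhds t hε] with u hu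
    exact (extChartAt I (γ t)).injOn (hball u hu) (mem_extChartAt_source _) (hconst u hu)
  exact hloc.apply_eq_of_preconnectedSpace s t

end Velocity

/-! ### The adjoint representation -/

section LieGroup

variable {E : Type*} [NormedAddCommGroup E] [NormedSpace ℝ E] [FiniteDimensional ℝ E]
  {G : Type*} [TopologicalSpace G] [Group G] [ChartedSpace E G] [LieGroup 𝓘(ℝ, E) ∞ G]

variable (G) in
/-- The bracket of the Lie algebra of `G`, as an operation on the model space `E`, which is the
underlying type of the Lie algebra. -/
def lieBr (ξ η : E) : E :=
  Bracket.bracket (L := GroupLieAlgebra 𝓘(ℝ, E) G) (M := GroupLieAlgebra 𝓘(ℝ, E) G) ξ η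

/-- The adjoint representation. -/
def Ad (g : G) : E →L[ℝ] E := modelDeriv 𝓘(ℝ, E) 𝓘(ℝ, E) (fun x : G => g * x * g⁻¹) 1

theorem contMDiff_conj : ContMDiff (𝓘(ℝ, E).prod 𝓘(ℝ, E)) 𝓘(ℝ, E) ∞
    (fun p : G × G => p.1 * p.2 * p.1⁻¹) :=
  (contMDiff_fst.mul contMDiff_snd).mul contMDiff_fst.inv

theorem contMDiff_conj_right (g : G) :
    ContMDiff 𝓘(ℝ, E) 𝓘(ℝ, E) ∞ (fun x : G => g * x * g⁻¹) :=
  contMDiff_conj.comp (contMDiff_const.prodMk contMDiff_id)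

theorem hasModelDerivAt_conj (g : G) :
    HasModelDerivAt 𝓘(ℝ, E) 𝓘(ℝ, E) (fun x : G => g * x * g⁻¹) 1 (Ad g) :=
  _root_.MDifferentiableAt.hasModelDerivAt ((contMDiff_conj_right g).mdifferentiableAt (by simp))

theorem Ad_one : Ad (1 : G) = ContinuousLinearMap.id ℝ E := by
  apply HasModelDerivAt.modelDeriv_eq
  have : (fun x : G => 1 * x * 1⁻¹) = fun x => x := by ext; simp
  rw [this]
  exact hasModelDerivAt_id 1

theorem Ad_mul (g h : G) : Ad (g * h) = (Ad g).comp (Ad h : E →L[ℝ] E) := by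
  apply HasModelDerivAt.modelDeriv_eq
  have h2 := (hasModelDerivAt_conj (E := E) g).comp (by group) (hasModelDerivAt_conj (E := E) h)
  have h3 : (fun x : G => g * h * x * (g * h)⁻¹) = (fun x : G => g * (h * x * h⁻¹) * g⁻¹) := by
    ext x; group
  rw [h3]; exact h2

theorem Ad_mul_apply (g h : G) (ξ : E) : Ad (g * h) ξ = Ad g (Ad h ξ) := by
  rw [Ad_mul]; rfl

theorem Ad_inv_Ad (g : G) (ξ : E) : Ad g⁻¹ (Ad g ξ) = ξ := by
  rw [← Ad_mul_apply, inv_mul_cancel, Ad_one]; rfl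

theorem Ad_Ad_inv (g : G) (ξ : E) : Ad g (Ad g⁻¹ ξ) = ξ := by
  rw [← Ad_mul_apply, mul_inv_cancel, Ad_one]; rfl

theorem contMDiff_Ad : ContMDiff 𝓘(ℝ, E) 𝓘(ℝ, E →L[ℝ] E) ∞ (Ad : G → E →L[ℝ] E) := by
  intro g₀
  have h := ContMDiffAt.mfderiv (n := ∞) (m := ∞) (x₀ := g₀) (I := 𝓘(ℝ, E)) (I' := 𝓘(ℝ, E))
    (fun (g x : G) => g * x * g⁻¹) (fun _ => 1) (contMDiff_conj (E := E) (G := G)).contMDiffAt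
    contMDiffAt_const (by simp)
  have h1 : (fun g : G => g * 1 * g⁻¹) = fun _ => 1 := by ext; simp
  rw [h1] at h
  have key : ∀ (φ : G → E →L[ℝ] E) (g : G),
      inTangentCoordinates 𝓘(ℝ, E) 𝓘(ℝ, E) (fun _ : G => (1 : G)) (fun _ : G => (1 : G)) φ g₀ g =
        φ g := by
    intro φ g
    rw [inTangentCoordinates_eq _ _ _ (by simp) (by simp)]
    ext ξ
    have hc := fun v => (tangentBundleCore 𝓘(ℝ, E) G).coordChange_self (achart E (1 : G)) 1
      (mem_chart_source E 1) v
    exact (hc _).trans (congrArg _ (hc ξ))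
  exact h.congr_of_eventuallyEq (Eventually.of_forall fun g => (key _ g).symm)

theorem continuous_Ad : Continuous (Ad : G → E →L[ℝ] E) := (contMDiff_Ad (E := E)).continuous

/-- The identity `g y = (g y g⁻¹) g`, differentiated in `y` at the identity. -/
theorem rightFrame_Ad {g : G} (hg : g ∈ (chartOne E G).source) (η : E) :
    rightFrame G (chartOne E G g) (Ad g η) = leftFrame G (chartOne E G g) η := by
  set x := chartOne E G g
  set c := chartOne E G 1
  have hx : x ∈ (chartOne E G).target := (chartOne E G).map_source hg
  have hgx : (chartOne E G).symm x = g := (chartOne E G).left_inv hg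
  have hc : c ∈ (chartOne E G).target := chartOne_mem_target
  -- The differential of the conjugation by `g`, read in the chart at the identity.
  have hC : HasFDerivAt (fun y => chartOne E G (g * (chartOne E G).symm y * g⁻¹)) (Ad g) c := by
    have h1 : HasModelDerivAt 𝓘(ℝ, E) 𝓘(ℝ, E) (chartOne E G).symm c (.id ℝ E) :=
      hasMFDerivAt_chartOne_symm
    have h2 : HasModelDerivAt 𝓘(ℝ, E) 𝓘(ℝ, E) (chartOne E G) (1 : G) (.id ℝ E) :=
      hasMFDerivAt_chartOne
    have h3 := hasModelDerivAt_iff.1 (h2.comp (by rw [chartOne_symm_one]; group)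
      ((hasModelDerivAt_conj g).comp chartOne_symm_one h1))
    simpa only [ContinuousLinearMap.comp_id, ContinuousLinearMap.id_comp] using h3
  have hCc : chartOne E G (g * (chartOne E G).symm c * g⁻¹) = c := by
    rw [chartOne_symm_one, mul_one, mul_inv_cancel]
  have hP : HasFDerivAt (fun y => chartMul G (y, x)) (rightFrame G x) c := by
    refine DifferentiableAt.hasFDerivAt ?_
    refine DifferentiableAt.comp (g := chartMul G) (f := fun y : E => (y, x)) c
      ((contDiffAt_chartMul hc hx ?_).differentiableAt (by simp)) (by fun_prop)
    simp only [c]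
    rw [chartOne_symm_one, one_mul, hgx]; exact hg
  have hPC := HasFDerivAt.comp (g := fun y => chartMul G (y, x))
    (f := fun y => chartOne E G (g * (chartOne E G).symm y * g⁻¹)) c (by rw [hCc]; exact hP) hC
  have hev : (fun y => chartMul G (x, y)) =ᶠ[𝓝 c] (fun y => chartMul G (y, x)) ∘
      (fun y => chartOne E G (g * (chartOne E G).symm y * g⁻¹)) := by
    have hcont : ContinuousAt (fun y => g * (chartOne E G).symm y * g⁻¹) c := by
      have h1 : ContinuousAt (chartOne E G).symm c :=
        (contMDiffAt_extChartAt_symm_of_mem (I := 𝓘(ℝ, E)) hc).continuousAt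
      have h2 : Continuous (fun b : G => g * b * g⁻¹) :=
        (contMDiff_conj_right (E := E) g).continuous
      exact h2.continuousAt.comp h1
    have hmem : g * (chartOne E G).symm c * g⁻¹ ∈ (chartOne E G).source := by
      rw [chartOne_symm_one, mul_one, mul_inv_cancel]; exact one_mem_source
    filter_upwards [hcont.eventually (eventually_extChartAt_source hmem)] with y hy
    simp only [Function.comp, chartMul]
    rw [hgx, (chartOne E G).left_inv hy]
    congr 1; group
  rw [leftFrame, hev.fderiv_eq, hPC.fderiv]
  rfl

/-- The differential of the adjoint representation is the bracket: differentiate `rightFrame_Ad` along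
`γ`, using that the derivatives of the two frames are exchanged by `fderiv_rightFrame_swap`. -/
theorem hasDerivAt_Ad {γ : ℝ → G} (h0 : γ 0 = 1) {ξ : E}
    (hγ : HasVelocity 𝓘(ℝ, E) γ 0 ξ) (η : E) :
    HasDerivAt (fun t => Ad (γ t) η) (lieBr G ξ η) 0 := by
  set c := chartOne E G 1
  have hc : c ∈ (chartOne E G).target := chartOne_mem_target
  have hAd : MDifferentiableAt 𝓘(ℝ, E) 𝓘(ℝ, E →L[ℝ] E) (Ad : G → E →L[ℝ] E) (γ 0) :=
    (contMDiff_Ad (E := E) (G := G)).mdifferentiableAt (by simp)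
  have h1 := (hγ.comp (MDifferentiableAt.hasModelDerivAt hAd) rfl).hasDerivAt
  set A' : E →L[ℝ] E := modelDeriv 𝓘(ℝ, E) 𝓘(ℝ, E →L[ℝ] E) (Ad : G → E →L[ℝ] E) (γ 0) ξ
  have hx : HasDerivAt (fun s => chartOne E G (γ s)) ξ 0 :=
    (hγ.comp (I' := 𝓘(ℝ, E)) (L := .id ℝ E) hasMFDerivAt_chartOne h0).hasDerivAt
  have hAη : HasDerivAt (fun t => Ad (γ t) η) (A' η) 0 := by
    simpa using h1.clm_apply (hasDerivAt_const (0 : ℝ) η)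
  have e0 : chartOne E G (γ 0) = c := by rw [h0]
  have hP : HasDerivAt (fun t => rightFrame G (chartOne E G (γ t)))
      (fderiv ℝ (rightFrame (E := E) G) c ξ) 0 :=
    HasFDerivAt.comp_hasDerivAt_of_eq (0 : ℝ)
      ((contDiffAt_rightFrame (E := E) (G := G) hc).differentiableAt (by simp)).hasFDerivAt hx e0.symm
  have hF : HasDerivAt (fun t => leftFrame G (chartOne E G (γ t)))
      (fderiv ℝ (leftFrame (E := E) G) c ξ) 0 :=
    HasFDerivAt.comp_hasDerivAt_of_eq (0 : ℝ)
      ((contDiffAt_leftFrame (E := E) (G := G) hc).differentiableAt (by simp)).hasFDerivAt hx e0.symm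
  have hFη := hF.clm_apply (hasDerivAt_const (0 : ℝ) (η : E))
  have hPA := hP.clm_apply hAη
  have hev : (fun t => rightFrame G (chartOne E G (γ t)) (Ad (γ t) η)) =ᶠ[𝓝 0]
      fun t => leftFrame G (chartOne E G (γ t)) η := by
    have : (γ 0) ∈ (chartOne E G).source := by rw [h0]; exact one_mem_source
    filter_upwards [hγ.continuousAt.eventually (eventually_extChartAt_source this)] with t ht
    exact rightFrame_Ad ht η
  have huniq := (hFη.congr_of_eventuallyEq hev).unique hPA
  rw [e0, h0, Ad_one, rightFrame_one] at huniq
  have hfin : A' η = lieBr G ξ η := by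
    refine Eq.trans ?_ (bracket_eq_fderiv_leftFrame (G := G) ξ η).symm
    rw [← fderiv_rightFrame_swap ξ η]
    simp at huniq
    exact eq_sub_of_add_eq' huniq.symm
  rw [← hfin]
  exact hAη

end LieGroup

/-! ### One-parameter subgroups -/

section OneParam

variable {E : Type*} [NormedAddCommGroup E] [NormedSpace ℝ E] [FiniteDimensional ℝ E]
  {G : Type*} [TopologicalSpace G] [Group G] [ChartedSpace E G] [LieGroup 𝓘(ℝ, E) ∞ G]

theorem lieBr_add_left (ξ ξ' η : E) : lieBr G (ξ + ξ') η = lieBr G ξ η + lieBr G ξ' η := by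
  have := FiniteDimensional.complete ℝ E
  exact add_lie (L := GroupLieAlgebra 𝓘(ℝ, E) G) (M := GroupLieAlgebra 𝓘(ℝ, E) G) ξ ξ' η

theorem lieBr_add_right (ξ η η' : E) : lieBr G ξ (η + η') = lieBr G ξ η + lieBr G ξ η' := by
  have := FiniteDimensional.complete ℝ E
  exact lie_add (L := GroupLieAlgebra 𝓘(ℝ, E) G) (M := GroupLieAlgebra 𝓘(ℝ, E) G) ξ η η'

theorem lieBr_smul_left (a : ℝ) (ξ η : E) : lieBr G (a • ξ) η = a • lieBr G ξ η := by
  have := FiniteDimensional.complete ℝ E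
  exact smul_lie (L := GroupLieAlgebra 𝓘(ℝ, E) G) (M := GroupLieAlgebra 𝓘(ℝ, E) G) a ξ η

theorem lieBr_smul_right (a : ℝ) (ξ η : E) : lieBr G ξ (a • η) = a • lieBr G ξ η := by
  have := FiniteDimensional.complete ℝ E
  exact lie_smul (L := GroupLieAlgebra 𝓘(ℝ, E) G) (M := GroupLieAlgebra 𝓘(ℝ, E) G) a ξ η

theorem lieBr_self (ξ : E) : lieBr G ξ ξ = 0 := by
  have := FiniteDimensional.complete ℝ E
  exact lie_self (L := GroupLieAlgebra 𝓘(ℝ, E) G) ξ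

theorem lieBr_skew (ξ η : E) : -lieBr G η ξ = lieBr G ξ η := by
  have := FiniteDimensional.complete ℝ E
  exact lie_skew (L := GroupLieAlgebra 𝓘(ℝ, E) G) ξ η

variable (G) in
/-- The bracket as a bilinear map. -/
def lieBilin : E →ₗ[ℝ] E →ₗ[ℝ] E :=
  LinearMap.mk₂ ℝ (lieBr G) lieBr_add_left lieBr_smul_left lieBr_add_right lieBr_smul_right

/-- The left-invariant vector field of `ξ`. -/
def leftField (ξ : E) (g : G) : E := modelDeriv 𝓘(ℝ, E) 𝓘(ℝ, E) (fun b : G => g * b) 1 ξ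

theorem hasModelDerivAt_mul_left (g x : G) :
    HasModelDerivAt 𝓘(ℝ, E) 𝓘(ℝ, E) (fun b : G => g * b) x
      (modelDeriv 𝓘(ℝ, E) 𝓘(ℝ, E) (fun b : G => g * b) x) := hasMFDerivAt_mul_left g x

theorem hasModelDerivAt_mul_right (g x : G) :
    HasModelDerivAt 𝓘(ℝ, E) 𝓘(ℝ, E) (fun b : G => b * g) x
      (modelDeriv 𝓘(ℝ, E) 𝓘(ℝ, E) (fun b : G => b * g) x) := hasMFDerivAt_mul_right g x

theorem leftField_mul (ξ : E) (g h : G) :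
    leftField ξ (g * h) = modelDeriv 𝓘(ℝ, E) 𝓘(ℝ, E) (fun b : G => g * b) h (leftField ξ h) := by
  have h1 := (hasModelDerivAt_mul_left (E := E) g h).comp (mul_one h)
    (hasModelDerivAt_mul_left (E := E) h 1)
  have h2 : (fun b : G => g * h * b) = fun b => g * (h * b) := by ext; group
  rw [leftField, h2, h1.modelDeriv_eq]; rfl

/-- `γ` is a one-parameter subgroup with velocity `ξ`. -/
structure IsOneParam (γ : ℝ → G) (ξ : E) : Prop where
  add : ∀ s t, γ (s + t) = γ s * γ t
  vel : HasVelocity 𝓘(ℝ, E) γ 0 ξ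

theorem IsOneParam.zero {γ : ℝ → G} {ξ : E} (h : IsOneParam γ ξ) : γ 0 = 1 := by
  have := h.add 0 0
  simpa using this

theorem IsOneParam.hasVelocity {γ : ℝ → G} {ξ : E} (h : IsOneParam γ ξ) (t : ℝ) :
    HasVelocity 𝓘(ℝ, E) γ t (leftField ξ (γ t)) := by
  have h1 : HasVelocity 𝓘(ℝ, E) (fun u => γ (u - t)) t ((1 : ℝ) • ξ) :=
    h.vel.comp_hasDerivAt (sub_self t) ((hasDerivAt_id t).sub_const t)
  have h2 := h1.comp (hasModelDerivAt_mul_left (E := E) (γ t) 1) (by simp [h.zero])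
  rw [one_smul] at h2
  exact h2.congr (Eventually.of_forall fun u => by simp only; rw [← h.add]; congr 1; ring)

theorem IsOneParam.continuous {γ : ℝ → G} {ξ : E} (h : IsOneParam γ ξ) : Continuous γ :=
  continuous_iff_continuousAt.2 fun t => (h.hasVelocity t).continuousAt

theorem contMDiff_mulInvariantVectorField_one (ξ : GroupLieAlgebra 𝓘(ℝ, E) G) :
    ContMDiff 𝓘(ℝ, E) 𝓘(ℝ, E).tangent 1
      (fun g : G => (⟨g, mulInvariantVectorField ξ g⟩ : TangentBundle 𝓘(ℝ, E) G)) :=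
  (contMDiff_mulInvariantVectorField ξ).of_le (by
    rw [minSmoothness_of_isRCLikeNormedField]; norm_num)

theorem IsOneParam.unique [T2Space G] {γ γ' : ℝ → G} {ξ : E} (h : IsOneParam γ ξ)
    (h' : IsOneParam γ' ξ) : γ = γ' := by
  have := FiniteDimensional.complete ℝ E
  exact isMIntegralCurve_Ioo_eq_of_contMDiff_boundaryless (t₀ := 0)
    (contMDiff_mulInvariantVectorField_one (E := E) (G := G) ξ)
    (fun t => h.hasVelocity t) (fun t => h'.hasVelocity t) (by rw [h.zero, h'.zero])

/-- Integral curves of smooth vector fields are smooth. -/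
theorem contDiffOn_of_hasDerivAt_contDiffOn {W : Type*} [NormedAddCommGroup W] [NormedSpace ℝ W]
    {x : ℝ → W} {v : W → W} {O : Set W} {J : Set ℝ} (hJ : IsOpen J) (hmaps : MapsTo x J O)
    (hv : ContDiffOn ℝ ∞ v O) (hx : ∀ t ∈ J, HasDerivAt x (v (x t)) t) : ContDiffOn ℝ ∞ x J := by
  rw [contDiffOn_infty]
  intro n
  induction n with
  | zero =>
    exact contDiffOn_zero.2 fun t ht => (hx t ht).continuousAt.continuousWithinAt
  | succ n ih =>
    rw [Nat.cast_succ, contDiffOn_succ_iff_deriv_of_isOpen hJ]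
    refine ⟨fun t ht => (hx t ht).differentiableAt.differentiableWithinAt, by simp, ?_⟩
    refine ((hv.of_le (by exact_mod_cast le_top)).comp ih hmaps).congr fun t ht => ?_
    exact (hx t ht).deriv

/-- Near `0`, the one-parameter subgroup solves a differential equation with smooth coefficients in
the chart at the identity; elsewhere it is a translate of this piece. -/
theorem IsOneParam.contMDiff {γ : ℝ → G} {ξ : E} (h : IsOneParam γ ξ) :
    ContMDiff 𝓘(ℝ, ℝ) 𝓘(ℝ, E) ∞ γ := by
  set J : Set ℝ := γ ⁻¹' (chartOne E G).source
  have hJ : IsOpen J := (isOpen_extChartAt_source (I := 𝓘(ℝ, E)) (1 : G)).preimage h.continuous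
  have h0 : (0 : ℝ) ∈ J := by
    rw [mem_preimage, h.zero]; exact one_mem_source
  have hsm : ContDiffOn ℝ ∞ (fun t => chartOne E G (γ t)) J := by
    refine contDiffOn_of_hasDerivAt_contDiffOn (O := (chartOne E G).target)
      (v := fun x => leftFrame G x ξ) hJ (fun t ht => (chartOne E G).map_source ht) ?_ ?_
    · intro x hx
      exact ((contDiffAt_leftFrame hx).clm_apply contDiffAt_const).contDiffWithinAt
    · intro t ht
      have h1 := ((h.hasVelocity t).comp (hasModelDerivAt_extChartAt ht) rfl).hasDerivAt
      have h2 : modelDeriv 𝓘(ℝ, E) 𝓘(ℝ, E) (chartOne E G) (γ t) (leftField ξ (γ t)) =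
          leftFrame G (chartOne E G (γ t)) ξ := mfderiv_chartOne_mulInvariantVectorField ξ ht
      rw [h2] at h1
      exact h1
  have hat0 : ContMDiffAt 𝓘(ℝ, ℝ) 𝓘(ℝ, E) ∞ γ 0 := by
    have h1 : ContMDiffAt 𝓘(ℝ, ℝ) 𝓘(ℝ, E) ∞ (fun t => (chartOne E G).symm (chartOne E G (γ t))) 0 :=
      ContMDiffAt.comp (0 : ℝ) (contMDiffAt_extChartAt_symm_of_mem ((chartOne E G).map_source h0))
        (hsm.contDiffAt (hJ.mem_nhds h0)).contMDiffAt
    refine h1.congr_of_eventuallyEq ?_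
    filter_upwards [hJ.mem_nhds h0] with t ht
    exact ((chartOne E G).left_inv ht).symm
  intro t
  have h1 : ContMDiffAt 𝓘(ℝ, ℝ) 𝓘(ℝ, E) ∞ (fun u => γ t * γ (u - t)) t := by
    refine contMDiffAt_const.mul ?_
    refine ContMDiffAt.comp (I' := 𝓘(ℝ, ℝ)) (g := γ) (f := fun u : ℝ => u - t) t ?_ ?_
    · simpa using hat0
    · exact (contDiff_id.sub contDiff_const).contMDiff.contMDiffAt
  refine h1.congr_of_eventuallyEq (Eventually.of_forall fun u => ?_)
  simp only; rw [← h.add]; congr 1; ring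

/-- Left translates of a local integral curve of the left-invariant field have a common time of
existence, so there is a global integral curve; it is a homomorphism by uniqueness. -/
theorem exists_isOneParam [T2Space G] (ξ : E) : ∃ γ : ℝ → G, IsOneParam γ ξ := by
  have := FiniteDimensional.complete ℝ E
  set v := fun g : G => mulInvariantVectorField (I := 𝓘(ℝ, E)) (G := G) ξ g
  have hv := contMDiff_mulInvariantVectorField_one (E := E) (G := G) ξ
  have htrans : ∀ (x : G) (γ : ℝ → G) (t : ℝ), HasVelocity 𝓘(ℝ, E) γ t (leftField ξ (γ t)) →
      HasVelocity 𝓘(ℝ, E) (fun s => x * γ s) t (leftField ξ (x * γ t)) := by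
    intro x γ t h
    rw [leftField_mul]
    exact h.comp (hasModelDerivAt_mul_left x (γ t)) rfl
  obtain ⟨γ, hγ0, hγ⟩ := exists_isMIntegralCurveAt_of_contMDiffAt_boundaryless
    (I := 𝓘(ℝ, E)) (v := v) (t₀ := 0) (x₀ := (1 : G)) (hv.contMDiffAt)
  obtain ⟨ε, hε, hball⟩ := Metric.eventually_nhds_iff_ball.1 hγ
  obtain ⟨δ, hδ0, hδ⟩ := exists_isMIntegralCurve_of_isMIntegralCurveOn (I := 𝓘(ℝ, E)) (v := v) hv hε
    (fun x => ⟨fun s => x * γ s, by simp [hγ0], fun t ht => by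
      have ht' : t ∈ Metric.ball (0 : ℝ) ε := by rw [Real.ball_eq_Ioo]; simpa using ht
      exact HasMFDerivAt.hasMFDerivWithinAt (htrans x γ t (hball t ht'))⟩) 1
  refine ⟨δ, fun s t => ?_, ?_⟩
  · have h1 : IsMIntegralCurve (I := 𝓘(ℝ, E)) (fun t => δ s * δ t) v :=
      fun t => htrans (δ s) δ t (hδ t)
    have h2 : IsMIntegralCurve (I := 𝓘(ℝ, E)) (δ ∘ (· + s)) v := hδ.comp_add s
    have h3 := isMIntegralCurve_Ioo_eq_of_contMDiff_boundaryless (t₀ := 0) hv h2 h1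
      (by simp [hδ0])
    have := congrFun h3 t
    simpa [add_comm] using this
  · have h1 : HasVelocity 𝓘(ℝ, E) δ 0 (leftField ξ (δ 0)) := hδ 0
    have h2 : leftField (G := G) ξ 1 = ξ := by
      have h3 : (fun b : G => 1 * b) = fun b => b := by ext; simp
      rw [leftField, h3, (hasModelDerivAt_id (I := 𝓘(ℝ, E)) (1 : G)).modelDeriv_eq]; rfl
    rwa [hδ0, h2] at h1

variable [T2Space G]

variable (G) in
/-- The one-parameter subgroup `t ↦ exp(tξ)`. -/
def oneParam (ξ : E) : ℝ → G := (exists_isOneParam ξ).choose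

theorem isOneParam_oneParam (ξ : E) : IsOneParam (oneParam G ξ) ξ := (exists_isOneParam ξ).choose_spec

theorem oneParam_zero (ξ : E) : oneParam G ξ 0 = 1 := (isOneParam_oneParam ξ).zero

theorem oneParam_add (ξ : E) (s t : ℝ) : oneParam G ξ (s + t) = oneParam G ξ s * oneParam G ξ t :=
  (isOneParam_oneParam ξ).add s t

theorem hasVelocity_oneParam (ξ : E) : HasVelocity 𝓘(ℝ, E) (oneParam G ξ) 0 ξ :=
  (isOneParam_oneParam ξ).vel

theorem contMDiff_oneParam (ξ : E) : ContMDiff 𝓘(ℝ, ℝ) 𝓘(ℝ, E) ∞ (oneParam G ξ) :=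
  (isOneParam_oneParam ξ).contMDiff

theorem conj_oneParam (g : G) (ξ : E) (t : ℝ) :
    g * oneParam G ξ t * g⁻¹ = oneParam G (Ad g ξ) t := by
  have h : IsOneParam (fun t => g * oneParam G ξ t * g⁻¹) (Ad g ξ) := by
    refine ⟨fun s t => ?_, ?_⟩
    · rw [oneParam_add]; group
    · exact (hasVelocity_oneParam ξ).comp (hasModelDerivAt_conj g) (oneParam_zero ξ)
  exact congrFun (h.unique (isOneParam_oneParam _)) t

theorem hasDerivAt_Ad_oneParam (ξ η : E) (t : ℝ) :
    HasDerivAt (fun t => Ad (oneParam G ξ t) η) (Ad (oneParam G ξ t) (lieBr G ξ η)) t := by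
  have h1 := hasDerivAt_Ad (oneParam_zero ξ) (hasVelocity_oneParam (G := G) ξ) η
  have h2 : HasDerivAt (fun s => Ad (oneParam G ξ (s - t)) η) ((1 : ℝ) • lieBr G ξ η) t :=
    HasDerivAt.scomp_of_eq t h1 ((hasDerivAt_id t).sub_const t) (by simp)
  rw [one_smul] at h2
  have h3 := (Ad (oneParam G ξ t) : E →L[ℝ] E).hasFDerivAt.comp_hasDerivAt t h2
  refine h3.congr_of_eventuallyEq (Eventually.of_forall fun s => ?_)
  simp only [Function.comp]
  rw [← Ad_mul_apply, ← oneParam_add]; congr 3; ring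

theorem Ad_oneParam_of_lieBr_eq_zero {ξ η : E} (h : lieBr G ξ η = 0) (t : ℝ) :
    Ad (oneParam G ξ t) η = η := by
  have h1 : ∀ t, HasDerivAt (fun t => Ad (oneParam G ξ t) η) 0 t := by
    intro t
    have := hasDerivAt_Ad_oneParam (G := G) ξ η t
    rwa [h, map_zero] at this
  have h2 := is_const_of_deriv_eq_zero (fun t => (h1 t).differentiableAt) (fun t => (h1 t).deriv) t 0
  simpa [oneParam_zero, Ad_one] using h2

theorem commute_oneParam {ξ η : E} (h : lieBr G ξ η = 0) (s t : ℝ) :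
    Commute (oneParam G ξ s) (oneParam G η t) := by
  have h1 := conj_oneParam (oneParam G ξ s) η t
  rw [Ad_oneParam_of_lieBr_eq_zero h] at h1
  exact mul_inv_eq_iff_eq_mul.1 h1

theorem lieBr_Ad (g : G) (ξ η : E) : lieBr G (Ad g ξ) (Ad g η) = Ad g (lieBr G ξ η) := by
  have h1 : HasVelocity 𝓘(ℝ, E) (fun t => g * oneParam G ξ t * g⁻¹) 0 (Ad g ξ) :=
    (hasVelocity_oneParam ξ).comp (hasModelDerivAt_conj g) (oneParam_zero ξ)
  have h2 := hasDerivAt_Ad (by simp [oneParam_zero]) h1 (Ad g η)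
  have h3 := (Ad g : E →L[ℝ] E).hasFDerivAt.comp_hasDerivAt (0 : ℝ)
    (hasDerivAt_Ad (oneParam_zero ξ) (hasVelocity_oneParam (G := G) ξ) η)
  refine (h2.congr_of_eventuallyEq (Eventually.of_forall fun s => ?_)).unique h3 |> fun h => h
  simp only [Function.comp]
  rw [← Ad_mul_apply, ← Ad_mul_apply]; congr 2; group

theorem hasModelDerivAt_mul_one_one :
    HasModelDerivAt (𝓘(ℝ, E).prod 𝓘(ℝ, E)) 𝓘(ℝ, E) (fun p : G × G => p.1 * p.2) (1, 1)
      (ContinuousLinearMap.fst ℝ E E + ContinuousLinearMap.snd ℝ E E) := by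
  have h := ((contMDiff_mul 𝓘(ℝ, E) ∞ (G := G)).mdifferentiableAt (x := (1, 1))
    (by simp)).hasModelDerivAt
  set L := modelDeriv (𝓘(ℝ, E).prod 𝓘(ℝ, E)) 𝓘(ℝ, E) (fun p : G × G => p.1 * p.2) (1, 1)
  have h1 := h.comp (g := fun x => (x, 1)) rfl ((hasModelDerivAt_id (I := 𝓘(ℝ, E)) (1 : G)).prodMk
    (hasModelDerivAt_const (I := 𝓘(ℝ, E)) (I' := 𝓘(ℝ, E)) (1 : G) (1 : G)))
  have h2 := h.comp (g := fun x => (1, x)) rfl ((hasModelDerivAt_const (I := 𝓘(ℝ, E)) (I' := 𝓘(ℝ, E)) (1 : G) (1 : G)).prodMk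
    (hasModelDerivAt_id (I := 𝓘(ℝ, E)) (1 : G)))
  simp only [mul_one, one_mul] at h1 h2
  have e1 := h1.unique (hasModelDerivAt_id (I := 𝓘(ℝ, E)) (1 : G))
  have e2 := h2.unique (hasModelDerivAt_id (I := 𝓘(ℝ, E)) (1 : G))
  have : L = ContinuousLinearMap.fst ℝ E E + ContinuousLinearMap.snd ℝ E E := by
    ext x
    · simpa using congrArg (fun L => L x) e1
    · simpa using congrArg (fun L => L x) e2
  rwa [this] at h

/-- Coordinates of the second kind: the product of the one-parameter subgroups of finitely many
elements of the Lie algebra. It is a homomorphism when these elements commute. -/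
theorem exists_prod_oneParam (n : ℕ) (ξ : Fin n → E) : ∃ ψ : (Fin n → ℝ) → G,
    ContMDiff 𝓘(ℝ, Fin n → ℝ) 𝓘(ℝ, E) ∞ ψ ∧ ψ 0 = 1 ∧
    HasModelDerivAt 𝓘(ℝ, Fin n → ℝ) 𝓘(ℝ, E) ψ 0
      (∑ i, (ContinuousLinearMap.proj (R := ℝ) (φ := fun _ : Fin n => ℝ) i).smulRight (ξ i)) ∧
    (∀ s, ψ s ∈ Subgroup.closure {g | ∃ i t, oneParam G (ξ i) t = g}) ∧
    ((∀ i j, lieBr G (ξ i) (ξ j) = 0) → ∀ s t, ψ (s + t) = ψ s * ψ t) := by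
  induction n with
  | zero =>
    refine ⟨fun _ => 1, contMDiff_const, rfl, ?_, fun s => one_mem _, by simp⟩
    simpa using hasModelDerivAt_const (I := 𝓘(ℝ, Fin 0 → ℝ)) (I' := 𝓘(ℝ, E)) (0 : Fin 0 → ℝ) (1 : G)
  | succ n ih =>
    obtain ⟨ψ, h1, h2, h3, h4, h5⟩ := ih (fun i => ξ i.succ)
    let T : (Fin (n + 1) → ℝ) →L[ℝ] (Fin n → ℝ) :=
      ContinuousLinearMap.pi fun i => ContinuousLinearMap.proj (R := ℝ)
        (φ := fun _ : Fin (n + 1) => ℝ) i.succ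
    let P : (Fin (n + 1) → ℝ) →L[ℝ] ℝ :=
      ContinuousLinearMap.proj (R := ℝ) (φ := fun _ : Fin (n + 1) => ℝ) 0
    refine ⟨fun s => oneParam G (ξ 0) (P s) * ψ (T s), ?_, ?_, ?_, ?_, ?_⟩
    · exact ((contMDiff_oneParam (ξ 0)).comp P.contDiff.contMDiff).mul
        (h1.comp T.contDiff.contMDiff)
    · simp [oneParam_zero, h2]
    · have ha : HasModelDerivAt 𝓘(ℝ, Fin (n + 1) → ℝ) 𝓘(ℝ, E) (fun s => oneParam G (ξ 0) (P s)) 0 _ :=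
        HasModelDerivAt.comp (hasVelocity_oneParam (ξ 0)) (by simp) (hasModelDerivAt_iff.2 P.hasFDerivAt)
      have hb : HasModelDerivAt 𝓘(ℝ, Fin (n + 1) → ℝ) 𝓘(ℝ, E) (fun s => ψ (T s)) 0 _ :=
        HasModelDerivAt.comp h3 (by simp) (hasModelDerivAt_iff.2 T.hasFDerivAt)
      have hc := hasModelDerivAt_mul_one_one.comp (by simp [oneParam_zero, h2]) (ha.prodMk hb)
      convert! hc using 1
      ext s
      simp [Fin.sum_univ_succ, P, T]
    · intro s
      refine mul_mem (Subgroup.subset_closure ⟨0, P s, rfl⟩) ?_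
      refine Subgroup.closure_mono ?_ (h4 (T s))
      rintro g ⟨i, t, rfl⟩
      exact ⟨i.succ, t, rfl⟩
    · intro hcomm s t
      have hk : oneParam G (ξ 0) (P t) ∈ Subgroup.centralizer
          (Subgroup.closure {g | ∃ i t, oneParam G (ξ (Fin.succ i)) t = g} : Set G) := by
        rw [Subgroup.centralizer_closure, Subgroup.mem_centralizer_iff]
        rintro g ⟨i, u, rfl⟩
        exact commute_oneParam (hcomm _ _) _ _
      have hk2 := (Subgroup.mem_centralizer_iff.1 hk) _ (h4 (T s))
      simp only [map_add]
      rw [oneParam_add, h5 (fun i j => hcomm _ _)]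
      simp only [mul_assoc]
      rw [← mul_assoc (ψ (T s)), hk2, mul_assoc]

end OneParam

/-! ### The symplectic form of a cotangent bundle in charts -/

section Canonical

variable {F : Type*} [NormedAddCommGroup F] [NormedSpace ℝ F]

variable (F) in
/-- The model space `F × F*` of a cotangent bundle. -/
abbrev CotSpace : Type _ := F × (F →L[ℝ] ℝ)

-- Shortcut instances: instance search on iterated duals is slow without them.
instance instNormedAddCommGroupDual : NormedAddCommGroup (F →L[ℝ] ℝ) :=
  ContinuousLinearMap.toNormedAddCommGroup
instance instAddCommGroupDual : AddCommGroup (F →L[ℝ] ℝ) := ContinuousLinearMap.addCommGroup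
instance instNormedSpaceDual : NormedSpace ℝ (F →L[ℝ] ℝ) := ContinuousLinearMap.toNormedSpace
instance instModuleDual : Module ℝ (F →L[ℝ] ℝ) := ContinuousLinearMap.module

variable (F) in
/-- The canonical symplectic form `dp ∧ dx` of `F × F*`. -/
def canonicalForm : CotSpace F →L[ℝ] CotSpace F →L[ℝ] ℝ :=
  let A : CotSpace F →L[ℝ] CotSpace F →L[ℝ] ℝ :=
    (ContinuousLinearMap.precomp ℝ (ContinuousLinearMap.fst ℝ F (F →L[ℝ] ℝ))).comp
      (ContinuousLinearMap.snd ℝ F (F →L[ℝ] ℝ))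
  A - A.flip

@[simp] theorem canonicalForm_apply (X Y : CotSpace F) :
    canonicalForm F X Y = X.2 Y.1 - Y.2 X.1 := rfl

/-- The canonical one-form `p dx` of `F × F*`. -/
def canonicalOneForm (z : CotSpace F) : CotSpace F →L[ℝ] ℝ :=
  z.2.comp (ContinuousLinearMap.fst ℝ F (F →L[ℝ] ℝ))

theorem canonicalForm_injective [FiniteDimensional ℝ F] :
    Function.Injective (canonicalForm F) := by
  rw [injective_iff_map_eq_zero]
  intro X hX
  have h : ∀ Y : CotSpace F, X.2 Y.1 - Y.2 X.1 = 0 := fun Y => by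
    rw [← canonicalForm_apply, hX, zero_apply]
  refine Prod.ext ?_ ?_
  · by_contra hne
    obtain ⟨p, hp⟩ := SeparatingDual.exists_ne_zero (R := ℝ) hne
    have := h (0, p)
    simp at this
    exact hp this
  · ext y
    simpa using h (y, 0)

theorem finrank_dual_eq {V : Type*} [NormedAddCommGroup V] [NormedSpace ℝ V]
    [FiniteDimensional ℝ V] : Module.finrank ℝ (V →L[ℝ] ℝ) = Module.finrank ℝ V := by
  rw [← (LinearMap.toContinuousLinearMap (𝕜 := ℝ) (E := V) (F' := ℝ)).finrank_eq]
  exact Subspace.dual_finrank_eq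

theorem isInvertible_of_injective {V : Type*} [NormedAddCommGroup V] [NormedSpace ℝ V]
    [FiniteDimensional ℝ V] {L : V →L[ℝ] V →L[ℝ] ℝ} (h : Function.Injective L) :
    L.IsInvertible := by
  have hf : Module.finrank ℝ V = Module.finrank ℝ (V →L[ℝ] ℝ) := finrank_dual_eq.symm
  refine ⟨(LinearEquiv.ofInjectiveOfFinrankEq (L : V →ₗ[ℝ] V →L[ℝ] ℝ) h hf).toContinuousLinearEquiv, ?_⟩
  ext; rfl

theorem extDerivOneForm_congr {W : Type*} [NormedAddCommGroup W] [NormedSpace ℝ W]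
    {θ θ' : W → W →L[ℝ] ℝ} {w : W} (h : θ =ᶠ[𝓝 w] θ') :
    extDerivOneForm θ w = extDerivOneForm θ' w := by
  rw [extDerivOneForm, extDerivOneForm, h.fderiv_eq]

/-- The exterior derivative commutes with the pull-back of the canonical one-form. -/
theorem extDerivOneForm_pullback {W : Type*} [NormedAddCommGroup W] [NormedSpace ℝ W]
    {S : W → CotSpace F} {w : W} (hS : ContDiffAt ℝ ∞ S w) (X Y : W) :
    extDerivOneForm (fun w => (canonicalOneForm (S w)).comp (fderiv ℝ S w)) w X Y =
      canonicalForm F (fderiv ℝ S w X) (fderiv ℝ S w Y) := by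
  have hd : DifferentiableAt ℝ (fderiv ℝ S) w :=
    (hS.fderiv_right (m := 1) (by norm_cast)).differentiableAt (by simp)
  have hS1 : HasFDerivAt S (fderiv ℝ S w) w := (hS.differentiableAt (by simp)).hasFDerivAt
  have hsymm : IsSymmSndFDerivAt ℝ S w :=
    hS.isSymmSndFDerivAt (by simpa using (ENat.LEInfty.out : (2 : ℕ∞ω) ≤ ∞))
  have hκ : DifferentiableAt ℝ (fun w => (canonicalOneForm (S w)).comp (fderiv ℝ S w)) w := by
    refine DifferentiableAt.clm_comp ?_ hd
    exact DifferentiableAt.clm_comp (hS1.differentiableAt.snd) (differentiableAt_const _)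
  have key : ∀ X Y : W, fderiv ℝ (fun w => (canonicalOneForm (S w)).comp (fderiv ℝ S w)) w X Y =
      (fderiv ℝ S w X).2 (fderiv ℝ S w Y).1 + (S w).2 (fderiv ℝ (fderiv ℝ S) w X Y).1 := by
    intro X Y
    have h1 := hκ.hasFDerivAt.clm_apply (hasFDerivAt_const Y w)
    have h2 : HasFDerivAt (fun w => (S w).2 ((fderiv ℝ S w Y).1)) _ w :=
      (hS1.snd).clm_apply ((hd.hasFDerivAt.clm_apply (hasFDerivAt_const Y w)).fst)
    have h3 := congrArg (fun L => L X) (h1.unique h2)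
    simpa [add_comm] using h3
  rw [extDerivOneForm]
  simp only [sub_apply, ContinuousLinearMap.flip_apply]
  rw [key, key, canonicalForm_apply, hsymm.eq X Y]
  ring

end Canonical

section CotangentChart

variable {F : Type*} [NormedAddCommGroup F] [NormedSpace ℝ F]
  {Q : Type*} [TopologicalSpace Q] [ChartedSpace F Q] [IsManifold 𝓘(ℝ, F) ∞ Q]

/-- The chart of `T*Q` around `α`. -/
abbrev cotChart (α : Cotangent F Q) : PartialEquiv (Cotangent F Q) (CotSpace F) :=
  extChartAt (cotModel F) α

/-- The covector of a point of `T*Q`, as a functional on the model space. -/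
def momentum (α : Cotangent F Q) : F →L[ℝ] ℝ := covector α

theorem mem_cotChart_source {α β : Cotangent F Q} :
    β ∈ (cotChart α).source ↔ β.1 ∈ (extChartAt 𝓘(ℝ, F) α.1).source := by
  rw [cotChart, extChartAt_source, extChartAt_source, FiberBundle.chartedSpace_chartAt]
  simp only [mfld_simps]
  exact ⟨fun h => h.1.1, fun h => ⟨⟨h, trivial⟩, h⟩⟩

theorem cotChart_apply {α β : Cotangent F Q} (h : β ∈ (cotChart α).source) :
    cotChart α β = (extChartAt 𝓘(ℝ, F) α.1 β.1, (momentum β).comp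
      (modelDeriv 𝓘(ℝ, F) 𝓘(ℝ, F) (extChartAt 𝓘(ℝ, F) α.1).symm
        (extChartAt 𝓘(ℝ, F) α.1 β.1))) := by
  have hs := mem_cotChart_source.1 h
  rw [extChartAt_source] at hs
  have h1 := TangentBundle.symmL_trivializationAt (I := 𝓘(ℝ, F)) hs
  rw [ModelWithCorners.range_eq_univ, mfderivWithin_univ] at h1
  rw [cotChart, FiberBundle.extChartAt]
  refine Prod.ext rfl ?_
  refine ContinuousLinearMap.ext fun v => ?_
  have h2 := congrArg (fun L => β.2 (L v)) h1
  refine Eq.trans ?_ h2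
  change (trivializationAt (F →L[ℝ] ℝ) (fun q : Q => TangentSpace 𝓘(ℝ, F) q →L[ℝ] Trivial Q ℝ q) α.1 β).2 v = _
  rw [hom_trivializationAt_apply, ContinuousLinearMap.inCoordinates]
  simp only [ContinuousLinearMap.comp_apply]
  exact congrArg (fun L : ℝ →L[ℝ] ℝ => L _)
    (Bundle.Trivial.continuousLinearMapAt_trivialization ℝ Q ℝ β.1)

theorem cotChart_fst (α β : Cotangent F Q) :
    (cotChart α β).1 = extChartAt 𝓘(ℝ, F) α.1 β.1 := by
  rw [cotChart, FiberBundle.extChartAt]; rfl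

theorem hasModelDerivAt_proj (β : Cotangent F Q) :
    HasModelDerivAt (cotModel F) 𝓘(ℝ, F) (fun β : Cotangent F Q => β.1) β
      (modelDeriv (cotModel F) 𝓘(ℝ, F) (fun β : Cotangent F Q => β.1) β) :=
  MDifferentiableAt.hasModelDerivAt
    ((Bundle.contMDiffAt_proj (n := ∞) (IB := 𝓘(ℝ, F)) (F := F →L[ℝ] ℝ)
      (fun q : Q => TangentSpace 𝓘(ℝ, F) q →L[ℝ] Trivial Q ℝ q)).mdifferentiableAt (by simp))

/-- The Liouville form, as a functional on the model space. -/
def liouville (β : Cotangent F Q) : CotSpace F →L[ℝ] ℝ := liouvilleForm β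

/-- The Liouville form is `p dx` in every chart. -/
theorem liouville_eq {α β : Cotangent F Q} (h : β ∈ (cotChart α).source) :
    liouville β = (canonicalOneForm (cotChart α β)).comp
      (modelDeriv (cotModel F) 𝓘(ℝ, CotSpace F) (cotChart α) β) := by
  have hs := mem_cotChart_source.1 h
  have h1 := (hasModelDerivAt_extChartAt (I := 𝓘(ℝ, F)) hs).comp rfl (hasModelDerivAt_proj β)
  have h2 := (hasModelDerivAt_iff.2 (ContinuousLinearMap.fst ℝ F (F →L[ℝ] ℝ)).hasFDerivAt).comp rfl
    (hasModelDerivAt_extChartAt (I := cotModel F) h)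
  have h3 : (fun β => (ContinuousLinearMap.fst ℝ F (F →L[ℝ] ℝ)) (extChartAt (cotModel F) α β)) =
      fun β : Cotangent F Q => extChartAt 𝓘(ℝ, F) α.1 β.1 := funext fun β => cotChart_fst α β
  rw [h3] at h2
  have h4 := h2.unique h1
  refine ContinuousLinearMap.ext fun X => ?_
  have h5 := congrArg (fun L => L X) h4
  simp only [ContinuousLinearMap.comp_apply, ContinuousLinearMap.coe_fst'] at h5
  simp only [canonicalOneForm, ContinuousLinearMap.comp_apply, ContinuousLinearMap.coe_fst']
  rw [h5, cotChart_apply h]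
  simp only [ContinuousLinearMap.comp_apply]
  rw [modelDeriv_symm_modelDeriv hs]
  rfl

/-- The symplectic form, as a bilinear form on the model space. -/
def sympl (α : Cotangent F Q) : CotSpace F →L[ℝ] CotSpace F →L[ℝ] ℝ := symplecticForm α

theorem liouville_comp_symm {α : Cotangent F Q} {z : CotSpace F} (hz : z ∈ (cotChart α).target) :
    (liouville ((cotChart α).symm z)).comp
      (modelDeriv 𝓘(ℝ, CotSpace F) (cotModel F) (cotChart α).symm z) = canonicalOneForm z := by
  have h := (cotChart α).map_target hz
  rw [liouville_eq h, (cotChart α).right_inv hz]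
  refine ContinuousLinearMap.ext fun X => ?_
  have := modelDeriv_modelDeriv_symm h X
  rw [(cotChart α).right_inv hz] at this
  simp only [ContinuousLinearMap.comp_apply]
  exact congrArg (canonicalOneForm z) this

theorem extDerivOneForm_canonicalOneForm (z X Y : CotSpace F) :
    extDerivOneForm canonicalOneForm z X Y = canonicalForm F X Y := by
  have h := extDerivOneForm_pullback (contDiffAt_id (𝕜 := ℝ) (n := ∞) (x := z)) X Y
  simpa using! h

/-- The symplectic form at `α` is defined in the chart around `α`, where the Liouville form is `p
dx`. -/
theorem sympl_self_chart (α : Cotangent F Q) (X Y : CotSpace F) :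
    sympl α X Y = canonicalForm F
      (modelDeriv (cotModel F) 𝓘(ℝ, CotSpace F) (cotChart α) α X)
      (modelDeriv (cotModel F) 𝓘(ℝ, CotSpace F) (cotChart α) α Y) := by
  have h1 : (localLiouvilleForm α : CotSpace F → CotSpace F →L[ℝ] ℝ) =ᶠ[𝓝 (cotChart α α)]
      canonicalOneForm := by
    filter_upwards [eventually_extChartAt_target (mem_extChartAt_target (I := cotModel F) α)]
      with z hz
    exact liouville_comp_symm hz
  rw [← extDerivOneForm_canonicalOneForm (cotChart α α), ← extDerivOneForm_congr h1]
  rfl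

/-- The pull-back of the symplectic form by a smooth map from a normed space is the exterior
derivative of the pull-back of the Liouville form. -/
theorem sympl_pullback {W : Type*} [NormedAddCommGroup W] [NormedSpace ℝ W]
    {T : W → Cotangent F Q} {w : W} (hT : ContMDiffAt 𝓘(ℝ, W) (cotModel F) ∞ T w) (X Y : W) :
    sympl (T w) (modelDeriv 𝓘(ℝ, W) (cotModel F) T w X) (modelDeriv 𝓘(ℝ, W) (cotModel F) T w Y) =
      extDerivOneForm
        (fun w => (liouville (T w)).comp (modelDeriv 𝓘(ℝ, W) (cotModel F) T w)) w X Y := by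
  set φ := cotChart (T w)
  have hsrc : T w ∈ φ.source := mem_extChartAt_source (T w)
  have hS : ContDiffAt ℝ ∞ (fun v => φ (T v)) w :=
    (ContMDiffAt.comp w (contMDiffAt_extChartAt_of_mem hsrc) hT).contDiffAt
  have hev : ∀ᶠ v in 𝓝 w, T v ∈ φ.source ∧ MDifferentiableAt 𝓘(ℝ, W) (cotModel F) T v := by
    refine (hT.continuousAt.eventually (eventually_extChartAt_source hsrc)).and ?_
    have := (contMDiffAt_iff_contMDiffAt_nhds (n := 1) (by simp)).1 (hT.of_le (by norm_cast))
    exact this.mono fun v hv => hv.mdifferentiableAt (by simp)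
  have hfd : ∀ v, T v ∈ φ.source → MDifferentiableAt 𝓘(ℝ, W) (cotModel F) T v →
      fderiv ℝ (fun v => φ (T v)) v = (modelDeriv (cotModel F) 𝓘(ℝ, CotSpace F) φ (T v)).comp
        (modelDeriv 𝓘(ℝ, W) (cotModel F) T v) := by
    intro v h1 h2
    exact (hasModelDerivAt_iff.1
      ((hasModelDerivAt_extChartAt h1).comp rfl h2.hasModelDerivAt)).fderiv
  have hκ : (fun w => (liouville (T w)).comp (modelDeriv 𝓘(ℝ, W) (cotModel F) T w)) =ᶠ[𝓝 w]
      fun v => (canonicalOneForm (φ (T v))).comp (fderiv ℝ (fun v => φ (T v)) v) := by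
    filter_upwards [hev] with v hv
    rw [hfd v hv.1 hv.2, liouville_eq hv.1]
    rfl
  rw [extDerivOneForm_congr hκ, extDerivOneForm_pullback hS, sympl_self_chart,
    hfd w hev.self_of_nhds.1 hev.self_of_nhds.2]
  rfl

/-- The symplectic form is `dp ∧ dx` in every chart. -/
theorem sympl_chart {α β : Cotangent F Q} (h : β ∈ (cotChart α).source) (X Y : CotSpace F) :
    sympl β X Y = canonicalForm F
      (modelDeriv (cotModel F) 𝓘(ℝ, CotSpace F) (cotChart α) β X)
      (modelDeriv (cotModel F) 𝓘(ℝ, CotSpace F) (cotChart α) β Y) := by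
  have hz := (cotChart α).map_source h
  have h1 := sympl_pullback (contMDiffAt_extChartAt_symm_of_mem (I := cotModel F) hz)
    (modelDeriv (cotModel F) 𝓘(ℝ, CotSpace F) (cotChart α) β X)
    (modelDeriv (cotModel F) 𝓘(ℝ, CotSpace F) (cotChart α) β Y)
  rw [modelDeriv_symm_modelDeriv h, modelDeriv_symm_modelDeriv h, (cotChart α).left_inv h] at h1
  rw [h1, ← extDerivOneForm_canonicalOneForm (cotChart α β)]
  congr 2
  refine extDerivOneForm_congr ?_
  filter_upwards [eventually_extChartAt_target hz] with z hz
  exact liouville_comp_symm hz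

variable [FiniteDimensional ℝ F]

theorem sympl_injective (β : Cotangent F Q) : Function.Injective (sympl β) := by
  rw [injective_iff_map_eq_zero]
  intro X hX
  have hs : β ∈ (cotChart β).source := mem_extChartAt_source β
  have h1 : modelDeriv (cotModel F) 𝓘(ℝ, CotSpace F) (cotChart β) β X = 0 := by
    apply canonicalForm_injective
    refine ContinuousLinearMap.ext fun Z => ?_
    have h2 := sympl_chart hs X
      (modelDeriv 𝓘(ℝ, CotSpace F) (cotModel F) (cotChart β).symm (cotChart β β) Z)
    rw [modelDeriv_modelDeriv_symm hs, hX] at h2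
    simpa using h2.symm
  rw [← modelDeriv_symm_modelDeriv hs X, h1, map_zero]

theorem sympl_skew (β : Cotangent F Q) (X Y : CotSpace F) : sympl β X Y = -sympl β Y X := by
  rw [sympl_self_chart, sympl_self_chart]; simp

/-- The differential of a function, as a functional on the model space. -/
def diffl (f : Cotangent F Q → ℝ) (β : Cotangent F Q) : CotSpace F →L[ℝ] ℝ := differential f β

/-- The Hamiltonian vector field, as an element of the model space. -/
def hamField (f : Cotangent F Q → ℝ) (β : Cotangent F Q) : CotSpace F := hamiltonianField f β

theorem hamField_eq (f : Cotangent F Q → ℝ) (β : Cotangent F Q) :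
    hamField f β = (sympl β).inverse (-diffl f β) := rfl

theorem sympl_hamField (f : Cotangent F Q → ℝ) (β : Cotangent F Q) :
    sympl β (hamField f β) = -diffl f β := by
  obtain ⟨e, he⟩ := isInvertible_of_injective (sympl_injective β)
  rw [hamField_eq, ← he, ContinuousLinearMap.inverse_equiv]
  simp

theorem hamField_unique {f : Cotangent F Q → ℝ} {β : Cotangent F Q} {X : CotSpace F}
    (h : ∀ Y, sympl β X Y = -diffl f β Y) : hamField f β = X := by
  apply sympl_injective β
  rw [sympl_hamField]
  refine ContinuousLinearMap.ext fun Y => ?_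
  rw [h]; rfl

theorem poissonBracket_eq (f g : Cotangent F Q → ℝ) (β : Cotangent F Q) :
    poissonBracket f g β = diffl f β (hamField g β) := rfl

theorem hasModelDerivAt_diffl (f : SmoothFun F Q) (β : Cotangent F Q) :
    HasModelDerivAt (cotModel F) 𝓘(ℝ, ℝ) f β (diffl f β) :=
  (f.contMDiff.mdifferentiableAt (by simp)).hasModelDerivAt

theorem contDiffOn_chart (f : SmoothFun F Q) (α : Cotangent F Q) :
    ContDiffOn ℝ ∞ (fun z => f ((cotChart α).symm z)) (cotChart α).target := fun z hz =>
  (ContMDiffAt.comp z f.contMDiff.contMDiffAt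
    (contMDiffAt_extChartAt_symm_of_mem hz)).contDiffAt.contDiffWithinAt

theorem contDiffAt_chart (f : SmoothFun F Q) {α : Cotangent F Q} {z : CotSpace F}
    (hz : z ∈ (cotChart α).target) : ContDiffAt ℝ ∞ (fun z => f ((cotChart α).symm z)) z :=
  (contDiffOn_chart f α).contDiffAt ((isOpen_extChartAt_target α).mem_nhds hz)

theorem fderiv_chart (f : SmoothFun F Q) {α : Cotangent F Q} {z : CotSpace F}
    (hz : z ∈ (cotChart α).target) :
    fderiv ℝ (fun z => f ((cotChart α).symm z)) z = (diffl f ((cotChart α).symm z)).comp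
      (modelDeriv 𝓘(ℝ, CotSpace F) (cotModel F) (cotChart α).symm z) :=
  (hasModelDerivAt_iff.1 ((hasModelDerivAt_diffl f _).comp rfl
    (hasModelDerivAt_extChartAt_symm (I := cotModel F) hz))).fderiv

theorem diffl_chart (f : SmoothFun F Q) {α β : Cotangent F Q} (h : β ∈ (cotChart α).source) :
    diffl f β = (fderiv ℝ (fun z => f ((cotChart α).symm z)) (cotChart α β)).comp
      (modelDeriv (cotModel F) 𝓘(ℝ, CotSpace F) (cotChart α) β) := by
  rw [fderiv_chart f ((cotChart α).map_source h), (cotChart α).left_inv h]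
  refine ContinuousLinearMap.ext fun X => ?_
  simp only [ContinuousLinearMap.comp_apply]
  rw [modelDeriv_symm_modelDeriv h]

theorem chart_hamField (f : SmoothFun F Q) {α β : Cotangent F Q} (h : β ∈ (cotChart α).source) :
    modelDeriv (cotModel F) 𝓘(ℝ, CotSpace F) (cotChart α) β (hamField f β) =
      (canonicalForm F).inverse
        (-fderiv ℝ (fun z => f ((cotChart α).symm z)) (cotChart α β)) := by
  obtain ⟨e, he⟩ := isInvertible_of_injective (canonicalForm_injective (F := F))
  have hz := (cotChart α).map_source h
  rw [← he, ContinuousLinearMap.inverse_equiv]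
  apply e.injective
  rw [ContinuousLinearEquiv.coe_coe, ContinuousLinearEquiv.apply_symm_apply]
  refine ContinuousLinearMap.ext fun Z => ?_
  have h1 := sympl_chart h (hamField f β)
    (modelDeriv 𝓘(ℝ, CotSpace F) (cotModel F) (cotChart α).symm (cotChart α β) Z)
  rw [modelDeriv_modelDeriv_symm h, sympl_hamField, ← he] at h1
  rw [fderiv_chart f hz, (cotChart α).left_inv h]
  exact h1.symm

theorem contMDiff_poissonBracket (f g : SmoothFun F Q) :
    ContMDiff (cotModel F) 𝓘(ℝ, ℝ) ∞ (poissonBracket f g) := by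
  intro α
  set φ := cotChart α
  have hs : α ∈ φ.source := mem_extChartAt_source α
  have h1 : ContDiffAt ℝ ∞ (fun z => fderiv ℝ (fun z => f (φ.symm z)) z ((canonicalForm F).inverse
      (-fderiv ℝ (fun z => g (φ.symm z)) z))) (φ α) := by
    have hf := contDiffAt_chart f (φ.map_source hs)
    have hg := contDiffAt_chart g (φ.map_source hs)
    exact (hf.fderiv_right (m := ∞) (by simp)).clm_apply
      ((canonicalForm F).inverse.contDiff.contDiffAt.comp (φ α)
        (hg.fderiv_right (m := ∞) (by simp)).neg)
  refine (ContMDiffAt.comp α h1.contMDiffAt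
    (contMDiffAt_extChartAt_of_mem hs)).congr_of_eventuallyEq ?_
  filter_upwards [eventually_extChartAt_source hs] with β hβ
  rw [poissonBracket_eq, diffl_chart f hβ, ContinuousLinearMap.comp_apply, chart_hamField g hβ]
  rfl

end CotangentChart

/-! ### The cotangent lift of a group action and its moment map -/

/-- The derivative in a vector variable depends smoothly on parameters. -/
theorem contMDiffAt_fderiv_param {V : Type*} [NormedAddCommGroup V] [NormedSpace ℝ V]
    {V' : Type*} [NormedAddCommGroup V'] [NormedSpace ℝ V']
    {W : Type*} [NormedAddCommGroup W] [NormedSpace ℝ W]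
    {K : Type*} [TopologicalSpace K] {I : ModelWithCorners ℝ W K}
    {N : Type*} [TopologicalSpace N] [ChartedSpace K N] [IsManifold I ∞ N]
    {f : N → V → V'} {y : N → V} {x₀ : N}
    (hf : ContMDiffAt (I.prod 𝓘(ℝ, V)) 𝓘(ℝ, V') ∞ (fun p : N × V => f p.1 p.2) (x₀, y x₀))
    (hy : ContMDiffAt I 𝓘(ℝ, V) ∞ y x₀) :
    ContMDiffAt I 𝓘(ℝ, V →L[ℝ] V') ∞ (fun x => fderiv ℝ (f x) (y x)) x₀ := by
  have h := ContMDiffAt.mfderiv (n := ∞) (m := ∞) (x₀ := x₀) (I := 𝓘(ℝ, V)) (I' := 𝓘(ℝ, V'))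
    f y hf hy (by simp)
  refine h.congr_of_eventuallyEq (Eventually.of_forall fun x => ?_)
  exact ((congrFun (inTangentCoordinates_model_space (I := 𝓘(ℝ, V)) (I' := 𝓘(ℝ, V')) y
    (fun x => f x (y x)) (fun x => mfderiv 𝓘(ℝ, V) 𝓘(ℝ, V') (f x) (y x)) x₀) x).trans
    mfderiv_eq_fderiv).symm

theorem extDerivOneForm_apply {V : Type*} [NormedAddCommGroup V] [NormedSpace ℝ V]
    (θ : V → V →L[ℝ] ℝ) (z X Y : V) :
    extDerivOneForm θ z X Y = fderiv ℝ θ z X Y - fderiv ℝ θ z Y X := rfl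

/-- The exterior derivative of the one-form `u dt + θ` on `ℝ × V`, where `u` and `θ` do not depend
on `t`, contracted with `∂/∂t` and a vector tangent to `V`. -/
theorem extDerivOneForm_suspension {V : Type*} [NormedAddCommGroup V] [NormedSpace ℝ V]
    {u : V → ℝ} {θ : V → V →L[ℝ] ℝ} {z : V} (hu : DifferentiableAt ℝ u z)
    (hθ : DifferentiableAt ℝ θ z) (t : ℝ) (Z : V) :
    extDerivOneForm (fun p : ℝ × V =>
      (ContinuousLinearMap.mul ℝ ℝ (u p.2)).comp (ContinuousLinearMap.fst ℝ ℝ V) +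
        (θ p.2).comp (ContinuousLinearMap.snd ℝ ℝ V)) (t, z) (1, 0) (0, Z) = -fderiv ℝ u z Z := by
  have h2 : HasFDerivAt (fun p : ℝ × V => u p.2) _ (t, z) :=
    HasFDerivAt.comp (g := u) (t, z) hu.hasFDerivAt hasFDerivAt_snd
  have h3 := HasFDerivAt.clm_comp
    (HasFDerivAt.comp (g := θ) (t, z) hθ.hasFDerivAt hasFDerivAt_snd)
    (hasFDerivAt_const (ContinuousLinearMap.snd ℝ ℝ V) (t, z))
  have h4 := HasFDerivAt.clm_comp
    (HasFDerivAt.comp (g := ContinuousLinearMap.mul ℝ ℝ) (t, z)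
      (ContinuousLinearMap.mul ℝ ℝ).hasFDerivAt h2)
    (hasFDerivAt_const (ContinuousLinearMap.fst ℝ ℝ V) (t, z))
  have h5 := (h4.add h3).differentiableAt.hasFDerivAt
  have h6 := HasFDerivAt.comp (t, z)
    (ContinuousLinearMap.apply ℝ ℝ ((1 : ℝ), (0 : V))).hasFDerivAt h5
  have h7 := HasFDerivAt.comp (t, z)
    (ContinuousLinearMap.apply ℝ ℝ ((0 : ℝ), Z)).hasFDerivAt h5
  have h8 : HasFDerivAt (fun p : ℝ × V => θ p.2 Z) _ (t, z) :=
    HasFDerivAt.comp (t, z) (ContinuousLinearMap.apply ℝ ℝ Z).hasFDerivAt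
      (HasFDerivAt.comp (g := θ) (t, z) hθ.hasFDerivAt hasFDerivAt_snd)
  have h9 := congrArg (fun L => L (0, Z)) ((h2.congr_of_eventuallyEq
    (Eventually.of_forall fun p => by simp)).unique h6)
  have h10 := congrArg (fun L => L (1, 0)) ((h8.congr_of_eventuallyEq
    (Eventually.of_forall fun p => by simp)).unique h7)
  rw [extDerivOneForm_apply]
  refine (congrArg₂ (· - ·) h10.symm h9.symm).trans ?_
  simp only [ContinuousLinearMap.comp_apply, ContinuousLinearMap.coe_snd', map_zero]
  simp

theorem differentiable_canonicalOneForm {F : Type*} [NormedAddCommGroup F] [NormedSpace ℝ F] :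
    Differentiable ℝ (canonicalOneForm (F := F)) :=
  differentiable_snd.clm_comp (differentiable_const _)

section Action

variable {E : Type*} [NormedAddCommGroup E] [NormedSpace ℝ E] [FiniteDimensional ℝ E]
  {G : Type*} [TopologicalSpace G] [Group G] [ChartedSpace E G] [LieGroup 𝓘(ℝ, E) ∞ G]
  {F : Type*} [NormedAddCommGroup F] [NormedSpace ℝ F]
  {Q : Type*} [TopologicalSpace Q] [ChartedSpace F Q] [IsManifold 𝓘(ℝ, F) ∞ Q] [MulAction G Q]

/-- The differential at `q` of the action of `g`. -/
def actDeriv (g : G) (q : Q) : F →L[ℝ] F := modelDeriv 𝓘(ℝ, F) 𝓘(ℝ, F) (fun x : Q => g • x) q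

/-- The cotangent lift of the action of `G` on `Q`: it sends `(q, p)` to `(g q, p ∘ (dg)_q⁻¹)`. -/
def cotAct (g : G) (α : Cotangent F Q) : Cotangent F Q :=
  let p : F →L[ℝ] ℝ := (momentum α).comp (actDeriv g⁻¹ (g • α.1))
  ⟨g • α.1, p⟩

@[simp] theorem cotAct_fst (g : G) (α : Cotangent F Q) : (cotAct g α).1 = g • α.1 := rfl

theorem momentum_cotAct (g : G) (α : Cotangent F Q) :
    momentum (cotAct g α) = (momentum α).comp (actDeriv g⁻¹ (g • α.1)) := rfl

theorem cotangent_ext {α β : Cotangent F Q} (h1 : α.1 = β.1) (h2 : momentum α = momentum β) :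
    α = β := by
  obtain ⟨q, p⟩ := α
  obtain ⟨q', p'⟩ := β
  obtain rfl : q = q' := h1
  exact congrArg (TotalSpace.mk q) h2

theorem contMDiffAt_cotangent {W : Type*} [NormedAddCommGroup W] [NormedSpace ℝ W]
    {K : Type*} [TopologicalSpace K] {I : ModelWithCorners ℝ W K}
    {N : Type*} [TopologicalSpace N] [ChartedSpace K N] {T : N → Cotangent F Q} {x : N}
    (h1 : ContMDiffAt I 𝓘(ℝ, F) ∞ (fun y => (T y).1) x)
    (h2 : ContMDiffAt I 𝓘(ℝ, F →L[ℝ] ℝ) ∞ (fun y => (cotChart (T x) (T y)).2) x) :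
    ContMDiffAt I (cotModel F) ∞ T x := by
  rw [Bundle.contMDiffAt_totalSpace]
  refine ⟨h1, ?_⟩
  rw [cotChart, FiberBundle.extChartAt] at h2
  exact h2

theorem momentum_eq {α β : Cotangent F Q} (h : β ∈ (cotChart α).source) :
    momentum β = (cotChart α β).2.comp
      (modelDeriv 𝓘(ℝ, F) 𝓘(ℝ, F) (extChartAt 𝓘(ℝ, F) α.1) β.1) := by
  rw [cotChart_apply h]
  refine ContinuousLinearMap.ext fun X => ?_
  simp only [ContinuousLinearMap.comp_apply]
  rw [modelDeriv_symm_modelDeriv (mem_cotChart_source.1 h)]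

variable [ContMDiffSMul 𝓘(ℝ, E) 𝓘(ℝ, F) ∞ G Q]

include E in
theorem contMDiff_smul_left (g : G) : ContMDiff 𝓘(ℝ, F) 𝓘(ℝ, F) ∞ (fun x : Q => g • x) :=
  (contMDiff_smul (I := 𝓘(ℝ, E)) (I' := 𝓘(ℝ, F)) (n := ∞)).comp
    (contMDiff_const.prodMk contMDiff_id)

theorem contMDiff_smul_right (q : Q) : ContMDiff 𝓘(ℝ, E) 𝓘(ℝ, F) ∞ (fun g : G => g • q) :=
  (contMDiff_smul (I := 𝓘(ℝ, E)) (I' := 𝓘(ℝ, F)) (n := ∞)).comp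
    (contMDiff_id.prodMk contMDiff_const)

include E in
theorem hasModelDerivAt_smul (g : G) (q : Q) :
    HasModelDerivAt 𝓘(ℝ, F) 𝓘(ℝ, F) (fun x : Q => g • x) q (actDeriv g q) :=
  _root_.MDifferentiableAt.hasModelDerivAt
    ((contMDiff_smul_left (E := E) g).mdifferentiableAt (by simp))

include E in
theorem actDeriv_mul (g h : G) (q : Q) :
    actDeriv (g * h) q = (actDeriv g (h • q)).comp (actDeriv (F := F) h q) := by
  apply HasModelDerivAt.modelDeriv_eq
  have h1 := (hasModelDerivAt_smul (E := E) (F := F) g (h • q)).comp rfl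
    (hasModelDerivAt_smul (E := E) h q)
  simpa only [mul_smul] using h1

theorem actDeriv_one (q : Q) : actDeriv (1 : G) q = ContinuousLinearMap.id ℝ F := by
  apply HasModelDerivAt.modelDeriv_eq
  simpa only [one_smul] using hasModelDerivAt_id (I := 𝓘(ℝ, F)) q

include E in
theorem actDeriv_inv_comp (g : G) (q : Q) :
    (actDeriv g⁻¹ (g • q)).comp (actDeriv g q) = ContinuousLinearMap.id ℝ F := by
  rw [← actDeriv_mul (E := E), inv_mul_cancel, actDeriv_one]

include E in
theorem cotAct_mul (g h : G) (α : Cotangent F Q) :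
    cotAct (g * h) α = cotAct g (cotAct h α) := by
  refine cotangent_ext (mul_smul _ _ _) ?_
  rw [momentum_cotAct, momentum_cotAct, momentum_cotAct, mul_inv_rev, actDeriv_mul (E := E),
    mul_smul, cotAct_fst, inv_smul_smul, ContinuousLinearMap.comp_assoc]

theorem cotAct_one (α : Cotangent F Q) : cotAct (1 : G) α = α := by
  refine cotangent_ext (one_smul _ _) ?_
  rw [momentum_cotAct, inv_one, actDeriv_one, ContinuousLinearMap.comp_id]

include E in
theorem cotAct_inv_cotAct (g : G) (α : Cotangent F Q) : cotAct g⁻¹ (cotAct g α) = α := by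
  rw [← cotAct_mul (E := E), inv_mul_cancel, cotAct_one]

include E in
theorem cotAct_cotAct_inv (g : G) (α : Cotangent F Q) : cotAct g (cotAct g⁻¹ α) = α := by
  rw [← cotAct_mul (E := E), mul_inv_cancel, cotAct_one]

include E in
theorem mem_invariantAlgebra_iff {f : SmoothFun F Q} :
    f ∈ invariantAlgebra G F Q ↔ ∀ (g : G) (α : Cotangent F Q), f (cotAct g α) = f α := by
  constructor
  · intro h g α
    have hp : ∀ p : F →L[ℝ] ℝ, p = momentum (cotAct g α) → f (cotAct g α) = f α := ?_
    · exact hp _ rfl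
    intro p hp
    have h2 : (⟨g • α.1, p⟩ : Cotangent F Q) = cotAct g α := cotangent_ext rfl hp
    refine (congrArg f h2.symm).trans ((h g α.1 p).symm.trans (congrArg f ?_))
    have h1 : p.comp (actDeriv g α.1) = momentum α := by
      rw [hp, momentum_cotAct, ContinuousLinearMap.comp_assoc, actDeriv_inv_comp (E := E),
        ContinuousLinearMap.comp_id]
    exact cotangent_ext rfl h1
  · intro h g q p
    refine (h g _).symm.trans (congrArg f ?_)
    have h1 := actDeriv_inv_comp (E := E) (F := F) g⁻¹ (g • q)
    rw [inv_inv, inv_smul_smul] at h1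
    have h2 : ∀ p : F →L[ℝ] ℝ, (p.comp (actDeriv g q)).comp (actDeriv g⁻¹ (g • q)) = p := by
      intro p
      rw [ContinuousLinearMap.comp_assoc, h1, ContinuousLinearMap.comp_id]
    exact cotangent_ext rfl (h2 p)

theorem contMDiff_cotAct : ContMDiff (𝓘(ℝ, E).prod (cotModel F)) (cotModel F) ∞
    (fun p : G × Cotangent F Q => cotAct p.1 p.2) := by
  rintro ⟨g₀, α₀⟩
  set β₀ := cotAct g₀ α₀
  set φ := extChartAt 𝓘(ℝ, F) α₀.1
  set ψ := extChartAt 𝓘(ℝ, F) β₀.1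
  have hproj : ContMDiff (𝓘(ℝ, E).prod (cotModel F)) 𝓘(ℝ, F) ∞
      (fun p : G × Cotangent F Q => p.1 • p.2.1) :=
    (contMDiff_smul (I := 𝓘(ℝ, E)) (I' := 𝓘(ℝ, F)) (n := ∞)).comp
      (contMDiff_fst.prodMk ((Bundle.contMDiff_proj _).comp contMDiff_snd))
  have hφ : α₀.1 ∈ φ.source := mem_extChartAt_source _
  have hψ : g₀ • α₀.1 ∈ ψ.source := mem_extChartAt_source (I := 𝓘(ℝ, F)) β₀.1
  have hα : α₀ ∈ (cotChart α₀).source := mem_extChartAt_source _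
  refine contMDiffAt_cotangent hproj.contMDiffAt ?_
  have hz : ContMDiffAt (𝓘(ℝ, E).prod (cotModel F)) 𝓘(ℝ, F) ∞
      (fun p : G × Cotangent F Q => ψ (p.1 • p.2.1)) (g₀, α₀) :=
    ContMDiffAt.comp (g₀, α₀) (contMDiffAt_extChartAt_of_mem hψ) hproj.contMDiffAt
  have hD : ContMDiffAt (𝓘(ℝ, E).prod (cotModel F)) 𝓘(ℝ, F →L[ℝ] F) ∞
      (fun p : G × Cotangent F Q =>
        fderiv ℝ (fun z => φ (p.1⁻¹ • ψ.symm z)) (ψ (p.1 • p.2.1))) (g₀, α₀) := by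
    refine contMDiffAt_fderiv_param (N := G × Cotangent F Q)
      (f := fun p z => φ (p.1⁻¹ • ψ.symm z)) ?_ hz
    have h1 : ContMDiffAt ((𝓘(ℝ, E).prod (cotModel F)).prod 𝓘(ℝ, F)) 𝓘(ℝ, F) ∞
        (fun p : (G × Cotangent F Q) × F => ψ.symm p.2) ((g₀, α₀), ψ (g₀ • α₀.1)) :=
      ContMDiffAt.comp ((g₀, α₀), ψ (g₀ • α₀.1))
        (contMDiffAt_extChartAt_symm_of_mem (ψ.map_source hψ)) contMDiffAt_snd
    have h2 := ContMDiffAt.comp ((g₀, α₀), ψ (g₀ • α₀.1))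
      (contMDiff_smul (I := 𝓘(ℝ, E)) (I' := 𝓘(ℝ, F)) (n := ∞) (G := G) (M := Q)).contMDiffAt
      (((contMDiffAt_fst.comp _ contMDiffAt_fst).inv).prodMk h1)
    refine ContMDiffAt.comp ((g₀, α₀), ψ (g₀ • α₀.1)) (contMDiffAt_extChartAt_of_mem ?_) h2
    simp only
    rw [ψ.left_inv hψ, inv_smul_smul]
    exact hφ
  have hm : ContMDiffAt (𝓘(ℝ, E).prod (cotModel F)) 𝓘(ℝ, F →L[ℝ] ℝ) ∞
      (fun p : G × Cotangent F Q => (cotChart α₀ p.2).2) (g₀, α₀) := by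
    have h1 : ContMDiffAt (cotModel F) 𝓘(ℝ, CotSpace F) ∞ (cotChart α₀) α₀ :=
      contMDiffAt_extChartAt_of_mem hα
    have h2 := ContMDiffAt.comp α₀ (ContinuousLinearMap.snd ℝ F
      (F →L[ℝ] ℝ)).contDiff.contDiffAt.contMDiffAt h1
    exact ContMDiffAt.comp (g := fun β => (cotChart α₀ β).2) (f := Prod.snd) (g₀, α₀) h2
      contMDiffAt_snd
  refine (hm.clm_comp hD).congr_of_eventuallyEq ?_
  have e1 : ∀ᶠ p : G × Cotangent F Q in 𝓝 (g₀, α₀), p.2 ∈ (cotChart α₀).source :=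
    continuousAt_snd.eventually (eventually_extChartAt_source hα)
  have e2 : ∀ᶠ p : G × Cotangent F Q in 𝓝 (g₀, α₀), p.1 • p.2.1 ∈ ψ.source :=
    hproj.continuous.continuousAt.eventually (eventually_extChartAt_source hψ)
  filter_upwards [e1, e2] with p h1 h2
  have h3 : cotAct p.1 p.2 ∈ (cotChart β₀).source := mem_cotChart_source.2 h2
  have h4 := mem_cotChart_source.1 h1
  rw [cotChart_apply h3]
  simp only [cotAct_fst]
  rw [momentum_cotAct, momentum_eq h1]
  have h5 := (hasModelDerivAt_extChartAt (I := 𝓘(ℝ, F)) h4).comp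
    (x := ψ (p.1 • p.2.1)) (g := fun z => p.1⁻¹ • ψ.symm z)
    (by simp only [ψ.left_inv h2, inv_smul_smul])
    ((hasModelDerivAt_smul (E := E) (F := F) p.1⁻¹ (p.1 • p.2.1)).comp
      (g := ψ.symm) (by exact ψ.left_inv h2)
      (hasModelDerivAt_extChartAt_symm (I := 𝓘(ℝ, F)) (ψ.map_source h2)))
  rw [(hasModelDerivAt_iff.1 h5).fderiv]
  rfl

include E in
theorem contMDiff_cotAct_left (g : G) :
    ContMDiff (cotModel F) (cotModel F) ∞ (fun α : Cotangent F Q => cotAct g α) :=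
  (contMDiff_cotAct (E := E) (G := G) (F := F) (Q := Q)).comp
    (contMDiff_const.prodMk contMDiff_id)

theorem contMDiff_cotAct_right (α : Cotangent F Q) :
    ContMDiff 𝓘(ℝ, E) (cotModel F) ∞ (fun g : G => cotAct g α) :=
  (contMDiff_cotAct (E := E) (G := G) (F := F) (Q := Q)).comp
    (contMDiff_id.prodMk contMDiff_const)

/-- The differential of the cotangent lift of the action of `g`. -/
def cotActDeriv (g : G) (α : Cotangent F Q) : CotSpace F →L[ℝ] CotSpace F :=
  modelDeriv (cotModel F) (cotModel F) (fun α : Cotangent F Q => cotAct g α) α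

include E in
theorem hasModelDerivAt_cotAct (g : G) (α : Cotangent F Q) :
    HasModelDerivAt (cotModel F) (cotModel F) (fun α : Cotangent F Q => cotAct g α) α
      (cotActDeriv g α) :=
  _root_.MDifferentiableAt.hasModelDerivAt
    ((contMDiff_cotAct_left (E := E) g).mdifferentiableAt (by simp))

/-- The infinitesimal action of the Lie algebra on `T*Q`, that is, the differential at the identity of
`g ↦ g • α`. -/
def cotOrbit (G : Type*) [TopologicalSpace G] [Group G] [ChartedSpace E G] [MulAction G Q]
    (α : Cotangent F Q) : E →L[ℝ] CotSpace F :=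
  modelDeriv 𝓘(ℝ, E) (cotModel F) (fun g : G => cotAct g α) 1

theorem hasModelDerivAt_cotOrbit (α : Cotangent F Q) :
    HasModelDerivAt 𝓘(ℝ, E) (cotModel F) (fun g : G => cotAct g α) 1 (cotOrbit G α) :=
  _root_.MDifferentiableAt.hasModelDerivAt
    ((contMDiff_cotAct_right (E := E) α).mdifferentiableAt (by simp))

/-- The infinitesimal action of the Lie algebra on `Q`, that is, the differential at the identity of
`g ↦ g • q`. -/
def baseOrbit (G : Type*) [TopologicalSpace G] [Group G] [ChartedSpace E G] [MulAction G Q]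
    (q : Q) : E →L[ℝ] F := modelDeriv 𝓘(ℝ, E) 𝓘(ℝ, F) (fun g : G => g • q) 1

theorem hasModelDerivAt_baseOrbit (q : Q) :
    HasModelDerivAt 𝓘(ℝ, E) 𝓘(ℝ, F) (fun g : G => g • q) 1 (baseOrbit G q) :=
  _root_.MDifferentiableAt.hasModelDerivAt
    ((contMDiff_smul_right (E := E) q).mdifferentiableAt (by simp))

theorem baseOrbit_smul (g : G) (q : Q) (ξ : E) :
    baseOrbit G (g • q) (Ad g ξ) = actDeriv (F := F) g q (baseOrbit G q ξ) := by
  have h1 := (hasModelDerivAt_baseOrbit (E := E) (F := F) (g • q)).comp (by group)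
    (hasModelDerivAt_conj (E := E) g)
  have h2 := HasModelDerivAt.comp (f := fun x : Q => g • x) (g := fun x : G => x • q)
    (hasModelDerivAt_smul (E := E) (F := F) g q) (one_smul G q)
    (hasModelDerivAt_baseOrbit (E := E) (F := F) q)
  have h3 : (fun x : G => (g * x * g⁻¹) • (g • q)) = fun x : G => g • (x • q) := by
    ext x; simp [mul_smul]
  rw [h3] at h1
  exact congrArg (fun L => L ξ) (h1.unique h2)

theorem cotOrbit_cotAct (g : G) (α : Cotangent F Q) (ξ : E) :
    cotOrbit G (cotAct g α) (Ad g ξ) = cotActDeriv g α (cotOrbit G α ξ) := by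
  have h1 := (hasModelDerivAt_cotOrbit (E := E) (F := F) (cotAct g α)).comp (by group)
    (hasModelDerivAt_conj (E := E) g)
  have h2 := HasModelDerivAt.comp (f := fun x : Cotangent F Q => cotAct g x)
    (g := fun x : G => cotAct x α)
    (hasModelDerivAt_cotAct (E := E) (F := F) g α) (cotAct_one α)
    (hasModelDerivAt_cotOrbit (E := E) (F := F) α)
  have h3 : (fun x : G => cotAct (g * x * g⁻¹) (cotAct g α)) =
      fun x : G => cotAct g (cotAct x α) := by
    ext1 x
    rw [← cotAct_mul (E := E), ← cotAct_mul (E := E), inv_mul_cancel_right]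
  rw [h3] at h1
  exact congrArg (fun L => L ξ) (h1.unique h2)

/-- The moment map, with values in the dual of the model space. -/
def moment (G : Type*) [TopologicalSpace G] [Group G] [ChartedSpace E G] [MulAction G Q]
    (α : Cotangent F Q) : E →L[ℝ] ℝ := momentMap G α

theorem moment_eq (α : Cotangent F Q) : moment G α = (momentum α).comp (baseOrbit (E := E) G α.1) :=
  rfl

theorem moment_cotAct (g : G) (α : Cotangent F Q) :
    moment G (cotAct g α) = (moment G α).comp (Ad (E := E) g⁻¹) := by
  refine ContinuousLinearMap.ext fun ξ => ?_
  rw [moment_eq, moment_eq, momentum_cotAct]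
  simp only [ContinuousLinearMap.comp_apply, cotAct_fst]
  have h := baseOrbit_smul (E := E) (F := F) g α.1 (Ad g⁻¹ ξ)
  rw [Ad_Ad_inv] at h
  rw [h]
  have h1 := congrArg (fun L => L (baseOrbit G α.1 (Ad (E := E) g⁻¹ ξ)))
    (actDeriv_inv_comp (E := E) (F := F) g α.1)
  exact congrArg _ h1

theorem proj_cotOrbit (α : Cotangent F Q) (ξ : E) :
    modelDeriv (cotModel F) 𝓘(ℝ, F) (fun β : Cotangent F Q => β.1) α (cotOrbit G α ξ) =
      baseOrbit G α.1 ξ := by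
  have h1 := (hasModelDerivAt_proj α).comp (by exact cotAct_one α)
    (hasModelDerivAt_cotOrbit (E := E) (G := G) α)
  exact congrArg (fun L => L ξ) (h1.unique (hasModelDerivAt_baseOrbit α.1))

theorem liouville_apply (α : Cotangent F Q) (X : CotSpace F) : liouville α X =
    momentum α (modelDeriv (cotModel F) 𝓘(ℝ, F) (fun β : Cotangent F Q => β.1) α X) := rfl

theorem liouville_cotOrbit (α : Cotangent F Q) (ξ : E) :
    liouville α (cotOrbit G α ξ) = moment G α ξ := by
  rw [liouville_apply, proj_cotOrbit]; rfl

include E in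
theorem liouville_cotActDeriv (g : G) (α : Cotangent F Q) (X : CotSpace F) :
    liouville (cotAct g α) (cotActDeriv g α X) = liouville α X := by
  have h1 := (hasModelDerivAt_proj (cotAct g α)).comp rfl
    (hasModelDerivAt_cotAct (E := E) (F := F) g α)
  have h2 := (hasModelDerivAt_smul (E := E) (F := F) g α.1).comp rfl (hasModelDerivAt_proj α)
  have h3 := congrArg (fun L => L X) (h1.unique h2)
  simp only [ContinuousLinearMap.comp_apply] at h3
  rw [liouville_apply, liouville_apply, h3, momentum_cotAct]
  have h4 := congrArg (fun L => L (modelDeriv (cotModel F) 𝓘(ℝ, F)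
    (fun β : Cotangent F Q => β.1) α X)) (actDeriv_inv_comp (E := E) (F := F) g α.1)
  exact congrArg _ h4

include E in
/-- The cotangent lift preserves the symplectic form, since it preserves the Liouville form. -/
theorem sympl_cotActDeriv (g : G) (α : Cotangent F Q) (X Y : CotSpace F) :
    sympl (cotAct g α) (cotActDeriv g α X) (cotActDeriv g α Y) = sympl α X Y := by
  set φ := cotChart α
  have hα : α ∈ φ.source := mem_extChartAt_source α
  have hz : φ α ∈ φ.target := φ.map_source hα
  have hT : ContMDiffAt 𝓘(ℝ, CotSpace F) (cotModel F) ∞ (fun z => cotAct g (φ.symm z)) (φ α) :=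
    (contMDiff_cotAct_left (E := E) g).contMDiffAt.comp _
      (contMDiffAt_extChartAt_symm_of_mem hz)
  have hD : ∀ z ∈ φ.target, modelDeriv 𝓘(ℝ, CotSpace F) (cotModel F)
      (fun z => cotAct g (φ.symm z)) z = (cotActDeriv g (φ.symm z)).comp
        (modelDeriv 𝓘(ℝ, CotSpace F) (cotModel F) φ.symm z) := fun z hz =>
    ((hasModelDerivAt_cotAct (E := E) g (φ.symm z)).comp rfl
      (hasModelDerivAt_extChartAt_symm (I := cotModel F) hz)).modelDeriv_eq
  have h1 := sympl_pullback hT (modelDeriv (cotModel F) 𝓘(ℝ, CotSpace F) φ α X)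
    (modelDeriv (cotModel F) 𝓘(ℝ, CotSpace F) φ α Y)
  rw [hD _ hz] at h1
  simp only [ContinuousLinearMap.comp_apply] at h1
  rw [modelDeriv_symm_modelDeriv hα, modelDeriv_symm_modelDeriv hα, φ.left_inv hα] at h1
  rw [h1, sympl_self_chart, ← extDerivOneForm_canonicalOneForm (φ α)]
  congr 2
  refine extDerivOneForm_congr ?_
  filter_upwards [eventually_extChartAt_target hz] with z hz
  rw [hD z hz, ← liouville_comp_symm hz]
  refine ContinuousLinearMap.ext fun Z => ?_
  simp only [ContinuousLinearMap.comp_apply]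
  exact liouville_cotActDeriv (E := E) g _ _

theorem contMDiff_moment :
    ContMDiff (cotModel F) 𝓘(ℝ, E →L[ℝ] ℝ) ∞ (fun α : Cotangent F Q => moment (E := E) G α) := by
  intro α₀
  set φ := extChartAt 𝓘(ℝ, F) α₀.1
  set ψ := chartOne E G
  have hφ : α₀.1 ∈ φ.source := mem_extChartAt_source _
  have hα : α₀ ∈ (cotChart α₀).source := mem_extChartAt_source _
  have hproj : ContMDiff (cotModel F) 𝓘(ℝ, F) ∞ (fun α : Cotangent F Q => α.1) :=
    Bundle.contMDiff_proj _
  have hD : ContMDiffAt (cotModel F) 𝓘(ℝ, E →L[ℝ] F) ∞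
      (fun α : Cotangent F Q => fderiv ℝ (fun z => φ (ψ.symm z • α.1)) (ψ 1)) α₀ := by
    refine contMDiffAt_fderiv_param (N := Cotangent F Q) (y := fun _ => ψ 1)
      (f := fun α z => φ (ψ.symm z • α.1)) ?_ contMDiffAt_const
    have h1 : ContMDiffAt ((cotModel F).prod 𝓘(ℝ, E)) 𝓘(ℝ, E) ∞
        (fun p : Cotangent F Q × E => ψ.symm p.2) (α₀, ψ 1) :=
      ContMDiffAt.comp (α₀, ψ 1)
        (contMDiffAt_extChartAt_symm_of_mem chartOne_mem_target) contMDiffAt_snd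
    have h2 := ContMDiffAt.comp (α₀, ψ 1)
      (contMDiff_smul (I := 𝓘(ℝ, E)) (I' := 𝓘(ℝ, F)) (n := ∞) (G := G) (M := Q)).contMDiffAt
      (h1.prodMk (hproj.contMDiffAt.comp _ contMDiffAt_fst))
    refine ContMDiffAt.comp (α₀, ψ 1) (contMDiffAt_extChartAt_of_mem ?_) h2
    simp only [ψ]
    rw [chartOne_symm_one, one_smul]
    exact hφ
  have hm : ContMDiffAt (cotModel F) 𝓘(ℝ, F →L[ℝ] ℝ) ∞
      (fun p : Cotangent F Q => (cotChart α₀ p).2) α₀ := by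
    have h1 : ContMDiffAt (cotModel F) 𝓘(ℝ, CotSpace F) ∞ (cotChart α₀) α₀ :=
      contMDiffAt_extChartAt_of_mem hα
    exact ContMDiffAt.comp α₀ (ContinuousLinearMap.snd ℝ F
      (F →L[ℝ] ℝ)).contDiff.contDiffAt.contMDiffAt h1
  refine (hm.clm_comp hD).congr_of_eventuallyEq ?_
  filter_upwards [eventually_extChartAt_source hα] with α h1
  have h4 := mem_cotChart_source.1 h1
  rw [moment_eq, momentum_eq h1]
  have h6 : HasModelDerivAt 𝓘(ℝ, E) 𝓘(ℝ, E) (chartOne E G).symm (chartOne E G 1) (.id ℝ E) :=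
    hasMFDerivAt_chartOne_symm
  have h5 := (hasModelDerivAt_extChartAt (I := 𝓘(ℝ, F)) h4).comp
    (x := ψ 1) (g := fun z => ψ.symm z • α.1) (by simp only [ψ, chartOne_symm_one, one_smul])
    (HasModelDerivAt.comp (f := fun g : G => g • α.1) (g := ψ.symm)
    (hasModelDerivAt_baseOrbit (E := E) (F := F) α.1) chartOne_symm_one h6)
  rw [(hasModelDerivAt_iff.1 h5).fderiv, ContinuousLinearMap.comp_id]
  rfl

theorem continuous_moment : Continuous (fun α : Cotangent F Q => moment (E := E) G α) :=
  contMDiff_moment.continuous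

variable (F Q G) in
/-- The component `Φ_ξ` of the moment map, as a smooth function on `T*Q`. -/
def momentFun (ξ : E) : SmoothFun F Q :=
  ⟨fun α => moment G α ξ, contMDiff_moment.clm_apply contMDiff_const⟩

@[simp] theorem momentFun_apply (ξ : E) (α : Cotangent F Q) :
    momentFun G F Q ξ α = moment G α ξ := rfl

variable [T2Space G]

theorem hasVelocity_cotAct_oneParam (ξ : E) (α : Cotangent F Q) (t : ℝ) :
    HasVelocity (cotModel F) (fun t => cotAct (oneParam G ξ t) α) t
      (cotOrbit G (cotAct (oneParam G ξ t) α) ξ) := by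
  have h1 := (hasVelocity_oneParam (G := G) ξ).comp
    (hasModelDerivAt_cotOrbit (E := E) (cotAct (oneParam G ξ t) α)) (oneParam_zero ξ)
  have h2 : HasDerivAt (fun s : ℝ => s - t) 1 t := by simpa using (hasDerivAt_id t).sub_const t
  have h3 := HasVelocity.comp_hasDerivAt (f := fun s => s - t) (sub_self t) h1 h2
  rw [one_smul] at h3
  refine h3.congr (Eventually.of_forall fun s => ?_)
  simp only
  rw [← cotAct_mul (E := E), ← oneParam_add, sub_add_cancel]

theorem Ad_oneParam_self (ξ : E) (t : ℝ) : Ad (oneParam G ξ t) ξ = ξ :=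
  Ad_oneParam_of_lieBr_eq_zero (lieBr_self ξ) t

theorem oneParam_neg (ξ : E) (t : ℝ) : oneParam G ξ (-t) = (oneParam G ξ t)⁻¹ := by
  rw [eq_inv_iff_mul_eq_one, ← oneParam_add, neg_add_cancel, oneParam_zero]

theorem moment_cotAct_oneParam (ξ : E) (α : Cotangent F Q) (t : ℝ) :
    moment G (cotAct (oneParam G ξ t) α) ξ = moment G α ξ := by
  rw [moment_cotAct, ContinuousLinearMap.comp_apply, ← oneParam_neg, Ad_oneParam_self]

/-- The infinitesimal action is Hamiltonian, with Hamiltonian function `Φ_ξ`. The map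
`(t, z) ↦ exp(tξ) • z` pulls the Liouville form back to `Φ_ξ dt + p dx`, because the lifted action
preserves the Liouville form and `Φ_ξ` is constant along `exp(tξ)`. -/
theorem sympl_cotOrbit [FiniteDimensional ℝ F] (ξ : E) (α : Cotangent F Q) (Y : CotSpace F) :
    sympl α (cotOrbit G α ξ) Y = -diffl (momentFun G F Q ξ) α Y := by
  set φ := cotChart α
  set f := momentFun G F Q ξ
  have hα : α ∈ φ.source := mem_extChartAt_source α
  have hz : φ α ∈ φ.target := φ.map_source hα
  set T : ℝ × CotSpace F → Cotangent F Q := fun p => cotAct (oneParam G ξ p.1) (φ.symm p.2)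
  have hTs : ∀ p : ℝ × CotSpace F, p.2 ∈ φ.target →
      ContMDiffAt 𝓘(ℝ, ℝ × CotSpace F) (cotModel F) ∞ T p := by
    intro p hp
    have h1 : ContMDiffAt 𝓘(ℝ, ℝ × CotSpace F) 𝓘(ℝ, E) ∞ (fun p => oneParam G ξ p.1) p :=
      (contMDiff_oneParam ξ).contMDiffAt.comp p contDiffAt_fst.contMDiffAt
    have h2 : ContMDiffAt 𝓘(ℝ, ℝ × CotSpace F) (cotModel F) ∞
        (fun p : ℝ × CotSpace F => φ.symm p.2) p :=
      ContMDiffAt.comp p (contMDiffAt_extChartAt_symm_of_mem hp) contDiffAt_snd.contMDiffAt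
    exact ContMDiffAt.comp p (contMDiff_cotAct (E := E) (G := G) (F := F) (Q := Q)).contMDiffAt
      (h1.prodMk h2)
  have hT0 : T (0, φ α) = α := by
    simp only [T]; rw [oneParam_zero, cotAct_one, φ.left_inv hα]
  have hD1 : ∀ p : ℝ × CotSpace F, p.2 ∈ φ.target → ∀ s : ℝ,
      modelDeriv 𝓘(ℝ, ℝ × CotSpace F) (cotModel F) T p (s, 0) = s • cotOrbit G (T p) ξ := by
    intro p hp s
    have h1 : HasModelDerivAt 𝓘(ℝ, ℝ × CotSpace F) (cotModel F) T p _ :=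
      _root_.MDifferentiableAt.hasModelDerivAt ((hTs p hp).mdifferentiableAt (by simp))
    have h2 : HasDerivAt (fun t : ℝ => (t, p.2)) ((1 : ℝ), (0 : CotSpace F)) p.1 :=
      (hasDerivAt_id p.1).prodMk (hasDerivAt_const _ _)
    have h3 := ((HasDerivAt.hasVelocity h2).comp h1 rfl).unique
      (hasVelocity_cotAct_oneParam ξ (φ.symm p.2) p.1)
    have h4 : ((s, 0) : ℝ × CotSpace F) = s • (1, 0) := by simp
    rw [h4, map_smul, h3]
  have hD2 : ∀ p : ℝ × CotSpace F, p.2 ∈ φ.target → ∀ Z : CotSpace F,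
      modelDeriv 𝓘(ℝ, ℝ × CotSpace F) (cotModel F) T p (0, Z) =
        cotActDeriv (oneParam G ξ p.1) (φ.symm p.2)
          (modelDeriv 𝓘(ℝ, CotSpace F) (cotModel F) φ.symm p.2 Z) := by
    intro p hp Z
    have h1 : HasModelDerivAt 𝓘(ℝ, ℝ × CotSpace F) (cotModel F) T p _ :=
      _root_.MDifferentiableAt.hasModelDerivAt ((hTs p hp).mdifferentiableAt (by simp))
    have h2 : HasFDerivAt (fun z : CotSpace F => (p.1, z))
        ((0 : CotSpace F →L[ℝ] ℝ).prod (.id ℝ (CotSpace F))) p.2 :=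
      (hasFDerivAt_const _ _).prodMk (hasFDerivAt_id _)
    have h3 := (h1.comp (g := fun z : CotSpace F => (p.1, z)) rfl (hasModelDerivAt_iff.2 h2)).unique
      ((hasModelDerivAt_cotAct (E := E) (oneParam G ξ p.1) (φ.symm p.2)).comp rfl
        (hasModelDerivAt_extChartAt_symm (I := cotModel F) hp))
    exact congrArg (fun L => L Z) h3
  -- The form `Φ_ξ dt + p dx` on `ℝ × (F × F*)`.
  set κ : ℝ × CotSpace F → (ℝ × CotSpace F) →L[ℝ] ℝ := fun p =>
    (ContinuousLinearMap.mul ℝ ℝ (f (φ.symm p.2))).comp (ContinuousLinearMap.fst ℝ ℝ (CotSpace F)) +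
      (canonicalOneForm p.2).comp (ContinuousLinearMap.snd ℝ ℝ (CotSpace F))
  have hκ : (fun p => (liouville (T p)).comp
      (modelDeriv 𝓘(ℝ, ℝ × CotSpace F) (cotModel F) T p)) =ᶠ[𝓝 (0, φ α)] κ := by
    have hev : ∀ᶠ p : ℝ × CotSpace F in 𝓝 (0, φ α), p.2 ∈ φ.target :=
      continuousAt_snd.eventually (eventually_extChartAt_target hz)
    filter_upwards [hev] with p hp
    refine ContinuousLinearMap.ext fun v => ?_
    obtain ⟨s, Z⟩ := v
    have h1 : ((s, Z) : ℝ × CotSpace F) = (s, 0) + (0, Z) := by simp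
    rw [h1, map_add, map_add]
    simp only [ContinuousLinearMap.comp_apply]
    rw [hD1 p hp, hD2 p hp, map_smul, liouville_cotOrbit, liouville_cotActDeriv (E := E)]
    have h2 := congrArg (fun L => L Z) (liouville_comp_symm hp)
    simp only [ContinuousLinearMap.comp_apply] at h2
    rw [h2]
    simp only [T, κ]
    rw [moment_cotAct_oneParam]
    simp [f, mul_comm]
  have h4 := sympl_pullback (hTs (0, φ α) hz) (1, 0)
    (0, modelDeriv (cotModel F) 𝓘(ℝ, CotSpace F) φ α Y)
  rw [extDerivOneForm_congr hκ, hD1 _ hz, hD2 _ hz, hT0, one_smul, extDerivOneForm_suspension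
    ((contDiffAt_chart f hz).differentiableAt (by simp))
    differentiable_canonicalOneForm.differentiableAt] at h4
  simp only [oneParam_zero] at h4
  have h5 : cotActDeriv (1 : G) (φ.symm (φ α)) = ContinuousLinearMap.id ℝ (CotSpace F) := by
    apply HasModelDerivAt.modelDeriv_eq
    have : (fun α : Cotangent F Q => cotAct (1 : G) α) = fun α => α := funext cotAct_one
    rw [this]
    exact hasModelDerivAt_id _
  rw [h5, ContinuousLinearMap.id_apply, modelDeriv_symm_modelDeriv hα] at h4
  rw [h4, diffl_chart f hα]
  rfl

theorem hamField_momentFun [FiniteDimensional ℝ F] (ξ : E) (α : Cotangent F Q) :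
    hamField (momentFun G F Q ξ) α = cotOrbit G α ξ := hamField_unique (sympl_cotOrbit ξ α)

end Action

/-! ### The algebras of integrals -/

section Dual

variable (E : Type*) [NormedAddCommGroup E] [NormedSpace ℝ E] [FiniteDimensional ℝ E]

/-- The identification of a finite dimensional space with its double dual. -/
def bidual : E ≃L[ℝ] ((E →L[ℝ] ℝ) →L[ℝ] ℝ) :=
  (LinearEquiv.ofInjectiveOfFinrankEq
    ((ContinuousLinearMap.apply ℝ ℝ : E →L[ℝ] (E →L[ℝ] ℝ) →L[ℝ] ℝ) : E →ₗ[ℝ] _)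
    (by
      rw [← LinearMap.ker_eq_bot, LinearMap.ker_eq_bot']
      intro ξ hξ
      by_contra hne
      obtain ⟨p, hp⟩ := SeparatingDual.exists_ne_zero (R := ℝ) hne
      exact hp (congrArg (fun L : (E →L[ℝ] ℝ) →L[ℝ] ℝ => L p) hξ))
    (by rw [finrank_dual_eq, finrank_dual_eq])).toContinuousLinearEquiv

variable {E}

theorem bidual_apply (ξ : E) (μ : E →L[ℝ] ℝ) : bidual E ξ μ = μ ξ := rfl

theorem apply_bidual_symm (L : (E →L[ℝ] ℝ) →L[ℝ] ℝ) (μ : E →L[ℝ] ℝ) :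
    μ ((bidual E).symm L) = L μ := by
  rw [← bidual_apply, ContinuousLinearEquiv.apply_symm_apply]

end Dual

section Hamiltonian

variable {F : Type*} [NormedAddCommGroup F] [NormedSpace ℝ F] [FiniteDimensional ℝ F]
  {Q : Type*} [TopologicalSpace Q] [ChartedSpace F Q] [IsManifold 𝓘(ℝ, F) ∞ Q]

theorem diffl_add (f g : SmoothFun F Q) (α : Cotangent F Q) :
    diffl (f + g : SmoothFun F Q) α = diffl f α + diffl g α := by
  refine HasModelDerivAt.unique (hasModelDerivAt_diffl (f + g) α) ?_
  exact HasMFDerivAt.add (f := f) (g := g) (f' := diffl f α) (g' := diffl g α)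
    (hasModelDerivAt_diffl f α) (hasModelDerivAt_diffl g α)

theorem diffl_smul (c : ℝ) (f : SmoothFun F Q) (α : Cotangent F Q) :
    diffl (c • f : SmoothFun F Q) α = c • diffl f α := by
  refine HasModelDerivAt.unique (hasModelDerivAt_diffl (c • f) α) ?_
  exact HasMFDerivAt.const_smul (f := f) (f' := diffl f α) (hasModelDerivAt_diffl f α) c

theorem hamField_add (f g : SmoothFun F Q) (α : Cotangent F Q) :
    hamField (f + g : SmoothFun F Q) α = hamField f α + hamField g α := by
  refine hamField_unique fun Y => ?_
  rw [map_add, sympl_hamField, sympl_hamField, diffl_add]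
  simp [add_comm]

theorem hamField_congr {f g : Cotangent F Q → ℝ} {α : Cotangent F Q} (h : diffl f α = diffl g α) :
    hamField f α = hamField g α := by rw [hamField_eq, hamField_eq, h]

theorem poissonBracket_skew (f g : Cotangent F Q → ℝ) (α : Cotangent F Q) :
    poissonBracket f g α = -poissonBracket g f α := by
  have h : ∀ f g : Cotangent F Q → ℝ,
      poissonBracket f g α = -sympl α (hamField f α) (hamField g α) := by
    intro f g
    rw [sympl_hamField, poissonBracket_eq]; simp
  rw [h, h, sympl_skew]

theorem isFirstIntegral_of_poissonBracket {Ham : Cotangent F Q → ℝ} {f : SmoothFun F Q}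
    (h : ∀ α, poissonBracket f Ham α = 0) : IsFirstIntegral Ham f := by
  intro γ a b hγ s hs t ht
  have hv : ∀ u ∈ Ioo a b, HasDerivAt (fun u => f (γ u)) 0 u := by
    intro u hu
    have h1 : HasVelocity (cotModel F) γ u (hamField Ham (γ u)) :=
      (hγ u hu).hasMFDerivAt (Ioo_mem_nhds hu.1 hu.2)
    have h2 := (h1.comp (hasModelDerivAt_diffl f (γ u)) rfl).hasDerivAt
    rwa [← poissonBracket_eq, h] at h2
  refine (convex_Ioo a b).is_const_of_fderivWithin_eq_zero (𝕜 := ℝ) (f := fun u => f (γ u))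
    (fun u hu => (hv u hu).differentiableAt.differentiableWithinAt) (fun u hu => ?_) hs ht
  rw [fderivWithin_of_isOpen isOpen_Ioo hu, (hv u hu).hasFDerivAt.fderiv]
  ext; simp

end Hamiltonian

section Action

variable {E : Type*} [NormedAddCommGroup E] [NormedSpace ℝ E] [FiniteDimensional ℝ E]
  {G : Type*} [TopologicalSpace G] [Group G] [ChartedSpace E G] [LieGroup 𝓘(ℝ, E) ∞ G] [T2Space G]
  {F : Type*} [NormedAddCommGroup F] [NormedSpace ℝ F] [FiniteDimensional ℝ F]
  {Q : Type*} [TopologicalSpace Q] [ChartedSpace F Q] [IsManifold 𝓘(ℝ, F) ∞ Q] [MulAction G Q]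
  [ContMDiffSMul 𝓘(ℝ, E) 𝓘(ℝ, F) ∞ G Q]

/-- The differential of the moment map. -/
def momentDeriv (G : Type*) [TopologicalSpace G] [Group G] [ChartedSpace E G] [MulAction G Q]
    (α : Cotangent F Q) : CotSpace F →L[ℝ] (E →L[ℝ] ℝ) :=
  modelDeriv (cotModel F) 𝓘(ℝ, E →L[ℝ] ℝ) (fun α : Cotangent F Q => moment (E := E) G α) α

theorem hasModelDerivAt_moment (α : Cotangent F Q) : HasModelDerivAt (cotModel F)
    𝓘(ℝ, E →L[ℝ] ℝ) (fun α : Cotangent F Q => moment (E := E) G α) α (momentDeriv G α) :=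
  _root_.MDifferentiableAt.hasModelDerivAt (contMDiff_moment.mdifferentiableAt (by simp))

theorem diffl_comp_moment {h : (E →L[ℝ] ℝ) → ℝ} {α : Cotangent F Q}
    (hh : DifferentiableAt ℝ h (moment G α)) :
    diffl (fun α : Cotangent F Q => h (moment G α)) α =
      (fderiv ℝ h (moment G α)).comp (momentDeriv (E := E) G α) :=
  ((hasModelDerivAt_iff.2 hh.hasFDerivAt).comp rfl (hasModelDerivAt_moment α)).modelDeriv_eq

theorem diffl_momentFun (ξ : E) (α : Cotangent F Q) (X : CotSpace F) :
    diffl (momentFun G F Q ξ) α X = momentDeriv (E := E) G α X ξ :=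
  congrArg (fun L => L X) (diffl_comp_moment (G := G)
    ((ContinuousLinearMap.apply ℝ ℝ ξ).differentiableAt (x := moment (E := E) G α))) |>.trans
    (by rw [ContinuousLinearMap.fderiv]; rfl)

/-- Along the orbits, the moment map moves by the coadjoint representation. -/
theorem momentDeriv_cotOrbit (α : Cotangent F Q) (ξ η : E) :
    momentDeriv (E := E) G α (cotOrbit G α η) ξ = -moment G α (lieBr G η ξ) := by
  have h1 := (hasVelocity_cotAct_oneParam (G := G) η α 0).comp (hasModelDerivAt_moment (E := E) (G := G) _) rfl
  rw [oneParam_zero, cotAct_one] at h1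
  have h2 := h1.hasDerivAt.clm_apply (hasDerivAt_const (0 : ℝ) ξ)
  have h3 : HasDerivAt (fun t => Ad (oneParam G η (-t)) ξ) (-lieBr G η ξ) 0 := by
    have h4 : HasDerivAt (fun t => Ad (oneParam G η t) ξ) (lieBr G η ξ) (-0) := by
      rw [neg_zero]
      exact hasDerivAt_Ad (oneParam_zero η) (hasVelocity_oneParam η) ξ
    have h5 := h4.scomp (0 : ℝ) (hasDerivAt_neg (0 : ℝ))
    rwa [neg_one_smul] at h5
  have h5 : HasDerivAt (fun t => moment G α (Ad (oneParam G η (-t)) ξ))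
      (moment G α (-lieBr G η ξ)) 0 := (moment G α).hasFDerivAt.comp_hasDerivAt 0 h3
  have h6 := h2.unique (h5.congr_of_eventuallyEq (Eventually.of_forall fun t => by
    simp only
    rw [moment_cotAct, ContinuousLinearMap.comp_apply, oneParam_neg]))
  rw [map_neg] at h6
  simpa using h6

theorem mem_pullbackAlgebra_iff {f : SmoothFun F Q} : f ∈ pullbackAlgebra E G F Q ↔
    ∃ h : (E →L[ℝ] ℝ) → ℝ, ContDiff ℝ ∞ h ∧ ∀ α, f α = h (moment G α) := Iff.rfl

theorem diffl_pullback {f : SmoothFun F Q} {h : (E →L[ℝ] ℝ) → ℝ} (hh : ContDiff ℝ ∞ h)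
    (hf : ∀ α, f α = h (moment G α)) (α : Cotangent F Q) :
    diffl f α = diffl (momentFun G F Q ((bidual E).symm (fderiv ℝ h (moment G α)))) α := by
  refine ContinuousLinearMap.ext fun X => ?_
  rw [diffl_momentFun, apply_bidual_symm]
  have h1 : (f : Cotangent F Q → ℝ) = fun α => h (moment G α) := funext hf
  rw [h1, diffl_comp_moment (hh.differentiable (by simp) _)]
  rfl

/-- The Hamiltonian fields of the functions in `F₁` are tangent to the orbits. -/
theorem hamField_pullback {f : SmoothFun F Q} {h : (E →L[ℝ] ℝ) → ℝ} (hh : ContDiff ℝ ∞ h)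
    (hf : ∀ α, f α = h (moment G α)) (α : Cotangent F Q) :
    hamField f α = cotOrbit G α ((bidual E).symm (fderiv ℝ h (moment G α))) :=
  (hamField_congr (diffl_pullback hh hf α)).trans (hamField_momentFun _ α)

theorem diffl_invariant {f : SmoothFun F Q} (hf : f ∈ invariantAlgebra G F Q) (α : Cotangent F Q)
    (ξ : E) : diffl f α (cotOrbit G α ξ) = 0 := by
  have h1 := (hasModelDerivAt_diffl f α).comp (g := fun g : G => cotAct g α) (cotAct_one α)
    (hasModelDerivAt_cotOrbit (E := E) α)
  have h2 : (fun g : G => f (cotAct g α)) = fun _ => f α :=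
    funext fun g => (mem_invariantAlgebra_iff (E := E)).1 hf g α
  rw [h2] at h1
  exact congrArg (fun L => L ξ) (h1.unique (hasModelDerivAt_const _ _))

/-- `F₁` and `F₂` commute: the Hamiltonian fields of the functions in `F₁` are tangent to the
orbits, along which invariant functions are constant. -/
theorem poissonBracket_pullback_invariant {f g : SmoothFun F Q} (hf : f ∈ invariantAlgebra G F Q)
    (hg : g ∈ pullbackAlgebra E G F Q) (α : Cotangent F Q) : poissonBracket f g α = 0 := by
  obtain ⟨h, hh, hgh⟩ := hg
  rw [poissonBracket_eq, hamField_pullback hh hgh, diffl_invariant hf]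

include E in
theorem diffl_cotAct {f : SmoothFun F Q} (hf : f ∈ invariantAlgebra G F Q) (g : G)
    (α : Cotangent F Q) : (diffl f (cotAct g α)).comp (cotActDeriv g α) = diffl f α := by
  have h1 := (hasModelDerivAt_diffl f (cotAct g α)).comp (g := fun α => cotAct g α) rfl
    (hasModelDerivAt_cotAct (E := E) g α)
  have h2 : (fun α : Cotangent F Q => f (cotAct g α)) = ⇑f :=
    funext fun α => (mem_invariantAlgebra_iff (E := E)).1 hf g α
  rw [h2] at h1
  exact h1.unique (hasModelDerivAt_diffl f α)

include E in
theorem cotActDeriv_surjective (g : G) (α : Cotangent F Q) :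
    Function.Surjective (cotActDeriv (F := F) g α) := by
  have h0 := hasModelDerivAt_cotAct (E := E) g⁻¹ (cotAct g α)
  have h1 := HasModelDerivAt.comp (f := fun α => cotAct g α) (g := fun α => cotAct g⁻¹ α)
    (hasModelDerivAt_cotAct (E := E) g α) (cotAct_inv_cotAct (E := E) g α) h0
  have h2 : (fun α : Cotangent F Q => cotAct g (cotAct g⁻¹ α)) = fun α => α :=
    funext fun α => cotAct_cotAct_inv (E := E) g α
  rw [h2] at h1
  intro X
  exact ⟨_, congrArg (fun L => L X) (h1.unique (hasModelDerivAt_id _))⟩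

include E in
theorem hamField_cotAct {f : SmoothFun F Q} (hf : f ∈ invariantAlgebra G F Q) (g : G)
    (α : Cotangent F Q) : hamField f (cotAct g α) = cotActDeriv g α (hamField f α) := by
  refine hamField_unique fun Y => ?_
  obtain ⟨X, rfl⟩ := cotActDeriv_surjective (E := E) g α Y
  rw [sympl_cotActDeriv (E := E), sympl_hamField, ← diffl_cotAct (E := E) hf g α]
  rfl

variable (E) in
include E in
theorem exists_poissonBracket_invariant {f g : SmoothFun F Q} (hf : f ∈ invariantAlgebra G F Q)
    (hg : g ∈ invariantAlgebra G F Q) :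
    ∃ k ∈ invariantAlgebra G F Q, ∀ α, k α = poissonBracket f g α := by
  refine ⟨⟨poissonBracket f g, contMDiff_poissonBracket f g⟩,
    (mem_invariantAlgebra_iff (E := E)).2 fun a α => ?_, fun α => rfl⟩
  change poissonBracket f g (cotAct a α) = poissonBracket f g α
  rw [poissonBracket_eq, poissonBracket_eq, hamField_cotAct (E := E) hg,
    ← diffl_cotAct (E := E) hf a α]
  rfl

/-- The moment map is a Poisson map to `𝔤*` with (up to sign) its Lie–Poisson bracket. -/
theorem exists_poissonBracket_pullback {f g : SmoothFun F Q} (hf : f ∈ pullbackAlgebra E G F Q)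
    (hg : g ∈ pullbackAlgebra E G F Q) :
    ∃ k ∈ pullbackAlgebra E G F Q, ∀ α, k α = poissonBracket f g α := by
  obtain ⟨h, hh, hfh⟩ := hf
  obtain ⟨h', hh', hgh⟩ := hg
  set H : (E →L[ℝ] ℝ) → ℝ := fun μ => -μ ((lieBilin (E := E) G).toContinuousBilinearMap
    ((bidual E).symm (fderiv ℝ h' μ)) ((bidual E).symm (fderiv ℝ h μ)))
  have hsm : ∀ h : (E →L[ℝ] ℝ) → ℝ, ContDiff ℝ ∞ h →
      ContDiff ℝ ∞ fun μ => (bidual E).symm (fderiv ℝ h μ) := fun h hh =>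
    (bidual E).symm.contDiff.comp (hh.fderiv_right (m := ∞) (by simp))
  have hH : ContDiff ℝ ∞ H :=
    (contDiff_id.clm_apply (((lieBilin (E := E) G).toContinuousBilinearMap.contDiff.comp
      (hsm h' hh')).clm_apply (hsm h hh))).neg
  refine ⟨⟨fun α => H (moment G α), hH.contMDiff.comp contMDiff_moment⟩, ⟨H, hH, fun α => rfl⟩,
    fun α => ?_⟩
  change H (moment G α) = _
  rw [poissonBracket_eq, hamField_pullback hh' hgh, diffl_pullback hh hfh, diffl_momentFun,
    momentDeriv_cotOrbit]
  rfl

variable (E G F Q) in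
theorem isPoissonClosed_sup :
    IsPoissonClosed (pullbackAlgebra E G F Q ⊔ invariantAlgebra G F Q) := by
  intro f hf g hg
  obtain ⟨f₁, hf₁, f₂, hf₂, rfl⟩ := Submodule.mem_sup.1 hf
  obtain ⟨g₁, hg₁, g₂, hg₂, rfl⟩ := Submodule.mem_sup.1 hg
  obtain ⟨k₁, hk₁, h₁⟩ := exists_poissonBracket_pullback hf₁ hg₁
  obtain ⟨k₂, hk₂, h₂⟩ := exists_poissonBracket_invariant E hf₂ hg₂
  refine ⟨k₁ + k₂, Submodule.add_mem_sup hk₁ hk₂, fun α => ?_⟩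
  have e1 := poissonBracket_pullback_invariant hf₂ hg₁ α
  have e2 := poissonBracket_pullback_invariant hg₂ hf₁ α
  rw [poissonBracket_skew] at e2
  rw [poissonBracket_eq] at e1 e2
  have e3 : (k₁ + k₂) α = k₁ α + k₂ α := rfl
  rw [e3, h₁, h₂, poissonBracket_eq, poissonBracket_eq, poissonBracket_eq, diffl_add, hamField_add,
    map_add, add_apply, add_apply]
  linarith

end Action

/-! ### Local inverses and local sections -/

section LocalInverse

variable {V : Type*} [NormedAddCommGroup V] [NormedSpace ℝ V] [FiniteDimensional ℝ V]
  {W : Type*} [NormedAddCommGroup W] [NormedSpace ℝ W] [FiniteDimensional ℝ W]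

/-- The inverse function theorem, with smoothness of the inverse. -/
theorem exists_localInverse {f : V → W} {a : V} {b : W} {e : V ≃L[ℝ] W} (hf : ContDiffAt ℝ ∞ f a)
    (he : HasFDerivAt f (e : V →L[ℝ] W) a) (hab : f a = b) :
    ∃ g : W → V, ContDiffAt ℝ ∞ g b ∧ g b = a ∧ (∀ᶠ y in 𝓝 b, f (g y) = y) ∧
      ∀ᶠ x in 𝓝 a, g (f x) = x := by
  have hVc := FiniteDimensional.complete ℝ V
  subst hab
  set P := hf.toOpenPartialHomeomorph f he (by simp)
  have ha : a ∈ P.source := hf.mem_toOpenPartialHomeomorph_source he (by simp)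
  refine ⟨P.symm, hf.to_localInverse he (by simp), P.left_inv ha, ?_, ?_⟩
  · filter_upwards [P.open_target.mem_nhds (P.map_source ha)] with y hy
    exact P.right_inv hy
  · filter_upwards [P.open_source.mem_nhds ha] with x hx
    exact P.left_inv hx

/-- A smooth map whose derivative at `a` is surjective has a local section through `a`. -/
theorem exists_localSection_of_surjective {f : V → W} {a : V} {L : V →L[ℝ] W}
    (hf : ContDiffAt ℝ ∞ f a) (hL : HasFDerivAt f L a) (hs : Function.Surjective L) :
    ∃ g : W → V, ContDiffAt ℝ ∞ g (f a) ∧ g (f a) = a ∧ ∀ᶠ y in 𝓝 (f a), f (g y) = y := by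
  obtain ⟨R, hR⟩ := (L : V →ₗ[ℝ] W).exists_rightInverse_of_surjective
    (LinearMap.range_eq_top.2 hs)
  set R' : W →L[ℝ] V := R.toContinuousLinearMap
  have hLR : L.comp R' = ContinuousLinearMap.id ℝ W :=
    ContinuousLinearMap.ext fun w => congrArg (fun T => T w) hR
  set j : W → V := fun w => a + R' w
  have hj0 : j 0 = a := by simp [j]
  have hj : HasFDerivAt j R' 0 := R'.hasFDerivAt.const_add a
  have hjs : ContDiff ℝ ∞ j := contDiff_const.add R'.contDiff
  have h1 : HasFDerivAt (fun w => f (j w))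
      ((ContinuousLinearEquiv.refl ℝ W : W ≃L[ℝ] W) : W →L[ℝ] W) 0 := by
    have h2 := HasFDerivAt.comp (g := f) 0 (by rw [hj0]; exact hL) hj
    rw [hLR] at h2
    exact h2
  have h2 : ContDiffAt ℝ ∞ (fun w => f (j w)) 0 :=
    ContDiffAt.comp (g := f) 0 (by rw [hj0]; exact hf) hjs.contDiffAt
  obtain ⟨g, hg, hg0, hg1, -⟩ := exists_localInverse h2 h1 (by rw [hj0])
  exact ⟨fun y => j (g y), hjs.contDiffAt.comp (f a) hg, by simp only [hg0, hj0], hg1⟩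

/-- Smooth submersions of manifolds have smooth local sections. -/
theorem exists_contMDiffAt_section {M : Type*} [TopologicalSpace M] [ChartedSpace V M]
    [IsManifold 𝓘(ℝ, V) ∞ M] {N : Type*} [TopologicalSpace N] [ChartedSpace W N]
    [IsManifold 𝓘(ℝ, W) ∞ N] {f : M → N} {x : M} (hf : ContMDiffAt 𝓘(ℝ, V) 𝓘(ℝ, W) ∞ f x)
    (hs : Function.Surjective (modelDeriv 𝓘(ℝ, V) 𝓘(ℝ, W) f x)) :
    ∃ σ : N → M, ContMDiffAt 𝓘(ℝ, W) 𝓘(ℝ, V) ∞ σ (f x) ∧ σ (f x) = x ∧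
      ∀ᶠ y in 𝓝 (f x), f (σ y) = y := by
  set φ := extChartAt 𝓘(ℝ, V) x
  set ψ := extChartAt 𝓘(ℝ, W) (f x)
  have hx : x ∈ φ.source := mem_extChartAt_source x
  have hfx : f x ∈ ψ.source := mem_extChartAt_source (f x)
  have e0 : φ.symm (φ x) = x := φ.left_inv hx
  set F : V → W := fun z => ψ (f (φ.symm z))
  have hφs := contMDiffAt_extChartAt_symm_of_mem (I := 𝓘(ℝ, V)) (φ.map_source hx)
  have hF : ContDiffAt ℝ ∞ F (φ x) := by
    have h1 : ContMDiffAt 𝓘(ℝ, V) 𝓘(ℝ, W) ∞ (fun z => f (φ.symm z)) (φ x) :=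
      ContMDiffAt.comp (φ x) (g := f) (by rw [e0]; exact hf) hφs
    exact (ContMDiffAt.comp (φ x) (g := ψ) (contMDiffAt_extChartAt_of_mem (by rw [e0]; exact hfx))
      h1).contDiffAt
  have hd := hasModelDerivAt_iff.1 ((hasModelDerivAt_extChartAt (I := 𝓘(ℝ, W)) hfx).comp
    (g := fun z => f (φ.symm z)) (congrArg f e0)
    ((_root_.MDifferentiableAt.hasModelDerivAt (hf.mdifferentiableAt (by simp))).comp
      (g := φ.symm) e0 (hasModelDerivAt_extChartAt_symm (I := 𝓘(ℝ, V)) (φ.map_source hx))))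
  obtain ⟨g, hg, hg0, hg1⟩ := exists_localSection_of_surjective hF hd (by
    intro y
    obtain ⟨X, hX⟩ := hs (modelDeriv 𝓘(ℝ, W) 𝓘(ℝ, W) ψ.symm (ψ (f x)) y)
    refine ⟨modelDeriv 𝓘(ℝ, V) 𝓘(ℝ, V) φ x X, ?_⟩
    simp only [ContinuousLinearMap.comp_apply]
    rw [modelDeriv_symm_modelDeriv hx, hX, modelDeriv_modelDeriv_symm hfx])
  have eF : F (φ x) = ψ (f x) := by simp only [F]; rw [e0]
  rw [eF] at hg hg0 hg1
  refine ⟨fun y => φ.symm (g (ψ y)), ?_, by simp only [hg0, e0], ?_⟩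
  · have h1 : ContMDiffAt 𝓘(ℝ, W) 𝓘(ℝ, V) ∞ (fun y => g (ψ y)) (f x) :=
      ContMDiffAt.comp (f x) hg.contMDiffAt (contMDiffAt_extChartAt_of_mem hfx)
    exact ContMDiffAt.comp (f x) (g := φ.symm) (by rw [hg0]; exact hφs) h1
  · have hψc : ContinuousAt ψ (f x) := (contMDiffAt_extChartAt_of_mem hfx).continuousAt
    have hgc : ContinuousAt (fun y => g (ψ y)) (f x) := hg.continuousAt.comp hψc
    have hfc : ContinuousAt (fun y => f (φ.symm (g (ψ y)))) (f x) := by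
      have h2 : ContinuousAt φ.symm (g (ψ (f x))) := by rw [hg0]; exact hφs.continuousAt
      have h3 : ContinuousAt (fun y => φ.symm (g (ψ y))) (f x) :=
        ContinuousAt.comp (g := φ.symm) h2 hgc
      exact ContinuousAt.comp (g := f) (by rw [hg0, e0]; exact hf.continuousAt) h3
    have h4 := hfc.eventually (eventually_extChartAt_source (I := 𝓘(ℝ, W)) (x := f x)
      (by simp only [hg0, e0]; exact hfx))
    filter_upwards [hψc.eventually hg1, h4, eventually_extChartAt_source hfx] with y h5 h6 h7
    exact ψ.injOn h6 h7 h5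

end LocalInverse

/-! ### Homogeneous spaces -/

section Homogeneous

variable {E : Type*} [NormedAddCommGroup E] [NormedSpace ℝ E] [FiniteDimensional ℝ E]
  {G : Type*} [TopologicalSpace G] [Group G] [ChartedSpace E G] [LieGroup 𝓘(ℝ, E) ∞ G] [T2Space G]
  {H : Subgroup G}
  {F : Type*} [NormedAddCommGroup F] [NormedSpace ℝ F] [FiniteDimensional ℝ F]
  [ChartedSpace F (G ⧸ H)] [IsManifold 𝓘(ℝ, F) ∞ (G ⧸ H)]

theorem IsQuotientStructure.surjective (hQ : IsQuotientStructure E H F) (g : G) :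
    Function.Surjective (modelDeriv 𝓘(ℝ, E) 𝓘(ℝ, F) (QuotientGroup.mk : G → G ⧸ H) g) :=
  hQ.submersion g

theorem IsQuotientStructure.exists_section (hQ : IsQuotientStructure E H F) (g : G) :
    ∃ σ : G ⧸ H → G, ContMDiffAt 𝓘(ℝ, F) 𝓘(ℝ, E) ∞ σ (g : G ⧸ H) ∧ σ (g : G ⧸ H) = g ∧
      ∀ᶠ q in 𝓝 (g : G ⧸ H), (σ q : G ⧸ H) = q :=
  exists_contMDiffAt_section hQ.contMDiff.contMDiffAt (hQ.submersion g)

theorem IsQuotientStructure.contMDiffSMul (hQ : IsQuotientStructure E H F) :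
    ContMDiffSMul 𝓘(ℝ, E) 𝓘(ℝ, F) ∞ G (G ⧸ H) := by
  refine ⟨?_⟩
  rintro ⟨g, q⟩
  obtain ⟨x, rfl⟩ := QuotientGroup.mk_surjective q
  obtain ⟨σ, hσ, hσx, hσs⟩ := hQ.exists_section x
  have h1 : ContMDiffAt (𝓘(ℝ, E).prod 𝓘(ℝ, F)) 𝓘(ℝ, E) ∞ (fun p : G × (G ⧸ H) => σ p.2)
      (g, (x : G ⧸ H)) := ContMDiffAt.comp _ (g := σ) (f := Prod.snd) hσ contMDiffAt_snd
  have h2 := ContMDiffAt.comp (g, (x : G ⧸ H)) hQ.contMDiff.contMDiffAt (contMDiffAt_fst.mul h1)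
  refine h2.congr_of_eventuallyEq ?_
  filter_upwards [continuousAt_snd.eventually hσs] with p hp
  change p.1 • p.2 = ((p.1 * σ p.2 : G) : G ⧸ H)
  conv_lhs => rw [← hp]
  rfl

theorem t2Space_quotient (hH : IsClosed (H : Set G)) [IsTopologicalGroup G] : T2Space (G ⧸ H) := by
  have hq : IsOpenQuotientMap (QuotientGroup.mk : G → G ⧸ H) :=
    QuotientGroup.isOpenQuotientMap_mk
  rw [t2Space_iff_of_isOpenQuotientMap hq]
  have : {p : G × G | (p.1 : G ⧸ H) = p.2} = (fun p : G × G => p.1⁻¹ * p.2) ⁻¹' (H : Set G) := by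
    ext p
    simp [QuotientGroup.eq]
  rw [this]
  exact hH.preimage (by fun_prop)

variable [ContMDiffSMul 𝓘(ℝ, E) 𝓘(ℝ, F) ∞ G (G ⧸ H)]

variable (H) in
/-- The base point `[1]` of `G ⧸ H`. -/
def base : G ⧸ H := ((1 : G) : G ⧸ H)

theorem smul_base (g : G) : g • base H = (g : G ⧸ H) := by
  change ((g * 1 : G) : G ⧸ H) = g
  rw [mul_one]

theorem smul_base_eq_iff {g : G} : g • base H = base H ↔ g ∈ H := by
  rw [smul_base, base, eq_comm, QuotientGroup.eq]; simp

theorem exists_smul_base (q : G ⧸ H) : ∃ g : G, g • base H = q := by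
  obtain ⟨g, rfl⟩ := QuotientGroup.mk_surjective q
  exact ⟨g, smul_base g⟩

theorem hasModelDerivAt_mk (hQ : IsQuotientStructure E H F) (g : G) :
    HasModelDerivAt 𝓘(ℝ, E) 𝓘(ℝ, F) (QuotientGroup.mk : G → G ⧸ H) g
      (modelDeriv 𝓘(ℝ, E) 𝓘(ℝ, F) (QuotientGroup.mk : G → G ⧸ H) g) :=
  _root_.MDifferentiableAt.hasModelDerivAt (hQ.contMDiff.mdifferentiableAt (by simp))

theorem baseOrbit_base : baseOrbit G (base H) =
    modelDeriv 𝓘(ℝ, E) 𝓘(ℝ, F) (QuotientGroup.mk : G → G ⧸ H) 1 := by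
  have : (fun g : G => g • base H) = QuotientGroup.mk := funext smul_base
  rw [baseOrbit, this]

theorem baseOrbit_surjective (hQ : IsQuotientStructure E H F) (q : G ⧸ H) :
    Function.Surjective (baseOrbit (E := E) (F := F) G q) := by
  obtain ⟨g, rfl⟩ := exists_smul_base q
  intro X
  obtain ⟨ξ, hξ⟩ := hQ.surjective 1 (actDeriv g⁻¹ (g • base H) X)
  refine ⟨Ad g ξ, ?_⟩
  rw [baseOrbit_smul, baseOrbit_base]
  have h1 := actDeriv_inv_comp (E := E) (F := F) g⁻¹ (g • base H)
  rw [inv_inv, inv_smul_smul] at h1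
  exact (congrArg (actDeriv g (base H)) hξ).trans (congrArg (fun L => L X) h1)

/-- A point of `T*(G/H)` is determined by its base point and the value of the moment map, since
`G` acts transitively on `G/H`. -/
theorem eq_of_moment_eq (hQ : IsQuotientStructure E H F) {α β : Cotangent F (G ⧸ H)}
    (h1 : α.1 = β.1) (h2 : moment (E := E) G α = moment G β) : α = β := by
  refine cotangent_ext h1 (ContinuousLinearMap.ext fun X => ?_)
  obtain ⟨ξ, rfl⟩ := baseOrbit_surjective hQ α.1 X
  have h3 := congrArg (fun L => L ξ) h2
  rw [moment_eq, moment_eq, ← h1] at h3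
  exact h3

/-- The base point and the moment map embed `T*(G/H)` continuously in a Hausdorff space. -/
theorem t2Space_cotangent (hQ : IsQuotientStructure E H F) [T2Space (G ⧸ H)] :
    T2Space (Cotangent F (G ⧸ H)) := by
  refine T2Space.of_injective_continuous
    (f := fun α : Cotangent F (G ⧸ H) => (α.1, moment (E := E) G α)) ?_ ?_
  · intro α β h
    exact eq_of_moment_eq hQ (congrArg Prod.fst h) (congrArg Prod.snd h)
  · refine Continuous.prodMk ?_ continuous_moment
    exact (Bundle.contMDiff_proj (n := ∞) (IB := 𝓘(ℝ, F)) (F := F →L[ℝ] ℝ)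
      (fun q : G ⧸ H => TangentSpace 𝓘(ℝ, F) q →L[ℝ] Trivial (G ⧸ H) ℝ q)).continuous

/-- One-parameter subgroups whose generator is tangent to the stabilizer of `q` fix `q`. -/
theorem oneParam_smul_eq {Q : Type*} [TopologicalSpace Q] [ChartedSpace F Q]
    [IsManifold 𝓘(ℝ, F) ∞ Q] [MulAction G Q] [ContMDiffSMul 𝓘(ℝ, E) 𝓘(ℝ, F) ∞ G Q] [T2Space Q]
    {q : Q} {ξ : E} (h : baseOrbit (F := F) G q ξ = 0) (t : ℝ) : oneParam G ξ t • q = q := by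
  have hv : ∀ t, HasVelocity 𝓘(ℝ, F) (fun t => oneParam G ξ t • q) t 0 := by
    intro t
    have h1 := (hasVelocity_oneParam (G := G) ξ).comp
      (hasModelDerivAt_baseOrbit (E := E) (F := F) q) (oneParam_zero ξ)
    rw [h] at h1
    have h2 : HasDerivAt (fun s : ℝ => s - t) 1 t := by simpa using (hasDerivAt_id t).sub_const t
    have h3 := HasVelocity.comp_hasDerivAt (f := fun s => s - t) (sub_self t) h1 h2
    have h4 := h3.comp (hasModelDerivAt_smul (E := E) (F := F) (oneParam G ξ t) _) rfl
    rw [smul_zero, map_zero] at h4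
    refine h4.congr (Eventually.of_forall fun s => ?_)
    simp only
    rw [← mul_smul, ← oneParam_add, add_sub_cancel]
  have := eq_of_hasVelocity_zero (I := 𝓘(ℝ, F)) hv t 0
  simpa [oneParam_zero] using this

end Homogeneous

/-! ### The bi-invariant metric and the geodesic Hamiltonian -/

section MetricAt

variable {F : Type*} [NormedAddCommGroup F] [NormedSpace ℝ F]
  {Q : Type*} [TopologicalSpace Q] [ChartedSpace F Q] [IsManifold 𝓘(ℝ, F) ∞ Q]

/-- The scalar product of the tangent space at `q`, as a bilinear form on the model space. -/
def metricAt (g : Metric F Q) (q : Q) : F →L[ℝ] F →L[ℝ] ℝ := g.inner q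

theorem metricAt_symm (g : Metric F Q) (q : Q) (u w : F) :
    metricAt g q u w = metricAt g q w u := g.symm q u w

theorem metricAt_pos (g : Metric F Q) (q : Q) {u : F} (h : u ≠ 0) : 0 < metricAt g q u u :=
  g.pos q u h

theorem eq_zero_of_metricAt_self (g : Metric F Q) (q : Q) {u : F} (h : metricAt g q u u = 0) :
    u = 0 := by
  by_contra hne
  exact (metricAt_pos g q hne).ne' h

theorem metricAt_injective (g : Metric F Q) (q : Q) : Function.Injective (metricAt g q) := by
  rw [injective_iff_map_eq_zero]
  intro u hu
  exact eq_zero_of_metricAt_self g q (by rw [hu]; rfl)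

variable [FiniteDimensional ℝ F]

/-- The identification of tangent vectors and covectors at `q` given by the metric. -/
def metricEquiv (g : Metric F Q) (q : Q) : F ≃L[ℝ] (F →L[ℝ] ℝ) :=
  (isInvertible_of_injective (metricAt_injective g q)).choose

theorem metricEquiv_apply (g : Metric F Q) (q : Q) (u w : F) :
    metricEquiv g q u w = metricAt g q u w := by
  have h := (isInvertible_of_injective (metricAt_injective g q)).choose_spec
  exact congrArg (fun L => L u w) h

theorem metricAt_symm_apply (g : Metric F Q) (q : Q) (p : F →L[ℝ] ℝ) (w : F) :
    metricAt g q ((metricEquiv g q).symm p) w = p w := by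
  rw [← metricEquiv_apply, ContinuousLinearEquiv.apply_symm_apply]

theorem kineticEnergy_eq_metricEquiv (g : Metric F Q) (α : Cotangent F Q) :
    kineticEnergy g α = 1 / 2 * momentum α ((metricEquiv g α.1).symm (momentum α)) := by
  have h := (isInvertible_of_injective (metricAt_injective g α.1)).choose_spec
  have h1 : (metricAt g α.1).inverse = (metricEquiv g α.1).symm := by
    rw [← ContinuousLinearMap.inverse_equiv]
    exact congrArg _ h.symm
  have h2 : kineticEnergy g α = 1 / 2 * momentum α ((metricAt g α.1).inverse (momentum α)) := rfl
  rw [h2, h1]; rfl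

end MetricAt

section Biinvariant

variable {E : Type*} [NormedAddCommGroup E] [NormedSpace ℝ E] [FiniteDimensional ℝ E]
  {G : Type*} [TopologicalSpace G] [Group G] [ChartedSpace E G] [LieGroup 𝓘(ℝ, E) ∞ G] [T2Space G]
  {B : Metric E G}

variable (B) in
/-- The scalar product of the Lie algebra. -/
def inn : E →L[ℝ] E →L[ℝ] ℝ := metricAt B 1

theorem inn_symm (ξ η : E) : inn B ξ η = inn B η ξ := metricAt_symm B 1 ξ η

theorem eq_zero_of_inn_self {ξ : E} (h : inn B ξ ξ = 0) : ξ = 0 := eq_zero_of_metricAt_self B 1 h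

theorem eq_zero_of_inn {ξ : E} (h : ∀ η, inn B ξ η = 0) : ξ = 0 := eq_zero_of_inn_self (h ξ)

/-- The differential at `x` of the right translation by `a`. -/
def rightDeriv (a x : G) : E →L[ℝ] E := modelDeriv 𝓘(ℝ, E) 𝓘(ℝ, E) (fun y : G => y * a) x

theorem hasModelDerivAt_rightDeriv (a x : G) :
    HasModelDerivAt 𝓘(ℝ, E) 𝓘(ℝ, E) (fun y : G => y * a) x (rightDeriv a x) :=
  hasModelDerivAt_mul_right a x

theorem rightDeriv_surjective (a x : G) : Function.Surjective (rightDeriv (E := E) a x) := by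
  have h0 := hasModelDerivAt_rightDeriv (E := E) a⁻¹ (x * a)
  have h1 := HasModelDerivAt.comp (f := fun y : G => y * a) (g := fun y : G => y * a⁻¹)
    (hasModelDerivAt_rightDeriv (E := E) a x) (mul_inv_cancel_right x a) h0
  have h2 : (fun y : G => y * a⁻¹ * a) = fun y => y := by ext y; simp
  rw [h2] at h1
  intro X
  exact ⟨_, congrArg (fun L => L X) (h1.unique (hasModelDerivAt_id _))⟩

theorem IsBiinvariant.metricAt_rightDeriv (hB : IsBiinvariant B) (a : G) (ξ η : E) :
    metricAt B a (rightDeriv a 1 ξ) (rightDeriv a 1 η) = inn B ξ η := by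
  have h : metricAt B (1 * a) (rightDeriv a 1 ξ) (rightDeriv a 1 η) = inn B ξ η :=
    hB.right a 1 ξ η
  rwa [one_mul] at h

theorem IsBiinvariant.inn_Ad (hB : IsBiinvariant B) (g : G) (ξ η : E) :
    inn B (Ad g ξ) (Ad g η) = inn B ξ η := by
  -- Conjugation is the left translation by `g` followed by the right translation by `g⁻¹`
  have h1 := HasModelDerivAt.comp (f := fun y : G => y * g⁻¹) (g := fun y : G => g * y)
    (hasModelDerivAt_rightDeriv (E := E) g⁻¹ (g * 1)) rfl (hasModelDerivAt_mul_left (E := E) g 1)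
  have h2 := h1.unique (hasModelDerivAt_conj (E := E) g)
  have h3 : ∀ ξ η : E, metricAt B (g * 1 * g⁻¹) (Ad g ξ) (Ad g η) = inn B ξ η := by
    intro ξ η
    rw [← h2]
    exact (hB.right g⁻¹ (g * 1) _ _).trans (hB.left g 1 ξ η)
  have h4 := h3 ξ η
  rwa [mul_one, mul_inv_cancel] at h4

/-- `ad` is skew-symmetric for a bi-invariant scalar product. -/
theorem IsBiinvariant.inn_lieBr (hB : IsBiinvariant B) (ζ ξ η : E) :
    inn B (lieBr G ζ ξ) η = -inn B ξ (lieBr G ζ η) := by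
  have h1 : ∀ ξ : E, HasDerivAt (fun t => Ad (oneParam G ζ t) ξ) (lieBr G ζ ξ) 0 := fun ξ =>
    hasDerivAt_Ad (oneParam_zero ζ) (hasVelocity_oneParam ζ) ξ
  have h2 := ((inn B).hasFDerivAt.comp_hasDerivAt 0 (h1 ξ)).clm_apply (h1 η)
  have h3 : (fun t => inn B (Ad (oneParam G ζ t) ξ) (Ad (oneParam G ζ t) η)) =
      fun _ => inn B ξ η := funext fun t => hB.inn_Ad _ _ _
  have h4 := (hasDerivAt_const (0 : ℝ) (inn B ξ η)).unique (by rw [← h3]; exact h2)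
  simp only [Function.comp_apply, oneParam_zero, Ad_one, ContinuousLinearMap.id_apply] at h4
  linarith

end Biinvariant

section MomentVec

variable {E : Type*} [NormedAddCommGroup E] [NormedSpace ℝ E] [FiniteDimensional ℝ E]
  {G : Type*} [TopologicalSpace G] [Group G] [ChartedSpace E G] [LieGroup 𝓘(ℝ, E) ∞ G] [T2Space G]
  {F : Type*} [NormedAddCommGroup F] [NormedSpace ℝ F] [FiniteDimensional ℝ F]
  {Q : Type*} [TopologicalSpace Q] [ChartedSpace F Q] [IsManifold 𝓘(ℝ, F) ∞ Q] [MulAction G Q]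
  {B : Metric E G}

variable (B) in
/-- The moment map, with values in the Lie algebra, which is identified with its dual by the
scalar product. -/
def momentVec (α : Cotangent F Q) : E := (metricEquiv B 1).symm (moment G α)

theorem inn_momentVec (α : Cotangent F Q) (ξ : E) :
    inn B (momentVec B α) ξ = moment G α ξ := metricAt_symm_apply B 1 _ ξ

theorem moment_eq_of_momentVec_eq {α β : Cotangent F Q} (h : momentVec B α = momentVec B β) :
    moment (E := E) G α = moment G β := (metricEquiv B 1).symm.injective h

variable [ContMDiffSMul 𝓘(ℝ, E) 𝓘(ℝ, F) ∞ G Q]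

theorem contMDiff_momentVec :
    ContMDiff (cotModel F) 𝓘(ℝ, E) ∞ (fun α : Cotangent F Q => momentVec B α) :=
  (metricEquiv B 1).symm.contDiff.contMDiff.comp contMDiff_moment

theorem IsBiinvariant.momentVec_cotAct (hB : IsBiinvariant B) (g : G) (α : Cotangent F Q) :
    momentVec B (cotAct g α) = Ad g (momentVec B α) := by
  apply metricAt_injective B 1
  refine ContinuousLinearMap.ext fun ξ => ?_
  change inn B _ _ = inn B _ _
  rw [inn_momentVec, moment_cotAct, ContinuousLinearMap.comp_apply, ← inn_momentVec (B := B),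
    ← hB.inn_Ad g, Ad_Ad_inv]

variable (B G F Q) in
/-- The function `½ |Φ|²`. -/
def energyFun : SmoothFun F Q :=
  ⟨fun α => 1 / 2 * inn B (momentVec B α) (momentVec B α),
    contMDiff_const.mul (((inn B).contDiff.contMDiff.comp contMDiff_momentVec).clm_apply
      contMDiff_momentVec)⟩

theorem energyFun_apply (α : Cotangent F Q) :
    energyFun G F Q B α = 1 / 2 * inn B (momentVec B α) (momentVec B α) := rfl

theorem energyFun_mem_pullbackAlgebra : energyFun G F Q B ∈ pullbackAlgebra E G F Q := by
  refine ⟨fun μ => 1 / 2 * inn B ((metricEquiv B 1).symm μ) ((metricEquiv B 1).symm μ), ?_,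
    fun α => rfl⟩
  exact contDiff_const.mul (((inn B).contDiff.comp (metricEquiv B 1).symm.contDiff).clm_apply
    (metricEquiv B 1).symm.contDiff)

theorem energyFun_mem_invariantAlgebra (hB : IsBiinvariant B) :
    energyFun G F Q B ∈ invariantAlgebra G F Q :=
  (mem_invariantAlgebra_iff (E := E)).2 fun g α => by
    rw [energyFun_apply, energyFun_apply, hB.momentVec_cotAct, hB.inn_Ad]

/-- The function `½ |Φ|²` lies in both `F₁` and `F₂`, so it commutes with `F₂` and with `F₁`. -/
theorem isFirstIntegral_energyFun (hB : IsBiinvariant B) {f : SmoothFun F Q}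
    (hf : f ∈ pullbackAlgebra E G F Q ⊔ invariantAlgebra G F Q) :
    IsFirstIntegral (energyFun G F Q B) f := by
  obtain ⟨f₁, hf₁, f₂, hf₂, rfl⟩ := Submodule.mem_sup.1 hf
  refine isFirstIntegral_of_poissonBracket fun α => ?_
  have e1 := poissonBracket_pullback_invariant (energyFun_mem_invariantAlgebra hB) hf₁ α
  have e2 := poissonBracket_pullback_invariant hf₂
    (energyFun_mem_pullbackAlgebra (G := G) (B := B)) α
  rw [poissonBracket_skew, neg_eq_zero] at e1
  rw [poissonBracket_eq] at e1 e2 ⊢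
  rw [diffl_add, add_apply, e1, e2, add_zero]

end MomentVec

section Homogeneous

variable {E : Type*} [NormedAddCommGroup E] [NormedSpace ℝ E] [FiniteDimensional ℝ E]
  {G : Type*} [TopologicalSpace G] [Group G] [ChartedSpace E G] [LieGroup 𝓘(ℝ, E) ∞ G] [T2Space G]
  {H : Subgroup G}
  {F : Type*} [NormedAddCommGroup F] [NormedSpace ℝ F] [FiniteDimensional ℝ F]
  [ChartedSpace F (G ⧸ H)] [IsManifold 𝓘(ℝ, F) ∞ (G ⧸ H)]
  [ContMDiffSMul 𝓘(ℝ, E) 𝓘(ℝ, F) ∞ G (G ⧸ H)]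
  {B : Metric E G}

theorem baseOrbit_mk (hQ : IsQuotientStructure E H F) (x : G) (ξ : E) :
    baseOrbit G (x : G ⧸ H) ξ =
      modelDeriv 𝓘(ℝ, E) 𝓘(ℝ, F) (QuotientGroup.mk : G → G ⧸ H) x (rightDeriv x 1 ξ) := by
  have h1 := HasModelDerivAt.comp (f := (QuotientGroup.mk : G → G ⧸ H)) (g := fun y => y * x)
    (hasModelDerivAt_mk hQ x) (one_mul x) (hasModelDerivAt_rightDeriv (E := E) x 1)
  have h2 := hasModelDerivAt_baseOrbit (E := E) (F := F) (G := G) (x : G ⧸ H)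
  exact congrArg (fun L => L ξ) (h2.unique h1)

/-- The kinetic energy of the normal metric is `½ |Φ|²`: if `X` is the horizontal lift to `T_x G`
of the tangent vector dual to the covector `p`, the right translation by `x⁻¹` sends `X` to the
vector of the Lie algebra dual to `Φ(p)`. -/
theorem kineticEnergy_eq_energyFun (hQ : IsQuotientStructure E H F) (hB : IsBiinvariant B)
    {ds₀ : Metric F (G ⧸ H)} (hds₀ : IsInducedMetric H B ds₀) (α : Cotangent F (G ⧸ H)) :
    kineticEnergy ds₀ α = energyFun G F (G ⧸ H) B α := by
  obtain ⟨x, hx⟩ := QuotientGroup.mk_surjective α.1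
  set D := modelDeriv 𝓘(ℝ, E) 𝓘(ℝ, F) (QuotientGroup.mk : G → G ⧸ H) x
  have hDs : Function.Surjective D := hQ.surjective x
  -- `S p` is the horizontal lift to `T_x G` of the tangent vector dual to the covector `p`.
  set S : (F →L[ℝ] ℝ) → E := fun p => (metricEquiv B x).symm (p.comp D)
  have hS : ∀ p w, metricAt B x (S p) w = p (D w) := fun p w => metricAt_symm_apply B x _ w
  have hSk : ∀ p k, D k = 0 → metricAt B x k (S p) = 0 := by
    intro p k hk
    rw [metricAt_symm, hS, hk, map_zero]
  set T : (F →L[ℝ] ℝ) →ₗ[ℝ] F :=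
    { toFun := fun p => D (S p)
      map_add' := fun p q => by simp only [S, ContinuousLinearMap.add_comp, map_add]
      map_smul' := fun c p => by simp only [S, ContinuousLinearMap.smul_comp, map_smul]; rfl }
  have hTinj : Function.Injective T := by
    rw [injective_iff_map_eq_zero]
    intro p hp
    have h1 : S p = 0 := eq_zero_of_metricAt_self B x (by rw [hS]; exact (congrArg p hp).trans (map_zero p))
    refine ContinuousLinearMap.ext fun y => ?_
    obtain ⟨w, rfl⟩ := hDs y
    rw [← hS, h1, map_zero]; rfl
  have hTs : Function.Surjective T :=
    (LinearMap.injective_iff_surjective_of_finrank_eq_finrank finrank_dual_eq).1 hTinj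
  have hind : ∀ p p', metricAt ds₀ (x : G ⧸ H) (D (S p)) (D (S p')) =
      metricAt B x (S p) (S p') := fun p p' => hds₀ x (S p) (S p') (hSk p) (hSk p')
  have hdual : (metricEquiv ds₀ α.1).symm (momentum α) = D (S (momentum α)) := by
    apply (metricEquiv ds₀ α.1).injective
    rw [ContinuousLinearEquiv.apply_symm_apply]
    refine ContinuousLinearMap.ext fun y => ?_
    obtain ⟨p', rfl⟩ := hTs y
    rw [metricEquiv_apply, ← hx]
    exact ((hind (momentum α) p').trans (hS _ _)).symm
  obtain ⟨ζ, hζ⟩ := rightDeriv_surjective x 1 (S (momentum α))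
  have hmv : momentVec B α = ζ := by
    apply metricAt_injective B 1
    refine ContinuousLinearMap.ext fun ξ => ?_
    change inn B _ _ = inn B _ _
    rw [inn_momentVec, ← hB.metricAt_rightDeriv x, hζ, hS, moment_eq, ContinuousLinearMap.comp_apply,
      ← hx, baseOrbit_mk hQ]
  rw [kineticEnergy_eq_metricEquiv, hdual, energyFun_apply, hmv, ← hS, ← hζ,
    hB.metricAt_rightDeriv]

end Homogeneous

/-! ### Linear families of maximal rank -/

section Rank

variable {V : Type*} [NormedAddCommGroup V] [NormedSpace ℝ V] [FiniteDimensional ℝ V]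
  {W : Type*} [NormedAddCommGroup W] [NormedSpace ℝ W] [FiniteDimensional ℝ W]

theorem finite_setOf_not_injective_id_add_smul (N : V →ₗ[ℝ] V) :
    {t : ℝ | ¬Function.Injective (LinearMap.id + t • N : V →ₗ[ℝ] V)}.Finite := by
  -- If `x + t N x = 0` with `x ≠ 0`, then `-1/t` is an eigenvalue of `N`.
  have h1 : {c : ℝ | Module.End.HasEigenvalue N c}.Finite := Module.End.finite_hasEigenvalue N
  refine (h1.image fun c => -c⁻¹).subset ?_
  intro t ht
  rw [mem_ofPred_eq, ← LinearMap.ker_eq_bot, Submodule.eq_bot_iff] at ht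
  push Not at ht
  obtain ⟨x, hx, hx0⟩ := ht
  have h2 : x + t • N x = 0 := hx
  have ht0 : t ≠ 0 := by
    rintro rfl
    rw [zero_smul, add_zero] at h2
    exact hx0 h2
  refine ⟨-t⁻¹, ?_, by simp⟩
  refine Module.End.hasEigenvalue_of_hasEigenvector (x := x) ⟨?_, hx0⟩
  rw [Module.End.mem_eigenspace_iff, neg_smul]
  have h3 : N x = t⁻¹ • (t • N x) := by rw [smul_smul, inv_mul_cancel₀ ht0, one_smul]
  rw [h3, eq_neg_of_add_eq_zero_right h2, smul_neg]

/-- If `A` is injective then `A + t C` is injective for all but finitely many `t`. -/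
theorem finite_setOf_not_injective_add_smul {U : Type*} [AddCommGroup U] [Module ℝ U]
    [FiniteDimensional ℝ U] {A C : U →ₗ[ℝ] W} (hA : Function.Injective A) :
    {t : ℝ | ¬Function.Injective (A + t • C : U →ₗ[ℝ] W)}.Finite := by
  obtain ⟨R, hR⟩ := A.exists_leftInverse_of_injective (LinearMap.ker_eq_bot.2 hA)
  refine (finite_setOf_not_injective_id_add_smul (V := W) ((C.comp R))).subset ?_
  intro t ht hinj
  apply ht
  intro y y' h
  have h1 : (LinearMap.id + t • C.comp R : W →ₗ[ℝ] W) (A y) = (LinearMap.id + t • C.comp R : W →ₗ[ℝ] W) (A y') := by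
    have e : ∀ y, R (A y) = y := fun y => congrArg (fun L => L y) hR
    simp only [LinearMap.add_apply, LinearMap.id_apply, LinearMap.smul_apply, LinearMap.comp_apply,
      e] at h ⊢
    exact h
  exact hA (hinj h1)

theorem finite_setOf_finrank_range_lt (A C : V →ₗ[ℝ] W) :
    {t : ℝ | Module.finrank ℝ (LinearMap.range (A + t • C)) <
      Module.finrank ℝ (LinearMap.range A)}.Finite := by
  obtain ⟨P, hP⟩ := A.rangeRestrict.exists_rightInverse_of_surjective (LinearMap.range_rangeRestrict A)
  have hAP : ∀ y, A (P y) = y := fun y => congrArg (fun L => ((L y : LinearMap.range A) : W)) hP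
  have hinj : Function.Injective (A.comp P) := fun y y' h => by
    simp only [LinearMap.comp_apply, hAP] at h
    exact Subtype.ext h
  refine (finite_setOf_not_injective_add_smul (C := C.comp P) hinj).subset ?_
  intro t ht hi
  rw [mem_ofPred_eq] at ht
  refine not_le.2 ht ?_
  have h1 : (A.comp P + t • C.comp P) = (A + t • C).comp P := by ext; simp
  rw [h1] at hi
  rw [← LinearMap.finrank_range_of_inj hi]
  exact Submodule.finrank_mono (LinearMap.range_comp_le_range _ _)

/-- If the rank of `A + t C` is never greater than the rank of `A`, then `C` maps the kernel of `A`
to its range. -/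
theorem mem_range_of_finrank_range_le {A C : V →ₗ[ℝ] W}
    (h : ∀ t : ℝ, Module.finrank ℝ (LinearMap.range (A + t • C)) ≤
      Module.finrank ℝ (LinearMap.range A)) {x : V} (hx : A x = 0) : C x ∈ LinearMap.range A := by
  by_contra hC
  obtain ⟨P, hP⟩ := A.rangeRestrict.exists_rightInverse_of_surjective (LinearMap.range_rangeRestrict A)
  have hAP : ∀ y, A (P y) = y := fun y => congrArg (fun L => ((L y : LinearMap.range A) : W)) hP
  -- Let `P` be a right inverse of `A`. If `t ≠ 0`, then
  -- `(A + t C) (P y + (s / t) x) = y + s C x + t C P y` for `y` in the range of `A` and `s` real.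
  -- For almost all `t` this is injective in `(y, s)`, so `A + t C` has a greater rank than `A`.
  set T : (LinearMap.range A × ℝ) →ₗ[ℝ] W :=
    (LinearMap.range A).subtype.coprod (LinearMap.toSpanSingleton ℝ W (C x))
  set D : (LinearMap.range A × ℝ) →ₗ[ℝ] W := (C.comp P).coprod 0
  have hT : Function.Injective T := by
    rw [← LinearMap.ker_eq_bot, LinearMap.ker_eq_bot']
    rintro ⟨y, s⟩ hys
    have h1 : (y : W) + s • C x = 0 := by simpa [T] using hys
    by_cases hs : s = 0
    · subst hs
      rw [zero_smul, add_zero] at h1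
      exact Prod.ext (Subtype.ext h1) rfl
    · exfalso
      apply hC
      have h2 : C x = s⁻¹ • (s • C x) := by rw [smul_smul, inv_mul_cancel₀ hs, one_smul]
      rw [h2, eq_neg_of_add_eq_zero_right h1]
      exact Submodule.smul_mem _ _ (Submodule.neg_mem _ y.2)
  have hfin := (finite_setOf_not_injective_add_smul (C := D) hT).union (finite_singleton (0 : ℝ))
  obtain ⟨t, ht⟩ := hfin.infinite_compl.nonempty
  rw [mem_compl_iff, mem_union, mem_ofPred_eq, not_or, not_not] at ht
  obtain ⟨hi, ht0⟩ := ht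
  have ht0 : t ≠ 0 := ht0
  have h1 : LinearMap.range (T + t • D) ≤ LinearMap.range (A + t • C) := by
    rintro _ ⟨⟨y, s⟩, rfl⟩
    refine ⟨P y + (s / t) • x, ?_⟩
    simp only [LinearMap.add_apply, LinearMap.smul_apply, map_add, map_smul, hAP, hx, add_zero, T, D, LinearMap.coprod_apply, LinearMap.comp_apply, Submodule.subtype_apply,
      LinearMap.toSpanSingleton_apply, LinearMap.zero_apply]
    rw [smul_add, smul_zero, zero_add, smul_smul, div_mul_cancel₀ _ ht0]
    abel
  have h2 := Submodule.finrank_mono h1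
  rw [LinearMap.finrank_range_of_inj hi, Module.finrank_prod, Module.finrank_self] at h2
  have := h t
  omega

variable {U : Type*} [NormedAddCommGroup U] [NormedSpace ℝ U] [FiniteDimensional ℝ U]

/-- The rank is lower semicontinuous. -/
theorem eventually_finrank_range_le (A : U →ₗ[ℝ] V →ₗ[ℝ] W) (u₀ : U) :
    ∀ᶠ u in 𝓝 u₀, Module.finrank ℝ (LinearMap.range (A u₀)) ≤
      Module.finrank ℝ (LinearMap.range (A u)) := by
  obtain ⟨P, hP⟩ := (A u₀).rangeRestrict.exists_rightInverse_of_surjective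
    (LinearMap.range_rangeRestrict _)
  have hAP : ∀ y, A u₀ (P y) = y :=
    fun y => congrArg (fun L => ((L y : LinearMap.range (A u₀)) : W)) hP
  set b := Module.finBasis ℝ (LinearMap.range (A u₀))
  have hli : LinearIndependent ℝ (fun i => A u₀ (P (b i))) := by
    simp only [hAP]
    exact b.linearIndependent.map' (LinearMap.range (A u₀)).subtype (Submodule.ker_subtype _)
  have hc : Continuous fun u => (fun i => A u (P (b i))) := by
    refine continuous_pi fun i => ?_
    exact (A.flip (P (b i))).continuous_of_finiteDimensional
  have hev := hc.continuousAt.eventually (isOpen_setOfPred_linearIndependent.mem_nhds hli)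
  filter_upwards [hev] with u hu
  have h1 := finrank_span_eq_card hu
  rw [Fintype.card_fin] at h1
  rw [← h1]
  refine Submodule.finrank_mono (Submodule.span_le.2 ?_)
  rintro _ ⟨i, rfl⟩
  exact ⟨_, rfl⟩

/-- Along a line through a point `u` of maximal rank for `A`, almost all points have maximal
rank. -/
theorem finite_setOf_finrank_range_lt_line (A : U →ₗ[ℝ] V →ₗ[ℝ] W) (u w : U) :
    {t : ℝ | Module.finrank ℝ (LinearMap.range (A (w + t • (u - w)))) <
      Module.finrank ℝ (LinearMap.range (A u))}.Finite := by
  refine ((finite_setOf_finrank_range_lt (A u) (A (w - u))).image fun s => 1 - s).subset ?_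
  intro t ht
  refine ⟨1 - t, ?_, by ring⟩
  have h1 : A u + (1 - t) • A (w - u) = A (w + t • (u - w)) := by
    rw [← map_smul, ← map_add]
    congr 1
    module
  rw [mem_ofPred_eq, h1]
  exact ht

end Rank

section FinrankMap

theorem finrank_map_add_finrank_inf_ker {V W : Type*} [AddCommGroup V] [Module ℝ V]
    [FiniteDimensional ℝ V] [AddCommGroup W] [Module ℝ W] (f : V →ₗ[ℝ] W) (S : Submodule ℝ V) :
    Module.finrank ℝ (S.map f) + Module.finrank ℝ ↥(S ⊓ LinearMap.ker f) =
      Module.finrank ℝ S := by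
  have h1 : (LinearMap.ker (f.comp S.subtype)).map S.subtype = S ⊓ LinearMap.ker f := by
    rw [LinearMap.ker_comp, Submodule.map_comap_subtype]
  have h2 : LinearMap.range (f.comp S.subtype) = S.map f := by
    rw [LinearMap.range_comp, Submodule.range_subtype]
  rw [← h1, ← h2, ← LinearEquiv.finrank_eq (Submodule.equivMapOfInjective S.subtype
    (Submodule.injective_subtype S) (LinearMap.ker (f.comp S.subtype)))]
  exact LinearMap.finrank_range_add_finrank_ker _

end FinrankMap

/-! ### Stabilizers, centralizers and the decomposition of the Lie algebra -/

section Centralizer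

variable {E : Type*} [NormedAddCommGroup E] [NormedSpace ℝ E] [FiniteDimensional ℝ E]
  {G : Type*} [TopologicalSpace G] [Group G] [ChartedSpace E G] [LieGroup 𝓘(ℝ, E) ∞ G]
  {F : Type*} [NormedAddCommGroup F] [NormedSpace ℝ F] [FiniteDimensional ℝ F]
  {Q : Type*} [TopologicalSpace Q] [ChartedSpace F Q] [IsManifold 𝓘(ℝ, F) ∞ Q] [MulAction G Q]
  {B : Metric E G}

variable (G) in
/-- The centralizer of `v` in the Lie algebra. -/
def cent (v : E) : Submodule ℝ E := LinearMap.ker ((lieBilin G).flip v)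

theorem mem_cent {v η : E} : η ∈ cent G v ↔ lieBr G η v = 0 := Iff.rfl

theorem mem_cent' {v η : E} : η ∈ cent G v ↔ lieBr G v η = 0 := by
  rw [mem_cent, ← lieBr_skew, neg_eq_zero]

variable (G) in
/-- The Lie algebra of the stabilizer of a point of `T*Q`. -/
def stab (α : Cotangent F Q) : Submodule ℝ E := LinearMap.ker (cotOrbit (E := E) G α).toLinearMap

theorem mem_stab {α : Cotangent F Q} {ξ : E} : ξ ∈ stab G α ↔ cotOrbit G α ξ = 0 := Iff.rfl

variable [T2Space G]

/-- A subspace stable under a one-parameter group is stable under its generator. -/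
theorem lieBr_mem_of_Ad_mem {S : Submodule ℝ E} {ξ η : E}
    (h : ∀ t : ℝ, Ad (oneParam G ξ t) η ∈ S) : lieBr G ξ η ∈ S := by
  have h1 := hasDerivAt_Ad (oneParam_zero ξ) (hasVelocity_oneParam (G := G) ξ) η
  by_contra hmem
  obtain ⟨f, hf, hfS⟩ := Submodule.exists_dual_map_eq_bot_of_notMem (p := S) hmem inferInstance
  have h2 := (LinearMap.toContinuousLinearMap f).hasFDerivAt.comp_hasDerivAt (0 : ℝ) h1
  have h3 : (LinearMap.toContinuousLinearMap f ∘ fun t => Ad (oneParam G ξ t) η) = fun _ => 0 :=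
    funext fun t => (Submodule.eq_bot_iff _).1 hfS _ (Submodule.mem_map_of_mem (h t))
  rw [h3] at h2
  exact hf (h2.unique (hasDerivAt_const _ _))

theorem Ad_oneParam_of_mem_cent {v ξ : E} (h : ξ ∈ cent G v) (t : ℝ) :
    Ad (oneParam G ξ t) v = v := Ad_oneParam_of_lieBr_eq_zero h t

theorem lieBr_mem_cent {v ξ η : E} (hξ : ξ ∈ cent G v) (hη : η ∈ cent G v) :
    lieBr G ξ η ∈ cent G v := by
  refine lieBr_mem_of_Ad_mem fun t => ?_
  have h := lieBr_Ad (oneParam G ξ t) η v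
  rw [Ad_oneParam_of_mem_cent hξ, mem_cent.1 hη, map_zero] at h
  exact h

theorem map_Ad_cent (g : G) (v : E) :
    (cent G v).map (Ad g : E →L[ℝ] E).toLinearMap = cent G (Ad g v) := by
  ext η
  constructor
  · rintro ⟨ξ, hξ, rfl⟩
    exact (lieBr_Ad g ξ v).trans (by rw [mem_cent.1 hξ, map_zero])
  · intro h
    refine ⟨Ad g⁻¹ η, ?_, Ad_Ad_inv g η⟩
    have h1 := lieBr_Ad g⁻¹ η (Ad g v)
    rw [mem_cent.1 h, map_zero, Ad_inv_Ad] at h1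
    exact h1

theorem Ad_injective (g : G) : Function.Injective (Ad g : E →L[ℝ] E) := fun ξ η h => by
  rw [← Ad_inv_Ad g ξ, h, Ad_inv_Ad]

theorem finrank_map_Ad (g : G) (S : Submodule ℝ E) :
    Module.finrank ℝ (S.map (Ad g : E →L[ℝ] E).toLinearMap) = Module.finrank ℝ S :=
  (LinearEquiv.finrank_eq (Submodule.equivMapOfInjective _ (Ad_injective g) S)).symm

variable [ContMDiffSMul 𝓘(ℝ, E) 𝓘(ℝ, F) ∞ G Q]

theorem cotActDeriv_cotOrbit_eq_zero_iff (g : G) (α : Cotangent F Q) {ξ : E} :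
    cotActDeriv g α (cotOrbit G α ξ) = 0 ↔ cotOrbit G α ξ = 0 := by
  constructor
  · intro h
    have h1 := cotOrbit_cotAct (E := E) g α ξ
    have h2 := cotOrbit_cotAct (E := E) g⁻¹ (cotAct g α) (Ad g ξ)
    rw [cotAct_inv_cotAct (E := E), Ad_inv_Ad, h1, h, map_zero] at h2
    exact h2
  · intro h
    rw [h, map_zero]

theorem map_Ad_stab (g : G) (α : Cotangent F Q) :
    (stab (E := E) G α).map (Ad g : E →L[ℝ] E).toLinearMap = stab G (cotAct g α) := by
  ext η
  constructor
  · rintro ⟨ξ, hξ, rfl⟩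
    exact (cotOrbit_cotAct g α ξ).trans (by rw [mem_stab.1 hξ, map_zero])
  · intro h
    refine ⟨Ad g⁻¹ η, ?_, Ad_Ad_inv g η⟩
    rw [SetLike.mem_coe, mem_stab, ← cotActDeriv_cotOrbit_eq_zero_iff g, ← cotOrbit_cotAct, Ad_Ad_inv]
    exact h

variable [T2Space Q]

/-- Elements fixing `α` fix its moment, by equivariance of the moment map. -/
theorem cent_of_mem_stab (hB : IsBiinvariant B) {α : Cotangent F Q} {ξ : E} (h : ξ ∈ stab G α) :
    ξ ∈ cent G (momentVec B α) := by
  rw [mem_cent]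
  refine eq_zero_of_inn (B := B) fun η => ?_
  have h1 := momentDeriv_cotOrbit (E := E) (G := G) α η ξ
  rw [mem_stab.1 h, map_zero, ← inn_momentVec (B := B)] at h1
  rw [hB.inn_lieBr, ← h1]; rfl

end Centralizer

section Homogeneous

variable {E : Type*} [NormedAddCommGroup E] [NormedSpace ℝ E] [FiniteDimensional ℝ E]
  {G : Type*} [TopologicalSpace G] [Group G] [ChartedSpace E G] [LieGroup 𝓘(ℝ, E) ∞ G] [T2Space G]
  {H : Subgroup G}
  {F : Type*} [NormedAddCommGroup F] [NormedSpace ℝ F] [FiniteDimensional ℝ F]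
  [ChartedSpace F (G ⧸ H)] [IsManifold 𝓘(ℝ, F) ∞ (G ⧸ H)]
  [ContMDiffSMul 𝓘(ℝ, E) 𝓘(ℝ, F) ∞ G (G ⧸ H)] [T2Space (G ⧸ H)]
  {B : Metric E G}

theorem cotAct_oneParam_of_cent (hQ : IsQuotientStructure E H F) (hB : IsBiinvariant B)
    {α : Cotangent F (G ⧸ H)} {ξ : E} (h1 : baseOrbit (F := F) G α.1 ξ = 0)
    (h2 : ξ ∈ cent G (momentVec B α)) (t : ℝ) : cotAct (oneParam G ξ t) α = α := by
  refine eq_of_moment_eq hQ (oneParam_smul_eq (F := F) h1 t) ?_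
  apply moment_eq_of_momentVec_eq (B := B)
  rw [hB.momentVec_cotAct, Ad_oneParam_of_mem_cent h2]

theorem mem_stab_iff (hQ : IsQuotientStructure E H F) (hB : IsBiinvariant B)
    {α : Cotangent F (G ⧸ H)} {ξ : E} :
    ξ ∈ stab G α ↔ baseOrbit (F := F) G α.1 ξ = 0 ∧ ξ ∈ cent G (momentVec B α) := by
  refine ⟨fun h => ⟨?_, cent_of_mem_stab hB h⟩, fun h => ?_⟩
  · rw [← proj_cotOrbit, mem_stab.1 h, map_zero]
  · have h1 := hasVelocity_cotAct_oneParam (G := G) ξ α 0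
    rw [oneParam_zero, cotAct_one] at h1
    refine h1.unique ((hasVelocity_const α 0).congr (Eventually.of_forall fun t => ?_))
    exact cotAct_oneParam_of_cent hQ hB h.1 h.2 t

theorem cotAct_oneParam_of_mem_stab (hQ : IsQuotientStructure E H F) (hB : IsBiinvariant B)
    {α : Cotangent F (G ⧸ H)} {ξ : E} (h : ξ ∈ stab G α) (t : ℝ) :
    cotAct (oneParam G ξ t) α = α :=
  cotAct_oneParam_of_cent hQ hB ((mem_stab_iff hQ hB).1 h).1 ((mem_stab_iff hQ hB).1 h).2 t

variable (H F) in
/-- The isotropy algebra `𝔥`, as a subspace of the model space. -/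
def iso : Submodule ℝ E := LinearMap.ker (baseOrbit (E := E) (F := F) G (base H)).toLinearMap

theorem mem_iso {ξ : E} : ξ ∈ iso H F ↔ baseOrbit (F := F) G (base H) ξ = 0 := Iff.rfl

variable (H F B) in
/-- The orthogonal complement `𝔳` of `𝔥`, as a subspace of the model space. -/
def hor : Submodule ℝ E where
  carrier := {u | ∀ ξ ∈ iso (E := E) H F, inn B ξ u = 0}
  add_mem' := fun ha hb ξ hξ => by rw [map_add, ha ξ hξ, hb ξ hξ, add_zero]
  zero_mem' := fun ξ _ => map_zero _
  smul_mem' := fun c a ha ξ hξ => by rw [map_smul, ha ξ hξ, smul_zero]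

/-- The scalar product as a bilinear form in the sense of linear algebra. -/
def innForm (B : Metric E G) : LinearMap.BilinForm ℝ E :=
  LinearMap.mk₂ ℝ (fun u w => inn B u w) (by simp) (by simp) (by simp) (by simp)

/-- Orthogonal decomposition along a subspace. -/
theorem exists_orthogonal_decomp (B : Metric E G) (S : Submodule ℝ E) (x : E) :
    ∃ a ∈ S, ∃ b, (∀ ξ ∈ S, inn B ξ b = 0) ∧ x = a + b := by
  have h : IsCompl S ((innForm B).orthogonal S) := by
    refine (LinearMap.BilinForm.isCompl_orthogonal_iff_disjoint ?_).2 ?_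
    · intro u w h
      exact (inn_symm w u).trans h
    · rw [Submodule.disjoint_def]
      intro u hu hu'
      exact eq_zero_of_inn_self (hu' u hu)
  have h1 : x ∈ S ⊔ (innForm B).orthogonal S := by rw [h.sup_eq_top]; trivial
  obtain ⟨a, ha, b, hb, rfl⟩ := Submodule.mem_sup.1 h1
  exact ⟨a, ha, b, hb, rfl⟩

theorem mem_iso_of_inn_hor {x : E} (h : ∀ u ∈ hor H F B, inn B u x = 0) : x ∈ iso H F := by
  obtain ⟨a, ha, b, hb, rfl⟩ := exists_orthogonal_decomp B (iso H F) x
  have h1 := h b hb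
  rw [map_add, inn_symm b a, hb a ha, zero_add] at h1
  rw [eq_zero_of_inn_self h1, add_zero]
  exact ha

theorem momentVec_mem_hor {α : Cotangent F (G ⧸ H)} (h : α.1 = base H) :
    momentVec B α ∈ hor H F B := by
  intro ξ hξ
  rw [inn_symm, inn_momentVec, moment_eq, ContinuousLinearMap.comp_apply, h, mem_iso.1 hξ, map_zero]

/-- A linear right inverse of the differential of the projection `G → G ⧸ H` at the identity. -/
theorem exists_rightInverse_baseOrbit (hQ : IsQuotientStructure E H F) :
    ∃ s : F →L[ℝ] E, ∀ y, baseOrbit (F := F) G (base H) (s y) = y := by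
  obtain ⟨R, hR⟩ := (baseOrbit (E := E) (F := F) G (base H)).toLinearMap.exists_rightInverse_of_surjective
    (LinearMap.range_eq_top.2 (baseOrbit_surjective hQ (base H)))
  exact ⟨R.toContinuousLinearMap, fun y => congrArg (fun L => L y) hR⟩

/-- The covector at the base point whose moment is `u`, for `u` orthogonal to `𝔥`. For other `u` the
value depends on the choice of a right inverse; it makes the map linear on the whole Lie algebra. -/
def lift (hQ : IsQuotientStructure E H F) (B : Metric E G) (u : E) : Cotangent F (G ⧸ H) :=
  let p : F →L[ℝ] ℝ := (inn B u).comp (exists_rightInverse_baseOrbit hQ).choose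
  ⟨base H, p⟩

theorem lift_fst (hQ : IsQuotientStructure E H F) (u : E) : (lift hQ B u).1 = base H := rfl

theorem momentum_lift (hQ : IsQuotientStructure E H F) (u : E) :
    momentum (lift hQ B u) = (inn B u).comp (exists_rightInverse_baseOrbit hQ).choose := rfl

theorem momentVec_lift (hQ : IsQuotientStructure E H F) {u : E} (hu : u ∈ hor H F B) :
    momentVec B (lift hQ B u) = u := by
  apply metricAt_injective B 1
  refine ContinuousLinearMap.ext fun ξ => ?_
  change inn B _ _ = inn B _ _
  set s := (exists_rightInverse_baseOrbit hQ).choose with hs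
  have hs' := (exists_rightInverse_baseOrbit hQ).choose_spec
  rw [inn_momentVec, moment_eq, momentum_lift, lift_fst]
  simp only [ContinuousLinearMap.comp_apply]
  have h1 : ξ - s (baseOrbit G (base H) ξ) ∈ iso H F := by
    rw [mem_iso, map_sub, hs', sub_self]
  have h2 := hu _ h1
  rw [inn_symm, map_sub, sub_eq_zero] at h2
  exact h2.symm

theorem lift_momentVec (hQ : IsQuotientStructure E H F) {α : Cotangent F (G ⧸ H)}
    (h : α.1 = base H) : lift hQ B (momentVec B α) = α :=
  eq_of_moment_eq hQ h.symm
    (moment_eq_of_momentVec_eq (B := B) (momentVec_lift hQ (momentVec_mem_hor h)))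

theorem lift_Ad (hQ : IsQuotientStructure E H F) (hB : IsBiinvariant B) {h : G} (hh : h ∈ H) {u : E}
    (hu : u ∈ hor H F B) : lift hQ B (Ad h u) = cotAct h (lift hQ B u) := by
  have h1 : (cotAct h (lift hQ B u)).1 = base H := smul_base_eq_iff.2 hh
  rw [← lift_momentVec (B := B) hQ h1, hB.momentVec_cotAct, momentVec_lift hQ hu]

theorem contMDiff_lift (hQ : IsQuotientStructure E H F) :
    ContMDiff 𝓘(ℝ, E) (cotModel F) ∞ (lift hQ B) := by
  intro u
  refine contMDiffAt_cotangent contMDiffAt_const ?_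
  have h1 : ∀ w, lift hQ B w ∈ (cotChart (lift hQ B u)).source := fun w =>
    mem_cotChart_source.2 (mem_extChartAt_source (I := 𝓘(ℝ, F)) (base H))
  simp only [cotChart_apply (h1 _), momentum_lift]
  set s := (exists_rightInverse_baseOrbit hQ).choose
  refine ContMDiff.contMDiffAt (ContDiff.contMDiff ?_)
  have h2 : ContDiff ℝ ∞ (fun w : E => (inn B w).comp s) := (inn B).contDiff.clm_comp contDiff_const
  exact h2.clm_comp (contDiff_const (c := modelDeriv 𝓘(ℝ, F) 𝓘(ℝ, F)
    (extChartAt 𝓘(ℝ, F) (base H)).symm (extChartAt 𝓘(ℝ, F) (base H) (base H))))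

theorem exists_eq_cotAct_lift (hQ : IsQuotientStructure E H F)
    (α : Cotangent F (G ⧸ H)) {g : G} (hg : g • base H = α.1) :
    momentVec B (cotAct g⁻¹ α) ∈ hor H F B ∧
      cotAct g (lift hQ B (momentVec B (cotAct g⁻¹ α))) = α := by
  have h1 : (cotAct g⁻¹ α).1 = base H := by rw [cotAct_fst, ← hg, inv_smul_smul]
  exact ⟨momentVec_mem_hor h1, by rw [lift_momentVec hQ h1, cotAct_cotAct_inv (E := E)]⟩

theorem stab_lift (hQ : IsQuotientStructure E H F) (hB : IsBiinvariant B) {u : E}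
    (hu : u ∈ hor H F B) : stab G (lift hQ B u) = cent G u ⊓ iso H F := by
  ext ξ
  rw [mem_stab_iff hQ hB, momentVec_lift hQ hu, and_comm]
  exact Iff.rfl

/-! ### Generic elements -/

variable (H F B) in
/-- Generic elements of `𝔳`, as elements of the model space. -/
def IsGen (u : E) : Prop :=
  u ∈ hor H F B ∧ ∀ w ∈ hor H F B,
    Module.finrank ℝ (cent G u) ≤ Module.finrank ℝ (cent G w) ∧
    Module.finrank ℝ ↥(cent G u ⊓ iso H F) ≤ Module.finrank ℝ ↥(cent G w ⊓ iso H F)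

variable (G) in
/-- The family `u ↦ (η ↦ [η, u])`. -/
def adFam : E →ₗ[ℝ] E →ₗ[ℝ] E := (lieBilin G).flip

variable (H F) in
/-- The family `u ↦ (η ↦ [η, u])`, restricted to `𝔥`. -/
def adIsoFam : E →ₗ[ℝ] iso (E := E) H F →ₗ[ℝ] E where
  toFun u := (adFam G u).comp (iso H F).subtype
  map_add' u w := by rw [map_add]; rfl
  map_smul' c u := by rw [map_smul]; rfl

theorem finrank_range_adFam (u : E) :
    Module.finrank ℝ (LinearMap.range (adFam G u)) + Module.finrank ℝ (cent G u) =
      Module.finrank ℝ E := LinearMap.finrank_range_add_finrank_ker _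

theorem finrank_range_adIsoFam (u : E) :
    Module.finrank ℝ (LinearMap.range (adIsoFam H F u)) +
      Module.finrank ℝ ↥(cent G u ⊓ iso (E := E) H F) = Module.finrank ℝ (iso (E := E) H F) := by
  have h1 : LinearMap.range (adIsoFam (E := E) H F u) = (iso H F).map (adFam G u) := by
    change LinearMap.range ((adFam G u).comp (iso H F).subtype) = _
    rw [LinearMap.range_comp, Submodule.range_subtype]
  rw [h1, inf_comm]
  exact finrank_map_add_finrank_inf_ker (adFam G u) (iso H F)

theorem isGen_iff {u : E} : IsGen H F B u ↔ u ∈ hor H F B ∧ ∀ w ∈ hor H F B,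
    Module.finrank ℝ (LinearMap.range (adFam G w)) ≤
      Module.finrank ℝ (LinearMap.range (adFam G u)) ∧
    Module.finrank ℝ (LinearMap.range (adIsoFam H F w)) ≤
      Module.finrank ℝ (LinearMap.range (adIsoFam H F u)) := by
  refine and_congr_right fun _ => forall₂_congr fun w _ => ?_
  have h1 := finrank_range_adFam (G := G) u
  have h2 := finrank_range_adFam (G := G) w
  have h3 := finrank_range_adIsoFam (G := G) (H := H) (F := F) u
  have h4 := finrank_range_adIsoFam (G := G) (H := H) (F := F) w
  omega

theorem exists_max_finrank {V : Type*} [AddCommGroup V] [Module ℝ V] [FiniteDimensional ℝ V]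
    (A : E →ₗ[ℝ] V →ₗ[ℝ] E) (S : Submodule ℝ E) : ∃ u ∈ S, ∀ w ∈ S,
      Module.finrank ℝ (LinearMap.range (A w)) ≤ Module.finrank ℝ (LinearMap.range (A u)) := by
  have hfin : ((fun u => Module.finrank ℝ (LinearMap.range (A u))) '' (S : Set E)).Finite :=
    (finite_Iic (Module.finrank ℝ E)).subset (by
      rintro _ ⟨u, -, rfl⟩
      exact Submodule.finrank_le _)
  obtain ⟨_, ⟨u, hu, rfl⟩, hmax⟩ := hfin.exists_maximal ⟨_, 0, S.zero_mem, rfl⟩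
  refine ⟨u, hu, fun w hw => ?_⟩
  by_contra hlt
  exact hlt (hmax ⟨w, hw, rfl⟩ (le_of_lt (not_le.1 hlt)))

/-- Almost all points are generic on the line that joins an element of `𝔳` where the rank of `ad` is
maximal and one where the rank of its restriction to `𝔥` is maximal. -/
theorem exists_isGen : ∃ u : E, IsGen H F B u := by
  obtain ⟨u, hu, hum⟩ := exists_max_finrank (adFam (E := E) G) (hor H F B)
  obtain ⟨w, hw, hwm⟩ := exists_max_finrank (adIsoFam (E := E) H F) (hor H F B)
  have h1 := finite_setOf_finrank_range_lt_line (adFam (E := E) G) u w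
  have h2 := finite_setOf_finrank_range_lt (adIsoFam H F w) (adIsoFam H F (u - w))
  obtain ⟨t, ht⟩ := (h1.union h2).infinite_compl.nonempty
  rw [mem_compl_iff, mem_union, mem_ofPred_eq, mem_ofPred_eq, not_or, not_lt, not_lt, ← map_smul,
    ← map_add] at ht
  refine ⟨w + t • (u - w), isGen_iff.2 ⟨?_, fun x hx => ⟨(hum x hx).trans ht.1,
    (hwm x hx).trans ht.2⟩⟩⟩
  exact Submodule.add_mem _ hw (Submodule.smul_mem _ _ (Submodule.sub_mem _ hu hw))

/-- Generic elements are dense in `𝔳`. -/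
theorem dense_isGen {w : E} (hw : w ∈ hor H F B) {O : Set E} (hO : O ∈ 𝓝 w) :
    ∃ u ∈ O, IsGen H F B u := by
  obtain ⟨u, hu⟩ := exists_isGen (E := E) (H := H) (F := F) (B := B)
  have hu' := isGen_iff.1 hu
  have h1 := finite_setOf_finrank_range_lt_line (adFam (E := E) G) u w
  have h2 := finite_setOf_finrank_range_lt_line (adIsoFam (E := E) H F) u w
  have hc : Tendsto (fun t : ℝ => w + t • (u - w)) (𝓝[≠] 0) (𝓝 w) := by
    have : Continuous fun t : ℝ => w + t • (u - w) := by fun_prop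
    have h3 := this.tendsto 0
    rw [zero_smul, add_zero] at h3
    exact h3.mono_left nhdsWithin_le_nhds
  have hfin := nhdsNE_le_cofinite (0 : ℝ) (h1.union h2).compl_mem_cofinite
  obtain ⟨t, ht, htO⟩ := ((eventually_mem_set.2 hfin).and (hc.eventually hO)).exists
  rw [mem_compl_iff, mem_union, mem_ofPred_eq, mem_ofPred_eq, not_or, not_lt, not_lt] at ht
  refine ⟨_, htO, isGen_iff.2 ⟨?_, fun x hx => ⟨(hu'.2 x hx).1.trans ht.1,
    (hu'.2 x hx).2.trans ht.2⟩⟩⟩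
  exact Submodule.add_mem _ hw (Submodule.smul_mem _ _ (Submodule.sub_mem _ hu.1 hw))

theorem IsGen.eventually {u : E} (hu : IsGen H F B u) :
    ∀ᶠ w in 𝓝 u, w ∈ hor H F B → IsGen H F B w := by
  have hu' := isGen_iff.1 hu
  filter_upwards [eventually_finrank_range_le (adFam (E := E) G) u,
    eventually_finrank_range_le (adIsoFam (E := E) H F) u] with w h1 h2 hw
  exact isGen_iff.2 ⟨hw, fun x hx => ⟨(hu'.2 x hx).1.trans h1, (hu'.2 x hx).2.trans h2⟩⟩

/-- The centralizer of a generic element is abelian modulo `𝔥`: since the rank of `ad u` is maximal,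
`ad w` maps the kernel of `ad u` to its range, the orthogonal complement of the kernel. -/
theorem IsGen.lieBr_mem_iso (hB : IsBiinvariant B) {u : E} (hu : IsGen H F B u) {ξ η : E}
    (hξ : ξ ∈ cent G u) (hη : η ∈ cent G u) : lieBr G ξ η ∈ iso H F := by
  refine mem_iso_of_inn_hor (B := B) fun w hw => ?_
  have h1 : adFam G w ξ ∈ LinearMap.range (adFam G u) := by
    refine mem_range_of_finrank_range_le (fun t => ?_) hξ
    rw [← map_smul, ← map_add]
    exact ((isGen_iff.1 hu).2 _ (Submodule.add_mem _ hu.1 (Submodule.smul_mem _ t hw))).1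
  obtain ⟨ζ, hζ⟩ := h1
  have h2 : lieBr G ζ u = lieBr G ξ w := hζ
  have h3 : inn B (lieBr G ξ w) η = 0 := by
    rw [← h2, ← lieBr_skew, map_neg, neg_apply, hB.inn_lieBr, mem_cent'.1 hη, map_zero,
      neg_zero, neg_zero]
  rw [hB.inn_lieBr, neg_eq_zero] at h3
  exact h3

end Homogeneous

/-! ### Invariant functions separate the orbits of a compact group -/

section Expansion

variable {E : Type*} [NormedAddCommGroup E] [NormedSpace ℝ E]
  {K : Type*} [TopologicalSpace K]

/-- The function `(h, x) ↦ p (ρ h x)` is a finite sum of products of a continuous function of `h`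
and a smooth function of `x`. All polynomials have this property. -/
def IsExpandable (ρ : K → E →L[ℝ] E) (p : E → ℝ) : Prop :=
  ∃ (ι : Type) (_ : Fintype ι) (c : ι → K → ℝ) (e : ι → E → ℝ), (∀ i, Continuous (c i)) ∧
    (∀ i, ContDiff ℝ ∞ (e i)) ∧ ∀ h x, p (ρ h x) = ∑ i, c i h * e i x

theorem isExpandable_const (ρ : K → E →L[ℝ] E) (a : ℝ) : IsExpandable ρ fun _ => a :=
  ⟨Unit, inferInstance, fun _ _ => a, fun _ _ => 1, fun _ => continuous_const,
    fun _ => contDiff_const, by simp⟩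

theorem IsExpandable.add {ρ : K → E →L[ℝ] E} {p q : E → ℝ} (hp : IsExpandable ρ p)
    (hq : IsExpandable ρ q) : IsExpandable ρ fun x => p x + q x := by
  obtain ⟨ι, _, c, e, hc, he, h⟩ := hp
  obtain ⟨ι', _, c', e', hc', he', h'⟩ := hq
  refine ⟨ι ⊕ ι', inferInstance, Sum.elim c c', Sum.elim e e', ?_, ?_, fun g x => ?_⟩
  · rintro (i | i); exacts [hc i, hc' i]
  · rintro (i | i); exacts [he i, he' i]
  · rw [Fintype.sum_sum_type]
    exact congrArg₂ (· + ·) (h g x) (h' g x)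

theorem IsExpandable.mul {ρ : K → E →L[ℝ] E} {p q : E → ℝ} (hp : IsExpandable ρ p)
    (hq : IsExpandable ρ q) : IsExpandable ρ fun x => p x * q x := by
  obtain ⟨ι, _, c, e, hc, he, h⟩ := hp
  obtain ⟨ι', _, c', e', hc', he', h'⟩ := hq
  refine ⟨ι × ι', inferInstance, fun i g => c i.1 g * c' i.2 g, fun i x => e i.1 x * e' i.2 x,
    fun i => (hc _).mul (hc' _), fun i => (he _).mul (he' _), fun g x => ?_⟩
  rw [Fintype.sum_prod_type]
  refine (congrArg₂ (· * ·) (h g x) (h' g x)).trans ((Finset.sum_mul_sum _ _ _ _).trans ?_)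
  exact Finset.sum_congr rfl fun i _ => Finset.sum_congr rfl fun j _ => by ring

theorem isExpandable_linear [FiniteDimensional ℝ E] {ρ : K → E →L[ℝ] E} (hρ : Continuous ρ)
    (l : E →L[ℝ] ℝ) : IsExpandable ρ l := by
  set b := Module.finBasis ℝ E
  refine ⟨Fin (Module.finrank ℝ E), inferInstance, fun i h => l (ρ h (b i)),
    fun i x => b.coord i x, fun i => l.continuous.comp (hρ.clm_apply continuous_const),
    fun i => (LinearMap.toContinuousLinearMap (b.coord i)).contDiff, fun h x => ?_⟩
  conv_lhs => rw [← b.sum_repr x]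
  simp only [map_sum, map_smul, smul_eq_mul]
  exact Finset.sum_congr rfl fun i _ => mul_comm _ _

end Expansion

section Separation

variable {E : Type*} [NormedAddCommGroup E] [NormedSpace ℝ E] [FiniteDimensional ℝ E]
  {K : Type*} [TopologicalSpace K] [Group K] [IsTopologicalGroup K] [CompactSpace K]

open MeasureTheory in
/-- Smooth invariant functions separate the orbits of a linear representation of a compact group:
a polynomial close to `0` on one orbit and to `1` on the other is averaged over the group. The
average is smooth, as it is a linear combination of smooth functions. -/
theorem exists_invariant_separating {ρ : K → E →L[ℝ] E} (hρ : Continuous ρ)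
    (hmul : ∀ g h x, ρ (g * h) x = ρ g (ρ h x)) {u w : E} (huw : ∀ g h, ρ g u ≠ ρ h w) :
    ∃ f : E → ℝ, ContDiff ℝ ∞ f ∧ (∀ h x, f (ρ h x) = f x) ∧ f u ≠ f w := by
  have hcont : ∀ x, Continuous fun h => ρ h x := fun x => hρ.clm_apply continuous_const
  have hc1 := isCompact_range (hcont u)
  have hc2 := isCompact_range (hcont w)
  have hdisj : Disjoint (range fun h => ρ h u) (range fun h => ρ h w) := by
    rw [Set.disjoint_left]
    rintro _ ⟨g, rfl⟩ ⟨h, hh⟩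
    exact huw g h hh.symm
  obtain ⟨φ, hφ0, hφ1, -⟩ := exists_continuous_zero_one_of_isClosed hc1.isClosed hc2.isClosed hdisj
  set X : Set E := (range fun h => ρ h u) ∪ range fun h => ρ h w
  have : CompactSpace X := isCompact_iff_compactSpace.1 (hc1.union hc2)
  -- By the Stone–Weierstrass theorem, the expandable functions are dense in the continuous functions
  -- on the union `X` of the two orbits.
  let A : Subalgebra ℝ C(X, ℝ) :=
    { carrier := {q | ∃ p : E → ℝ, IsExpandable ρ p ∧ ∀ x : X, q x = p x}
      mul_mem' := by
        rintro a b ⟨p, hp, ha⟩ ⟨q, hq, hb⟩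
        exact ⟨_, hp.mul hq, fun x => by rw [ContinuousMap.mul_apply, ha, hb]⟩
      add_mem' := by
        rintro a b ⟨p, hp, ha⟩ ⟨q, hq, hb⟩
        exact ⟨_, hp.add hq, fun x => by rw [ContinuousMap.add_apply, ha, hb]⟩
      algebraMap_mem' := fun r => ⟨_, isExpandable_const ρ r, fun x => rfl⟩ }
  have hA : A.SeparatesPoints := by
    intro x y hxy
    have h1 : (x : E) ≠ y := fun h => hxy (Subtype.ext h)
    obtain ⟨l, hl⟩ := SeparatingDual.exists_separating_of_ne (R := ℝ) h1
    exact ⟨_, ⟨⟨fun x : X => l x, l.continuous.comp continuous_subtype_val⟩,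
      ⟨l, isExpandable_linear hρ l, fun _ => rfl⟩, rfl⟩, hl⟩
  obtain ⟨⟨q, p, hp, hqp⟩, hq⟩ :=
    ContinuousMap.exists_mem_subalgebra_near_continuousMap_of_separatesPoints A hA
      (φ.restrict X) (1 / 3) (by norm_num)
  have hnear : ∀ x ∈ X, |p x - φ x| < 1 / 3 := by
    intro x hx
    have h1 := (ContinuousMap.norm_coe_le_norm (q - φ.restrict X) ⟨x, hx⟩).trans_lt hq
    rw [ContinuousMap.sub_apply, hqp] at h1
    exact h1
  obtain ⟨ι, _, c, e, hc, he, hce⟩ := hp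
  let _ : MeasurableSpace K := borel K
  have : BorelSpace K := ⟨rfl⟩
  let μ : Measure K := Measure.haarMeasure ⊤
  have : IsFiniteMeasure μ := CompactSpace.isFiniteMeasure
  have hint : ∀ {k : K → ℝ}, Continuous k → Integrable k μ := fun hk =>
    hk.integrable_of_hasCompactSupport (HasCompactSupport.of_compactSpace _)
  have hpc : ∀ x, Continuous fun h => p (ρ h⁻¹ x) := by
    intro x
    simp only [hce]
    exact continuous_finsetSum _ fun i _ => ((hc i).comp continuous_inv).mul continuous_const
  -- The inverse turns the left invariance of the Haar measure into the invariance of the average.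
  refine ⟨fun x => ∫ h, p (ρ h⁻¹ x) ∂μ, ?_, ?_, ?_⟩
  · have h1 : (fun x => ∫ h, p (ρ h⁻¹ x) ∂μ) = fun x => ∑ i, (∫ h, c i h⁻¹ ∂μ) * e i x := by
      funext x
      simp only [hce]
      rw [integral_finsetSum (μ := μ) (f := fun i h => c i h⁻¹ * e i x) Finset.univ fun i _ =>
        hint (((hc i).comp continuous_inv).mul continuous_const)]
      exact Finset.sum_congr rfl fun i _ => integral_mul_const _ _
    rw [h1]
    exact ContDiff.sum fun i _ => contDiff_const.mul (he i)
  · intro k x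
    dsimp only
    rw [← integral_mul_left_eq_self (fun h => p (ρ h⁻¹ (ρ k x))) k]
    refine integral_congr_ae (Eventually.of_forall fun h => ?_)
    change p (ρ (k * h)⁻¹ (ρ k x)) = _
    rw [← hmul]
    congr 2
    group
  · have h1 : ∀ h, p (ρ h⁻¹ u) + 1 / 3 ≤ p (ρ h⁻¹ w) := by
      intro h
      have h2 := abs_lt.1 (hnear _ (Or.inl ⟨h⁻¹, rfl⟩))
      have h3 := abs_lt.1 (hnear _ (Or.inr ⟨h⁻¹, rfl⟩))
      have h4 : φ (ρ h⁻¹ u) = 0 := hφ0 ⟨h⁻¹, rfl⟩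
      have h5 : φ (ρ h⁻¹ w) = 1 := hφ1 ⟨h⁻¹, rfl⟩
      rw [h4] at h2
      rw [h5] at h3
      linarith [h2.2, h3.1]
    have h2 := integral_mono ((hint (hpc u)).add (hint continuous_const)) (hint (hpc w)) h1
    have h3 : 0 < μ.real univ :=
      ENNReal.toReal_pos (IsOpen.measure_ne_zero μ isOpen_univ univ_nonempty) (measure_ne_top μ _)
    have h4 : ∫ h, (p (ρ h⁻¹ u) + 1 / 3) ∂μ =
        (∫ h, p (ρ h⁻¹ u) ∂μ) + μ.real univ * (1 / 3) := by
      rw [integral_add (hint (hpc u)) (hint continuous_const), integral_const, smul_eq_mul]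
    intro h5
    have h6 : (∫ h, p (ρ h⁻¹ u) ∂μ) + μ.real univ * (1 / 3) ≤ ∫ h, p (ρ h⁻¹ w) ∂μ := h4 ▸ h2
    simp only at h5
    linarith

end Separation

section Invariant

variable {E : Type*} [NormedAddCommGroup E] [NormedSpace ℝ E] [FiniteDimensional ℝ E]
  {G : Type*} [TopologicalSpace G] [Group G] [ChartedSpace E G] [LieGroup 𝓘(ℝ, E) ∞ G] [T2Space G]
  {H : Subgroup G}

variable (H) in
/-- Smooth functions on the Lie algebra invariant under `Ad(H)`. -/
def IsInvariantFun (f : E → ℝ) : Prop := ContDiff ℝ ∞ f ∧ ∀ h ∈ H, ∀ x, f (Ad h x) = f x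

/-- Smooth `Ad(H)`-invariant functions separate the orbits of `Ad(H)`. -/
theorem exists_Ad_eq_of_invariantFun [CompactSpace G] (hH : IsClosed (H : Set G)) {u w : E}
    (huw : ∀ f, IsInvariantFun H f → f u = f w) : ∃ h ∈ H, Ad h u = w := by
  by_contra! hne
  have : IsTopologicalGroup G := topologicalGroup_of_lieGroup 𝓘(ℝ, E) ∞
  have : CompactSpace H := isCompact_iff_compactSpace.1 hH.isCompact
  obtain ⟨f, hf, hinv, hsep⟩ := exists_invariant_separating (u := u) (w := w)
    (ρ := fun h : H => (Ad (h : G) : E →L[ℝ] E)) (continuous_Ad.comp continuous_subtype_val)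
    (fun g h x => Ad_mul_apply (g : G) h x) (fun g h hgh => by
      refine hne ((h : G)⁻¹ * g) (H.mul_mem (H.inv_mem h.2) g.2) ?_
      rw [Ad_mul_apply, hgh, Ad_inv_Ad])
  exact hsep (huw f ⟨hf, fun h hh x => hinv ⟨h, hh⟩ x⟩)

variable {F : Type*} [NormedAddCommGroup F] [NormedSpace ℝ F] [FiniteDimensional ℝ F]
  [ChartedSpace F (G ⧸ H)] [IsManifold 𝓘(ℝ, F) ∞ (G ⧸ H)]
  [ContMDiffSMul 𝓘(ℝ, E) 𝓘(ℝ, F) ∞ G (G ⧸ H)] [T2Space (G ⧸ H)]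
  {B : Metric E G}

/-- The function on `T*(G ⧸ H)` induced by an `Ad(H)`-invariant function `f`: its value at
`g • α`, for `α` over the base point, is the value of `f` at the moment of `α`. The choice of `g` is
immaterial, by `inducedFun_eq`. -/
def inducedFun (B : Metric E G) (f : E → ℝ) (α : Cotangent F (G ⧸ H)) : ℝ :=
  f (momentVec B (cotAct (exists_smul_base α.1).choose⁻¹ α))

theorem inducedFun_eq (hB : IsBiinvariant B) {f : E → ℝ} (hf : IsInvariantFun H f)
    {α : Cotangent F (G ⧸ H)} {g : G} (hg : g • base H = α.1) :
    inducedFun B f α = f (momentVec B (cotAct g⁻¹ α)) := by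
  have h1 := (exists_smul_base α.1).choose_spec
  unfold inducedFun
  set k := (exists_smul_base α.1).choose
  have h2 : k⁻¹ * g ∈ H := smul_base_eq_iff.1 (by rw [mul_smul, hg, ← h1, inv_smul_smul])
  rw [← hf.2 _ h2 (momentVec B (cotAct g⁻¹ α)), ← hB.momentVec_cotAct, ← cotAct_mul (E := E),
    mul_inv_cancel_right]

/-- Near a covector over `g • o`, the group element `σ q` given by a smooth local section `σ` moves
the base point to `q`. -/
theorem IsQuotientStructure.exists_section_smul (hQ : IsQuotientStructure E H F) (g : G) :
    ∃ σ : G ⧸ H → G, ContMDiffAt 𝓘(ℝ, F) 𝓘(ℝ, E) ∞ σ (g • base H) ∧ σ (g • base H) = g ∧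
      ∀ᶠ q in 𝓝 (g • base H), σ q • base H = q := by
  obtain ⟨σ, h1, h2, h3⟩ := hQ.exists_section g
  rw [smul_base]
  exact ⟨σ, h1, h2, h3.mono fun q hq => (smul_base _).trans hq⟩

/-- The map `β ↦ (σ q)⁻¹ • β`, where `q` is the base point of `β`, for a local section `σ`. -/
theorem contMDiffAt_cotAct_section {σ : G ⧸ H → G} {α : Cotangent F (G ⧸ H)}
    (hσ : ContMDiffAt 𝓘(ℝ, F) 𝓘(ℝ, E) ∞ σ α.1) :
    ContMDiffAt (cotModel F) (cotModel F) ∞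
      (fun β : Cotangent F (G ⧸ H) => cotAct (σ β.1)⁻¹ β) α := by
  have hp : ContMDiffAt (cotModel F) 𝓘(ℝ, F) ∞ (fun β : Cotangent F (G ⧸ H) => β.1) α :=
    Bundle.contMDiffAt_proj _
  have h1 : ContMDiffAt (cotModel F) 𝓘(ℝ, E) ∞ (fun β : Cotangent F (G ⧸ H) => (σ β.1)⁻¹) α :=
    (ContMDiffAt.comp α hσ hp).inv
  exact ContMDiffAt.comp α (g := fun p : G × Cotangent F (G ⧸ H) => cotAct p.1 p.2)
    (contMDiff_cotAct (E := E) (G := G) (F := F) (Q := G ⧸ H)).contMDiffAt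
    (h1.prodMk contMDiffAt_id)

theorem contMDiff_inducedFun (hQ : IsQuotientStructure E H F) (hB : IsBiinvariant B) {f : E → ℝ}
    (hf : IsInvariantFun H f) :
    ContMDiff (cotModel F) 𝓘(ℝ, ℝ) ∞ (inducedFun (F := F) (H := H) B f) := by
  intro α
  obtain ⟨g, hg⟩ := exists_smul_base α.1
  obtain ⟨σ, h1, -, h3⟩ := hQ.exists_section_smul g
  rw [hg] at h1 h3
  have hp : ContinuousAt (fun β : Cotangent F (G ⧸ H) => β.1) α :=
    (Bundle.contMDiffAt_proj (n := ∞) (IB := 𝓘(ℝ, F)) (F := F →L[ℝ] ℝ)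
      (fun q : G ⧸ H => TangentSpace 𝓘(ℝ, F) q →L[ℝ] Trivial (G ⧸ H) ℝ q)).continuousAt
  refine ContMDiffAt.congr_of_eventuallyEq (f := fun β : Cotangent F (G ⧸ H) =>
    f (momentVec B (cotAct (σ β.1)⁻¹ β))) ?_ ?_
  · exact hf.1.contMDiff.contMDiffAt.comp α
      ((contMDiff_momentVec (B := B)).contMDiffAt.comp α (contMDiffAt_cotAct_section h1))
  · filter_upwards [hp.eventually h3] with β hβ
    exact inducedFun_eq hB hf hβ

/-- The invariant function on `T*(G ⧸ H)` induced by an `Ad(H)`-invariant function. -/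
theorem exists_invariantAlgebra (hQ : IsQuotientStructure E H F) (hB : IsBiinvariant B) {f : E → ℝ}
    (hf : IsInvariantFun H f) : ∃ k ∈ invariantAlgebra G F (G ⧸ H),
      ∀ (g : G) (α : Cotangent F (G ⧸ H)), g • base H = α.1 →
        k α = f (momentVec B (cotAct g⁻¹ α)) := by
  refine ⟨⟨inducedFun B f, contMDiff_inducedFun hQ hB hf⟩,
    (mem_invariantAlgebra_iff (E := E)).2 fun g α => ?_, fun g α hg => inducedFun_eq hB hf hg⟩
  change inducedFun B f (cotAct g α) = inducedFun B f α
  obtain ⟨k, hk⟩ := exists_smul_base α.1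
  rw [inducedFun_eq hB hf hk, inducedFun_eq (g := g * k) hB hf (by rw [mul_smul, hk, cotAct_fst]),
    mul_inv_rev, cotAct_mul (E := E), cotAct_inv_cotAct (E := E)]

/-- Smooth invariant functions separate the orbits of `G` in `T*(G/H)`: these orbits correspond to the
orbits of `Ad(H)` in `𝔳`, and every smooth `Ad(H)`-invariant function on `𝔤` induces a smooth
invariant function on `T*(G/H)`. -/
theorem exists_cotAct_eq [CompactSpace G] (hH : IsClosed (H : Set G))
    (hQ : IsQuotientStructure E H F) (hB : IsBiinvariant B) {α β : Cotangent F (G ⧸ H)}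
    (h : ∀ f ∈ invariantAlgebra G F (G ⧸ H), f α = f β) : ∃ g : G, cotAct g α = β := by
  obtain ⟨g, hg⟩ := exists_smul_base α.1
  obtain ⟨k, hk⟩ := exists_smul_base β.1
  obtain ⟨y, hy, hyv⟩ := exists_Ad_eq_of_invariantFun (E := E) hH
    (u := momentVec B (cotAct g⁻¹ α)) (w := momentVec B (cotAct k⁻¹ β)) fun f hf => by
      obtain ⟨q, hq, hq'⟩ := exists_invariantAlgebra hQ hB hf
      rw [← hq' g α hg, ← hq' k β hk]
      exact h q hq
  obtain ⟨h1, h2⟩ := exists_eq_cotAct_lift (B := B) hQ α hg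
  obtain ⟨-, h4⟩ := exists_eq_cotAct_lift (B := B) hQ β hk
  refine ⟨k * y * g⁻¹, ?_⟩
  rw [cotAct_mul (E := E), cotAct_mul (E := E), ← h4, ← hyv, lift_Ad hQ hB hy h1]
  congr 2
  conv_lhs => rw [← h2, cotAct_inv_cotAct (E := E)]

end Invariant

/-! ### Immersions and level sets in a vector space -/

section Curves

variable {V : Type*} [NormedAddCommGroup V] [NormedSpace ℝ V] [FiniteDimensional ℝ V]
  {W : Type*} [NormedAddCommGroup W] [NormedSpace ℝ W] [FiniteDimensional ℝ W]

/-- An immersion has a smooth left inverse near each point. -/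
theorem exists_leftInverse_of_injective {A : V → W} {a : V} {L : V →L[ℝ] W}
    (hA : ContDiffAt ℝ ∞ A a) (hL : HasFDerivAt A L a) (hi : Function.Injective L) :
    ∃ Λ : W → V, ContDiffAt ℝ ∞ Λ (A a) ∧ ∀ᶠ y in 𝓝 a, Λ (A y) = y := by
  obtain ⟨R, hR⟩ := (L : V →ₗ[ℝ] W).exists_leftInverse_of_injective
    (LinearMap.ker_eq_bot.2 hi)
  set R' : W →L[ℝ] V := R.toContinuousLinearMap
  have h1 : HasFDerivAt (fun y => R' (A y)) (ContinuousLinearEquiv.refl ℝ V : V →L[ℝ] V) a := by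
    have h2 := R'.hasFDerivAt.comp a hL
    have h3 : R'.comp L = (ContinuousLinearEquiv.refl ℝ V : V →L[ℝ] V) :=
      ContinuousLinearMap.ext fun v => congrArg (fun T => T v) hR
    rw [h3] at h2
    exact h2
  obtain ⟨g, hg, -, -, hg'⟩ := exists_localInverse (R'.contDiff.contDiffAt.comp a hA) h1 rfl
  exact ⟨fun w => g (R' w), ContDiffAt.comp (A a) hg R'.contDiff.contDiffAt, hg'⟩

/-- The velocity of a curve contained in the image of an immersion is in the range of its
differential. -/
theorem mem_range_of_curve {A : V → W} {a : V} {L : V →L[ℝ] W} (hA : ContDiffAt ℝ ∞ A a)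
    (hL : HasFDerivAt A L a) (hi : Function.Injective L) {c : ℝ → W} {X : W} (hc0 : c 0 = A a)
    (hc : HasDerivAt c X 0) (hmem : ∀ N ∈ 𝓝 a, ∀ᶠ t in 𝓝 (0 : ℝ), ∃ y ∈ N, A y = c t) :
    ∃ y, L y = X := by
  obtain ⟨Λ, hΛ, hΛA⟩ := exists_leftInverse_of_injective hA hL hi
  have ha : Λ (A a) = a := hΛA.self_of_nhds
  have h1 : HasDerivAt (fun t => Λ (c t)) (fderiv ℝ Λ (A a) X) 0 := by
    have := (hΛ.differentiableAt (by simp)).hasFDerivAt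
    rw [← hc0] at this ⊢
    exact this.comp_hasDerivAt (0 : ℝ) hc
  have h2 : HasDerivAt (fun t => A (Λ (c t))) (L (fderiv ℝ Λ (A a) X)) 0 := by
    have h3 : HasFDerivAt A L (Λ (c 0)) := by rw [hc0, ha]; exact hL
    exact h3.comp_hasDerivAt (0 : ℝ) h1
  refine ⟨_, h2.unique (hc.congr_of_eventuallyEq ?_)⟩
  filter_upwards [hmem _ hΛA] with t ⟨y, hy, hyt⟩
  rw [← hyt, show Λ (A y) = y from hy]

/-- A vector in the kernel of the differential of a submersion is the velocity of a curve in its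
level set. -/
theorem exists_curve_in_level {Φ : V → W} {a : V} {L : V →L[ℝ] W} (hΦ : ContDiffAt ℝ ∞ Φ a)
    (hL : HasFDerivAt Φ L a) (hs : Function.Surjective L) {X : V} (hX : L X = 0) :
    ∃ c : ℝ → V, ContDiffAt ℝ ∞ c 0 ∧ c 0 = a ∧ HasDerivAt c X 0 ∧
      ∀ᶠ t in 𝓝 (0 : ℝ), Φ (c t) = Φ a := by
  obtain ⟨R, hR⟩ := (L : V →ₗ[ℝ] W).exists_rightInverse_of_surjective (LinearMap.range_eq_top.2 hs)
  set R' : W →L[ℝ] V := R.toContinuousLinearMap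
  have hLR : ∀ w, L (R' w) = w := fun w => congrArg (fun T => T w) hR
  -- `Ξ` straightens `Φ`: its differential at `a` is the identity and `L ∘ Ξ = Φ` up to a constant.
  set Ξ : V → V := fun z => z + R' (Φ z - Φ a - L (z - a)) with hΞ
  have hΞs : ContDiffAt ℝ ∞ Ξ a := contDiffAt_id.add (R'.contDiff.contDiffAt.comp a
    ((hΦ.sub contDiffAt_const).sub (L.contDiff.contDiffAt.comp a
      (contDiffAt_id.sub contDiffAt_const))))
  have hΞd : HasFDerivAt Ξ (ContinuousLinearEquiv.refl ℝ V : V →L[ℝ] V) a := by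
    have h1 := (hasFDerivAt_id (𝕜 := ℝ) a).add (R'.hasFDerivAt.comp a
      ((hL.sub_const (Φ a)).sub (L.hasFDerivAt.comp a ((hasFDerivAt_id (𝕜 := ℝ) a).sub_const a))))
    convert! h1 using 1
    ext v
    simp
  have hΞa : Ξ a = a := by simp [hΞ]
  obtain ⟨g, hg, hga, hgr, -⟩ := exists_localInverse hΞs hΞd hΞa
  have hline : HasDerivAt (fun t : ℝ => a + t • X) X 0 := by
    simpa using ((hasDerivAt_id (0 : ℝ)).smul_const X).const_add a
  have hline0 : a + (0 : ℝ) • X = a := by simp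
  have hgd : HasFDerivAt g (ContinuousLinearMap.id ℝ V) a := by
    have h1 := (hg.differentiableAt (by simp)).hasFDerivAt
    have h2 : HasFDerivAt Ξ (ContinuousLinearMap.id ℝ V) (g a) := by rw [hga]; exact hΞd
    have h3 := (h2.comp a h1).unique ((hasFDerivAt_id (𝕜 := ℝ) a).congr_of_eventuallyEq hgr)
    rw [ContinuousLinearMap.id_comp] at h3
    rw [h3] at h1
    exact h1
  refine ⟨fun t => g (a + t • X), ?_, by dsimp only; rw [hline0, hga], ?_, ?_⟩
  · have h1 : ContDiffAt ℝ ∞ g (a + (0 : ℝ) • X) := by rw [hline0]; exact hg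
    exact ContDiffAt.comp (0 : ℝ) h1
      (contDiffAt_const.add (contDiffAt_id.smul contDiffAt_const))
  · have h1 : HasFDerivAt g (ContinuousLinearMap.id ℝ V) (a + (0 : ℝ) • X) := by
      rw [hline0]; exact hgd
    exact h1.comp_hasDerivAt (0 : ℝ) hline
  · have h1 : Tendsto (fun t : ℝ => a + t • X) (𝓝 0) (𝓝 a) := by
      have := hline.continuousAt.tendsto
      rwa [hline0] at this
    filter_upwards [h1.eventually hgr] with t ht
    have h2 := congrArg L ht
    simp only [hΞ, map_add, hLR, map_sub, map_smul, hX, smul_zero, add_zero] at h2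
    have h3 : L (g (a + t • X)) + (Φ (g (a + t • X)) - Φ a - (L (g (a + t • X)) - L a)) - L a = 0 :=
      sub_eq_zero.2 h2
    rw [← sub_eq_zero, ← h3]
    abel

end Curves

/-! ### Orbits of a compact group -/

section Orbit

variable {E : Type*} [NormedAddCommGroup E] [NormedSpace ℝ E] [FiniteDimensional ℝ E]
  {G : Type*} [TopologicalSpace G] [Group G] [ChartedSpace E G] [LieGroup 𝓘(ℝ, E) ∞ G]

/-- In the orbit of a compact group, points near `x` are of the form `g • x` with `g` near the
identity. -/
theorem eventually_exists_near_one {K : Type*} [TopologicalSpace K] [Group K]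
    [IsTopologicalGroup K] [CompactSpace K] {X : Type*} [TopologicalSpace X] [T2Space X] {ρ : K → X}
    (hρ : Continuous ρ) (hmul : ∀ g k, ρ k = ρ 1 → ρ (g * k) = ρ g) {N : Set K}
    (hN : N ∈ 𝓝 (1 : K)) : ∀ᶠ y in 𝓝 (ρ 1), ∀ g, ρ g = y → ∃ n ∈ N, ρ n = y := by
  set O : Set K := ⋃ k ∈ {k | ρ k = ρ 1}, (fun g => g * k⁻¹) ⁻¹' interior N
  have hO : IsOpen O := isOpen_biUnion fun k _ => isOpen_interior.preimage (by fun_prop)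
  have hcl : IsClosed (ρ '' Oᶜ) := (hO.isClosed_compl.isCompact.image hρ).isClosed
  have h1 : ρ 1 ∉ ρ '' Oᶜ := by
    rintro ⟨g, hg, hg1⟩
    refine hg (mem_biUnion (x := g) hg1 ?_)
    rw [mem_preimage, mul_inv_cancel]
    exact mem_interior_iff_mem_nhds.2 hN
  filter_upwards [hcl.isOpen_compl.mem_nhds h1] with y hy g hg
  have h2 : g ∈ O := by
    by_contra h
    exact hy ⟨g, h, hg⟩
  obtain ⟨k, hk, hgk⟩ := mem_iUnion₂.1 h2
  refine ⟨g * k⁻¹, interior_subset hgk, ?_⟩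
  rw [← hg, ← hmul (g * k⁻¹) k hk, inv_mul_cancel_right]

variable [T2Space G]

/-- A smooth parametrization of a piece of the group by a subspace of the Lie algebra, whose
differential at the origin is the inclusion, and which takes values in the group generated by the
subspace. It is a homomorphism if the subspace is abelian. -/
structure IsSubspaceParam (S : Submodule ℝ E) (ψ : S → G) : Prop where
  contMDiff : ContMDiff 𝓘(ℝ, S) 𝓘(ℝ, E) ∞ ψ
  zero : ψ 0 = 1
  deriv : HasModelDerivAt 𝓘(ℝ, S) 𝓘(ℝ, E) ψ 0 S.subtypeL
  mem : ∀ s, ψ s ∈ Subgroup.closure {g | ∃ ξ ∈ S, ∃ t, oneParam G ξ t = g}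
  hom : (∀ ξ ∈ S, ∀ η ∈ S, lieBr G ξ η = 0) → ∀ s t, ψ (s + t) = ψ s * ψ t

theorem exists_isSubspaceParam (S : Submodule ℝ E) : ∃ ψ : S → G, IsSubspaceParam S ψ := by
  set b := Module.finBasis ℝ S
  obtain ⟨ψ, h1, h2, h3, h4, h5⟩ := exists_prod_oneParam (G := G) _ fun i => (b i : E)
  set e : S →L[ℝ] (Fin (Module.finrank ℝ S) → ℝ) := b.equivFun.toLinearMap.toContinuousLinearMap
  have he : ∀ s i, e s i = b.repr s i := fun s i => rfl
  refine ⟨fun s => ψ (e s), h1.comp e.contDiff.contMDiff, by rw [map_zero, h2], ?_, fun s => ?_, ?_⟩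
  · have h6 := HasModelDerivAt.comp (f := ψ) (g := fun s => e s) (x := 0) h3 (map_zero e)
      (hasModelDerivAt_iff.2 e.hasFDerivAt)
    convert! h6 using 1
    refine ContinuousLinearMap.ext fun s => ?_
    have h7 := congrArg S.subtype (b.sum_repr s)
    rw [map_sum] at h7
    rw [ContinuousLinearMap.comp_apply, sum_apply]
    exact h7.symm.trans (Finset.sum_congr rfl fun i _ => by
      rw [map_smul, ContinuousLinearMap.smulRight_apply]; rfl)
  · refine Subgroup.closure_mono ?_ (h4 (e s))
    rintro g ⟨i, t, rfl⟩
    exact ⟨b i, (b i).2, t, rfl⟩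
  · intro hc s t
    rw [map_add]
    exact h5 (fun i j => hc _ (b i).2 _ (b j).2) _ _

theorem IsSubspaceParam.mem_subgroup {S : Submodule ℝ E} {ψ : S → G} (h : IsSubspaceParam S ψ)
    {K : Subgroup G} (hK : ∀ ξ ∈ S, ∀ t, oneParam G ξ t ∈ K) (s : S) : ψ s ∈ K := by
  refine (Subgroup.closure_le K).2 ?_ (h.mem s)
  rintro _ ⟨ξ, hξ, t, rfl⟩
  exact hK ξ hξ t

theorem IsSubspaceParam.mul_deriv {S₁ S₂ : Submodule ℝ E} {ψ₁ : S₁ → G} {ψ₂ : S₂ → G}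
    (h₁ : IsSubspaceParam S₁ ψ₁) (h₂ : IsSubspaceParam S₂ ψ₂) :
    HasModelDerivAt 𝓘(ℝ, S₁ × S₂) 𝓘(ℝ, E) (fun p : S₁ × S₂ => ψ₁ p.1 * ψ₂ p.2) 0
      (S₁.subtypeL.coprod S₂.subtypeL) := by
  have ha := HasModelDerivAt.comp (f := ψ₁) (g := fun p : S₁ × S₂ => p.1) (x := 0) h₁.deriv rfl
    (hasModelDerivAt_iff.2 (ContinuousLinearMap.fst ℝ S₁ S₂).hasFDerivAt)
  have hb := HasModelDerivAt.comp (f := ψ₂) (g := fun p : S₁ × S₂ => p.2) (x := 0) h₂.deriv rfl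
    (hasModelDerivAt_iff.2 (ContinuousLinearMap.snd ℝ S₁ S₂).hasFDerivAt)
  have hc := HasModelDerivAt.comp (f := fun p : G × G => p.1 * p.2)
    (g := fun p : S₁ × S₂ => (ψ₁ p.1, ψ₂ p.2)) (x := 0) hasModelDerivAt_mul_one_one
    (by rw [Prod.fst_zero, Prod.snd_zero, h₁.zero, h₂.zero]) (ha.prodMk hb)
  exact hc

theorem IsSubspaceParam.mul_contMDiff {S₁ S₂ : Submodule ℝ E} {ψ₁ : S₁ → G} {ψ₂ : S₂ → G}
    (h₁ : IsSubspaceParam S₁ ψ₁) (h₂ : IsSubspaceParam S₂ ψ₂) :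
    ContMDiff 𝓘(ℝ, S₁ × S₂) 𝓘(ℝ, E) ∞ (fun p : S₁ × S₂ => ψ₁ p.1 * ψ₂ p.2) :=
  (h₁.contMDiff.comp contDiff_fst.contMDiff).mul (h₂.contMDiff.comp contDiff_snd.contMDiff)

/-- If three subspaces span the Lie algebra, the products of their parametrizations cover a
neighbourhood of the identity. -/
theorem exists_factorization {S₁ S₂ S₃ : Submodule ℝ E} (hS : S₁ ⊔ S₂ ⊔ S₃ = ⊤) {ψ₁ : S₁ → G}
    {ψ₂ : S₂ → G} {ψ₃ : S₃ → G} (h₁ : IsSubspaceParam S₁ ψ₁) (h₂ : IsSubspaceParam S₂ ψ₂)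
    (h₃ : IsSubspaceParam S₃ ψ₃) {N : Set (S₁ × S₂)} (hN : N ∈ 𝓝 0) :
    ∀ᶠ g in 𝓝 (1 : G), ∃ p ∈ N, ∃ u : S₃, g = ψ₁ p.1 * ψ₂ p.2 * ψ₃ u := by
  set f : (S₁ × S₂) × S₃ → G := fun p => ψ₁ p.1.1 * ψ₂ p.1.2 * ψ₃ p.2 with hf
  have hf0 : f 0 = 1 := by
    simp only [hf, Prod.fst_zero, Prod.snd_zero, h₁.zero, h₂.zero, h₃.zero, mul_one]
  have ha := HasModelDerivAt.comp (f := fun p : S₁ × S₂ => ψ₁ p.1 * ψ₂ p.2)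
    (g := fun p : (S₁ × S₂) × S₃ => p.1) (x := 0) (h₁.mul_deriv h₂) rfl
    (hasModelDerivAt_iff.2 (ContinuousLinearMap.fst ℝ (S₁ × S₂) S₃).hasFDerivAt)
  have hb := HasModelDerivAt.comp (f := ψ₃) (g := fun p : (S₁ × S₂) × S₃ => p.2) (x := 0) h₃.deriv
    rfl (hasModelDerivAt_iff.2 (ContinuousLinearMap.snd ℝ (S₁ × S₂) S₃).hasFDerivAt)
  have hc := HasModelDerivAt.comp (f := fun p : G × G => p.1 * p.2)
    (g := fun p : (S₁ × S₂) × S₃ => (ψ₁ p.1.1 * ψ₂ p.1.2, ψ₃ p.2)) (x := 0)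
    hasModelDerivAt_mul_one_one (by
      simp only [Prod.fst_zero, Prod.snd_zero, h₁.zero, h₂.zero, h₃.zero, mul_one])
    (ha.prodMk hb)
  have hs : Function.Surjective (modelDeriv 𝓘(ℝ, (S₁ × S₂) × S₃) 𝓘(ℝ, E) f 0) := by
    rw [HasModelDerivAt.modelDeriv_eq (f := f) hc]
    intro x
    have hx : x ∈ S₁ ⊔ S₂ ⊔ S₃ := by rw [hS]; trivial
    obtain ⟨y, hy, c, hc, rfl⟩ := Submodule.mem_sup.1 hx
    obtain ⟨a, ha, b, hb, rfl⟩ := Submodule.mem_sup.1 hy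
    exact ⟨((⟨a, ha⟩, ⟨b, hb⟩), ⟨c, hc⟩), rfl⟩
  have hsm : ContMDiff 𝓘(ℝ, (S₁ × S₂) × S₃) 𝓘(ℝ, E) ∞ f :=
    ((h₁.mul_contMDiff h₂).comp contDiff_fst.contMDiff).mul (h₃.contMDiff.comp contDiff_snd.contMDiff)
  obtain ⟨σ, h4, h5, h6⟩ := exists_contMDiffAt_section hsm.contMDiffAt hs
  rw [hf0] at h4 h5 h6
  have h7 : ∀ᶠ g in 𝓝 (1 : G), (σ g).1 ∈ N := by
    have h8 : Tendsto (fun g => (σ g).1) (𝓝 1) (𝓝 0) := by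
      have h9 := (continuous_fst (X := S₁ × S₂) (Y := S₃)).continuousAt.tendsto.comp
        h4.continuousAt.tendsto
      rw [h5] at h9
      exact h9
    exact h8 hN
  filter_upwards [h6, h7] with g hg hgN
  exact ⟨(σ g).1, hgN, (σ g).2, hg.symm⟩

variable {F : Type*} [NormedAddCommGroup F] [NormedSpace ℝ F] [FiniteDimensional ℝ F]
  {Q : Type*} [TopologicalSpace Q] [ChartedSpace F Q] [IsManifold 𝓘(ℝ, F) ∞ Q] [MulAction G Q]
  [ContMDiffSMul 𝓘(ℝ, E) 𝓘(ℝ, F) ∞ G Q]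

/-- The stabilizer of a point of `T*Q`. -/
def stabilizer (α : Cotangent F Q) : Subgroup G where
  carrier := {g | cotAct g α = α}
  mul_mem' := fun {a b} ha hb => by
    change cotAct (a * b) α = α
    rw [cotAct_mul (E := E), show cotAct b α = α from hb, show cotAct a α = α from ha]
  one_mem' := cotAct_one α
  inv_mem' := fun {a} ha => by
    change cotAct a⁻¹ α = α
    conv_lhs => rw [← show cotAct a α = α from ha]
    exact cotAct_inv_cotAct (E := E) a α

/-- The points near `α` of the orbit of `α` are of the form `(ψ₁ x * ψ₂ y) • α` with `(x, y)` small,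
when `S₁`, `S₂` and a subspace of the stabilizer algebra of `α` span the Lie algebra. -/
theorem eventually_exists_factorization [CompactSpace G] [T2Space (Cotangent F Q)]
    {α : Cotangent F Q} {S₁ S₂ S₃ : Submodule ℝ E}
    (hS : S₁ ⊔ S₂ ⊔ S₃ = ⊤) (hS₃ : ∀ ξ ∈ S₃, ∀ t, cotAct (oneParam G ξ t) α = α)
    {ψ₁ : S₁ → G} {ψ₂ : S₂ → G} (h₁ : IsSubspaceParam S₁ ψ₁) (h₂ : IsSubspaceParam S₂ ψ₂)
    {N : Set (S₁ × S₂)} (hN : N ∈ 𝓝 0) :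
    ∀ᶠ β in 𝓝 α, ∀ g : G, cotAct g α = β → ∃ p ∈ N, cotAct (ψ₁ p.1 * ψ₂ p.2) α = β := by
  have : IsTopologicalGroup G := topologicalGroup_of_lieGroup 𝓘(ℝ, E) ∞
  obtain ⟨ψ₃, h₃⟩ := exists_isSubspaceParam (G := G) S₃
  have h4 := eventually_exists_near_one (ρ := fun g : G => cotAct g α)
    (contMDiff_cotAct_right (E := E) α).continuous (fun g k hk => by
      rw [cotAct_one] at hk
      rw [cotAct_mul (E := E), hk]) (exists_factorization hS h₁ h₂ h₃ hN)
  rw [cotAct_one] at h4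
  filter_upwards [h4] with β hβ g hg
  obtain ⟨n, ⟨p, hp, u, rfl⟩, hn⟩ := hβ g hg
  refine ⟨p, hp, ?_⟩
  rw [← hn, cotAct_mul (E := E) _ (ψ₃ u)]
  congr 1
  exact (h₃.mem_subgroup (K := stabilizer (E := E) α) hS₃ u).symm

end Orbit

/-! ### The differentials of a space of functions -/

section Functionals

variable {V : Type*} [NormedAddCommGroup V] [NormedSpace ℝ V] {k : ℕ}

theorem linearIndependent_functionals_iff {L : Fin k → V →L[ℝ] ℝ} :
    LinearIndependent ℝ L ↔ ∀ c : Fin k → ℝ, (∀ X, ∑ i, c i * L i X = 0) → ∀ i, c i = 0 := by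
  rw [Fintype.linearIndependent_iff]
  refine forall_congr' fun c => ?_
  have h1 : (∑ i, c i • L i = 0) ↔ ∀ X, ∑ i, c i * L i X = 0 := by
    refine ContinuousLinearMap.ext_iff.trans (forall_congr' fun X => ?_)
    rw [sum_apply, zero_apply]
    rfl
  rw [h1]

theorem linearIndependent_comp_iff {V' : Type*} [NormedAddCommGroup V'] [NormedSpace ℝ V']
    {L : Fin k → V →L[ℝ] ℝ} {D : Fin k → V' →L[ℝ] ℝ} {T : V →L[ℝ] V'}
    (hT : Function.Surjective T) (h : ∀ i, L i = (D i).comp T) :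
    LinearIndependent ℝ L ↔ LinearIndependent ℝ D := by
  rw [linearIndependent_functionals_iff, linearIndependent_functionals_iff]
  refine forall_congr' fun c => imp_congr_left ?_
  simp only [h, ContinuousLinearMap.comp_apply]
  exact ⟨fun h' Y => by obtain ⟨X, rfl⟩ := hT Y; exact h' X, fun h' X => h' _⟩

theorem surjective_pi_of_linearIndependent {L : Fin k → V →L[ℝ] ℝ} (h : LinearIndependent ℝ L) :
    Function.Surjective (ContinuousLinearMap.pi L) := by
  by_contra hne
  have h1 : LinearMap.range (ContinuousLinearMap.pi L).toLinearMap < ⊤ :=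
    lt_top_iff_ne_top.2 fun h' => hne (LinearMap.range_eq_top.1 h')
  obtain ⟨f, hf, hfr⟩ := Submodule.exists_dual_map_eq_bot_of_lt_top h1 inferInstance
  refine hf (LinearMap.pi_ext' fun i => LinearMap.ext_ring ?_)
  refine linearIndependent_functionals_iff.1 h (fun i => f (Pi.single i 1)) (fun X => ?_) i
  have h2 : f (ContinuousLinearMap.pi L X) = 0 :=
    (Submodule.eq_bot_iff _).1 hfr _ (Submodule.mem_map_of_mem (LinearMap.mem_range_self _ X))
  rw [← h2]
  conv_rhs => rw [← Finset.univ_sum_single (ContinuousLinearMap.pi L X), map_sum]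
  refine Finset.sum_congr rfl fun j _ => ?_
  rw [ContinuousLinearMap.pi_apply, mul_comm, ← smul_eq_mul, ← map_smul, ← Pi.single_smul,
    smul_eq_mul, mul_one]

theorem exists_linearIndependent_mem [FiniteDimensional ℝ V] (S : Submodule ℝ V) :
    ∃ b : Fin (Module.finrank ℝ S) → V, LinearIndependent ℝ b ∧ ∀ i, b i ∈ S :=
  ⟨fun i => Module.finBasis ℝ S i, (Module.finBasis ℝ S).linearIndependent.map' S.subtype
    (Submodule.ker_subtype _), fun i => (Module.finBasis ℝ S i).2⟩

end Functionals

section Differentials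

variable {F : Type*} [NormedAddCommGroup F] [NormedSpace ℝ F] [FiniteDimensional ℝ F]
  {Q : Type*} [TopologicalSpace Q] [ChartedSpace F Q] [IsManifold 𝓘(ℝ, F) ∞ Q]

/-- The differential at `β`, as a linear map on smooth functions. -/
def difflMap (β : Cotangent F Q) : SmoothFun F Q →ₗ[ℝ] (CotSpace F →L[ℝ] ℝ) where
  toFun f := diffl f β
  map_add' f g := diffl_add f g β
  map_smul' c f := diffl_smul c f β

/-- The space of the differentials at `β` of the functions in `A`. -/
def dSpace (A : Submodule ℝ (SmoothFun F Q)) (β : Cotangent F Q) :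
    Submodule ℝ (CotSpace F →L[ℝ] ℝ) := A.map (difflMap β)

/-- The common kernel of the differentials at `β` of the functions in `A`. -/
def kSpace (A : Submodule ℝ (SmoothFun F Q)) (β : Cotangent F Q) : Submodule ℝ (CotSpace F) where
  carrier := {X | ∀ f ∈ A, diffl f β X = 0}
  add_mem' := fun ha hb f hf => by rw [map_add, ha f hf, hb f hf, add_zero]
  zero_mem' := fun _ _ => map_zero _
  smul_mem' := fun c a ha f hf => by rw [map_smul, ha f hf, smul_zero]

variable {A : Submodule ℝ (SmoothFun F Q)}

theorem diffl_mem_dSpace {f : SmoothFun F Q} (hf : f ∈ A) (β : Cotangent F Q) :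
    diffl f β ∈ dSpace A β := Submodule.mem_map_of_mem (f := difflMap β) hf

theorem finrank_dSpace_add (A : Submodule ℝ (SmoothFun F Q)) (β : Cotangent F Q) :
    Module.finrank ℝ (dSpace A β) + Module.finrank ℝ (kSpace A β) =
      Module.finrank ℝ (CotSpace F) := by
  let e : (CotSpace F →L[ℝ] ℝ) ≃ₗ[ℝ] Module.Dual ℝ (CotSpace F) :=
    LinearMap.toContinuousLinearMap.symm
  set D := (dSpace A β).map e.toLinearMap with hD
  have h1 : Module.finrank ℝ D = Module.finrank ℝ (dSpace A β) := e.finrank_map_eq _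
  have h2 : D.dualCoannihilator = kSpace A β := by
    ext X
    rw [Submodule.mem_dualCoannihilator]
    constructor
    · intro h f hf
      exact h (e (diffl f β)) (Submodule.mem_map_of_mem (diffl_mem_dSpace hf β))
    · rintro h _ ⟨_, ⟨f, hf, rfl⟩, rfl⟩
      exact h f hf
  rw [← h1, ← h2]
  exact Subspace.finrank_add_finrank_dualCoannihilator_eq D

theorem modelDeriv_chart_surjective {α β : Cotangent F Q} (h : β ∈ (cotChart α).source) :
    Function.Surjective (modelDeriv (cotModel F) 𝓘(ℝ, CotSpace F) (cotChart α) β) := fun Z =>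
  ⟨_, modelDeriv_modelDeriv_symm h Z⟩

theorem modelDeriv_chart_injective {α β : Cotangent F Q} (h : β ∈ (cotChart α).source) :
    Function.Injective (modelDeriv (cotModel F) 𝓘(ℝ, CotSpace F) (cotChart α) β) := fun X Y hXY => by
  rw [← modelDeriv_symm_modelDeriv h X, hXY, modelDeriv_symm_modelDeriv h]

theorem continuousAt_fderiv_chart (f : SmoothFun F Q) (α : Cotangent F Q) : ContinuousAt
    (fun β => fderiv ℝ (fun z => f ((cotChart α).symm z)) (cotChart α β)) α := by
  have h1 := (contDiffAt_chart f ((cotChart α).map_source (mem_extChartAt_source α))).fderiv_right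
    (m := 0) (by simp)
  exact ContinuousAt.comp (g := fderiv ℝ (fun z => f ((cotChart α).symm z))) h1.continuousAt
    (continuousAt_extChartAt α)

theorem eventually_linearIndependent {k : ℕ} {f : Fin k → SmoothFun F Q} {α : Cotangent F Q}
    (h : LinearIndependent ℝ fun i => diffl (f i) α) :
    ∀ᶠ β in 𝓝 α, LinearIndependent ℝ fun i => diffl (f i) β := by
  set D : Cotangent F Q → Fin k → CotSpace F →L[ℝ] ℝ := fun β i =>
    fderiv ℝ (fun z => f i ((cotChart α).symm z)) (cotChart α β)
  have hD : ContinuousAt D α := continuousAt_pi.2 fun i => continuousAt_fderiv_chart (f i) α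
  have h1 : ∀ β ∈ (cotChart α).source,
      (LinearIndependent ℝ fun i => diffl (f i) β) ↔ LinearIndependent ℝ (D β) := fun β hβ =>
    linearIndependent_comp_iff (modelDeriv_chart_surjective hβ) fun i => diffl_chart (f i) hβ
  have h2 := hD.eventually (isOpen_setOfPred_linearIndependent.mem_nhds
    ((h1 α (mem_extChartAt_source α)).1 h))
  filter_upwards [h2, extChartAt_source_mem_nhds (I := cotModel F) α] with β hβ hβ'
  exact (h1 β hβ').2 hβ

theorem exists_independent (A : Submodule ℝ (SmoothFun F Q)) (α : Cotangent F Q) :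
    ∃ f : Fin (Module.finrank ℝ (dSpace A α)) → SmoothFun F Q, (∀ i, f i ∈ A) ∧
      ∀ᶠ β in 𝓝 α, LinearIndependent ℝ fun i => diffl (f i) β := by
  obtain ⟨b, hb, hbS⟩ := exists_linearIndependent_mem (dSpace A α)
  have h1 : ∀ i, ∃ f ∈ A, diffl f α = b i := hbS
  choose f hf hfb using h1
  refine ⟨f, hf, eventually_linearIndependent ?_⟩
  simp only [hfb]
  exact hb

theorem span_eq_dSpace {k : ℕ} {f : Fin k → SmoothFun F Q} (hf : ∀ i, f i ∈ A)
    {β : Cotangent F Q} (h : LinearIndependent ℝ fun i => diffl (f i) β)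
    (hk : Module.finrank ℝ (dSpace A β) ≤ k) :
    Submodule.span ℝ (range fun i => diffl (f i) β) = dSpace A β := by
  refine Submodule.eq_of_le_of_finrank_le (Submodule.span_le.2 ?_) ?_
  · rintro _ ⟨i, rfl⟩
    exact diffl_mem_dSpace (hf i) β
  · rw [finrank_span_eq_card h, Fintype.card_fin]
    exact hk

theorem eventually_finrank_dSpace_le (A : Submodule ℝ (SmoothFun F Q)) (α : Cotangent F Q) :
    ∀ᶠ β in 𝓝 α, Module.finrank ℝ (dSpace A α) ≤ Module.finrank ℝ (dSpace A β) := by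
  obtain ⟨f, hf, h⟩ := exists_independent A α
  filter_upwards [h] with β hβ
  have h1 := finrank_span_eq_card hβ
  rw [Fintype.card_fin] at h1
  rw [← h1]
  refine Submodule.finrank_mono (Submodule.span_le.2 ?_)
  rintro _ ⟨i, rfl⟩
  exact diffl_mem_dSpace (hf i) β

/-- At a point where the rank of the differentials is locally maximal, a vector killed by all of
them is the velocity of a curve along which all functions are constant. -/
theorem exists_curve_of_mem_kSpace {α : Cotangent F Q}
    (hα : ∀ᶠ β in 𝓝 α, Module.finrank ℝ (dSpace A β) ≤ Module.finrank ℝ (dSpace A α))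
    {X : CotSpace F} (hX : X ∈ kSpace A α) :
    ∃ c : ℝ → CotSpace F, c 0 = cotChart α α ∧
      HasDerivAt c (modelDeriv (cotModel F) 𝓘(ℝ, CotSpace F) (cotChart α) α X) 0 ∧
      ∀ᶠ t in 𝓝 (0 : ℝ), c t ∈ (cotChart α).target ∧
        ∀ f ∈ A, f ((cotChart α).symm (c t)) = f α := by
  obtain ⟨f, hf, hind⟩ := exists_independent A α
  set φ := cotChart α
  have hαs : α ∈ φ.source := mem_extChartAt_source α
  have hαt := φ.map_source hαs
  have hsm : ContDiffAt ℝ ∞ (fun z i => f i (φ.symm z)) (φ α) :=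
    contDiffAt_pi.2 fun i => contDiffAt_chart (f i) hαt
  have hd : ∀ i, ∀ z ∈ φ.target, HasFDerivAt (fun z => f i (φ.symm z))
      (fderiv ℝ (fun z => f i (φ.symm z)) z) z := fun i z hz =>
    ((contDiffAt_chart (f i) hz).differentiableAt (by simp)).hasFDerivAt
  have hL := hasFDerivAt_pi.2 fun i => hd i (φ α) hαt
  have hLs := surjective_pi_of_linearIndependent ((linearIndependent_comp_iff
    (modelDeriv_chart_surjective hαs) fun i => diffl_chart (f i) hαs).1 hind.self_of_nhds)
  have hLX : ContinuousLinearMap.pi (fun i => fderiv ℝ (fun z => f i (φ.symm z)) (φ α))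
      (modelDeriv (cotModel F) 𝓘(ℝ, CotSpace F) φ α X) = 0 := by
    funext i
    have h1 := hX (f i) (hf i)
    rw [diffl_chart (f i) hαs] at h1
    exact h1
  obtain ⟨c, hc, hc0, hcd, hcl⟩ := exists_curve_in_level hsm hL hLs hLX
  have hct : Tendsto c (𝓝 0) (𝓝 (φ α)) := by
    have := hc.continuousAt.tendsto
    rwa [hc0] at this
  have hβt : Tendsto (fun t => φ.symm (c t)) (𝓝 0) (𝓝 α) := by
    have h1 := (continuousAt_extChartAt_symm (I := cotModel F) α).tendsto.comp hct
    rwa [extChartAt_to_inv] at h1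
  have hdc : ∀ᶠ t in 𝓝 (0 : ℝ), ContDiffAt ℝ 1 c t :=
    (hc.of_le (by simp)).eventually (by simp)
  have hall := ((hct.eventually (extChartAt_target_mem_nhds (I := cotModel F) α)).and
    ((hβt.eventually (hind.and hα)).and (hdc.and hcl.eventually_nhds)))
  obtain ⟨ε, hε, hall⟩ := Metric.eventually_nhds_iff_ball.1 hall
  refine ⟨c, hc0, hcd, Metric.eventually_nhds_iff_ball.2 ⟨ε, hε, fun t ht => ⟨(hall t ht).1, ?_⟩⟩⟩
  -- Along `c` the differential of any `q` in `A` is a combination of those of the `f i`.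
  intro q hq
  have hderiv : ∀ s ∈ Metric.ball (0 : ℝ) ε, HasDerivAt (fun s => q (φ.symm (c s))) 0 s := by
    intro s hs
    obtain ⟨hst, ⟨hsi, hsr⟩, hsc, hsl⟩ := hall s hs
    have hcs := (hsc.differentiableAt (by simp)).hasDerivAt
    set Y := modelDeriv 𝓘(ℝ, CotSpace F) (cotModel F) φ.symm (c s) (deriv c s)
    have h1 : ∀ i, diffl (f i) (φ.symm (c s)) Y = 0 := by
      intro i
      have h2 := (hd i (c s) hst).comp_hasDerivAt s hcs
      have h3 : ((fun z => f i (φ.symm z)) ∘ c) =ᶠ[𝓝 s] fun _ => f i (φ.symm (φ α)) := by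
        filter_upwards [hsl] with t ht
        rw [← hc0]
        rw [← hc0] at ht
        exact congrFun ht i
      have h4 := h2.unique ((hasDerivAt_const s _).congr_of_eventuallyEq h3)
      rw [fderiv_chart (f i) hst] at h4
      exact h4
    have h5 : diffl q (φ.symm (c s)) Y = 0 := by
      have h6 := diffl_mem_dSpace hq (φ.symm (c s))
      rw [← span_eq_dSpace hf hsi hsr] at h6
      refine Submodule.span_induction (p := fun l _ => l Y = 0) ?_ rfl ?_ ?_ h6
      · rintro _ ⟨i, rfl⟩
        exact h1 i
      · intro a b _ _ ha hb
        rw [add_apply, ha, hb, add_zero]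
      · intro a l _ hl
        change a * l Y = 0
        rw [hl, mul_zero]
    have h7 := ((contDiffAt_chart q hst).differentiableAt (by simp)).hasFDerivAt.comp_hasDerivAt s hcs
    rw [fderiv_chart q hst] at h7
    have h8 : (diffl q (φ.symm (c s))).comp
        (modelDeriv 𝓘(ℝ, CotSpace F) (cotModel F) φ.symm (c s)) (deriv c s) = 0 := h5
    rw [h8] at h7
    exact h7
  have h9 := Metric.isOpen_ball.is_const_of_deriv_eq_zero (convex_ball (0 : ℝ) ε).isPreconnected
    (fun s hs => (hderiv s hs).differentiableAt.differentiableWithinAt)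
    (fun s hs => (hderiv s hs).deriv) ht (Metric.mem_ball_self hε)
  rw [h9, hc0]
  congr 1
  exact φ.left_inv hαs

end Differentials

/-! ### The regular set -/

section Regular

variable {E : Type*} [NormedAddCommGroup E] [NormedSpace ℝ E] [FiniteDimensional ℝ E]
  {G : Type*} [TopologicalSpace G] [Group G] [ChartedSpace E G] [LieGroup 𝓘(ℝ, E) ∞ G] [T2Space G]
  {H : Subgroup G}
  {F : Type*} [NormedAddCommGroup F] [NormedSpace ℝ F] [FiniteDimensional ℝ F]
  [ChartedSpace F (G ⧸ H)] [IsManifold 𝓘(ℝ, F) ∞ (G ⧸ H)]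
  [ContMDiffSMul 𝓘(ℝ, E) 𝓘(ℝ, F) ∞ G (G ⧸ H)] [T2Space (G ⧸ H)]
  {B : Metric E G}

/-- The velocity of a curve contained in an orbit is tangent to the orbit. -/
theorem exists_cotOrbit_of_curve [CompactSpace G] [T2Space (Cotangent F (G ⧸ H))]
    (hQ : IsQuotientStructure E H F) (hB : IsBiinvariant B) {α : Cotangent F (G ⧸ H)}
    {c : ℝ → CotSpace F} {X : CotSpace F} (hc0 : c 0 = cotChart α α) (hc : HasDerivAt c X 0)
    (h : ∀ᶠ t in 𝓝 (0 : ℝ), c t ∈ (cotChart α).target ∧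
      ∃ g : G, cotAct g α = (cotChart α).symm (c t)) :
    ∃ ξ : E, modelDeriv (cotModel F) 𝓘(ℝ, CotSpace F) (cotChart α) α (cotOrbit G α ξ) = X := by
  set φ := cotChart α
  have hαs : α ∈ φ.source := mem_extChartAt_source α
  -- A complement `S` of the stabilizer algebra parametrizes the orbit near `α` by an immersion.
  obtain ⟨S, hS⟩ := Submodule.exists_isCompl (stab (E := E) G α)
  obtain ⟨ψ₁, h₁⟩ := exists_isSubspaceParam (G := G) S
  obtain ⟨ψ₂, h₂⟩ := exists_isSubspaceParam (G := G) (⊥ : Submodule ℝ E)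
  have hd := HasModelDerivAt.comp (f := fun g : G => cotAct g α)
    (g := fun p : S × (⊥ : Submodule ℝ E) => ψ₁ p.1 * ψ₂ p.2) (x := 0)
    (hasModelDerivAt_cotOrbit (E := E) α) (by
      rw [Prod.fst_zero, Prod.snd_zero, h₁.zero, h₂.zero, mul_one]) (h₁.mul_deriv h₂)
  have hA0 : cotAct (ψ₁ (0 : S × (⊥ : Submodule ℝ E)).1 * ψ₂ (0 : S × (⊥ : Submodule ℝ E)).2) α =
      α := by
    rw [Prod.fst_zero, Prod.snd_zero, h₁.zero, h₂.zero, mul_one, cotAct_one]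
  have hA := HasModelDerivAt.comp (f := φ)
    (g := fun p : S × (⊥ : Submodule ℝ E) => cotAct (ψ₁ p.1 * ψ₂ p.2) α) (x := 0)
    (hasModelDerivAt_extChartAt (I := cotModel F) hαs) hA0 hd
  have hAs : ContDiffAt ℝ ∞
      (fun p : S × (⊥ : Submodule ℝ E) => φ (cotAct (ψ₁ p.1 * ψ₂ p.2) α)) 0 := by
    have h1 : ContMDiffAt 𝓘(ℝ, S × (⊥ : Submodule ℝ E)) (cotModel F) ∞
      (fun p : S × (⊥ : Submodule ℝ E) => cotAct (ψ₁ p.1 * ψ₂ p.2) α) 0 :=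
      ((contMDiff_cotAct_right (E := E) α).comp (h₁.mul_contMDiff h₂)).contMDiffAt
    have h2 : ContMDiffAt (cotModel F) 𝓘(ℝ, CotSpace F) ∞ φ
        (cotAct (ψ₁ (0 : S × (⊥ : Submodule ℝ E)).1 * ψ₂ (0 : S × (⊥ : Submodule ℝ E)).2) α) := by
      rw [hA0]
      exact contMDiffAt_extChartAt' (by
        rw [← extChartAt_source (cotModel F)]; exact hαs)
    exact (ContMDiffAt.comp (0 : S × (⊥ : Submodule ℝ E)) h2 h1).contDiffAt
  have hi : Function.Injective ((modelDeriv (cotModel F) 𝓘(ℝ, CotSpace F) φ α).comp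
      ((cotOrbit G α).comp (S.subtypeL.coprod (⊥ : Submodule ℝ E).subtypeL))) := by
    refine (injective_iff_map_eq_zero _).2 ?_
    rintro ⟨⟨s, hs⟩, ⟨t, ht⟩⟩ h0
    obtain rfl := (Submodule.mem_bot ℝ).1 ht
    have h3 := modelDeriv_chart_injective hαs (h0.trans (map_zero _).symm)
    have h4 : cotOrbit G α (s + 0) = 0 := h3
    rw [add_zero] at h4
    obtain rfl := (Submodule.disjoint_def.1 hS.disjoint) s h4 hs
    rfl
  have hT : S ⊔ ⊥ ⊔ stab (E := E) G α = ⊤ := by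
    rw [sup_bot_eq, sup_comm, hS.sup_eq_top]
  obtain ⟨y, hy⟩ := mem_range_of_curve hAs (hasModelDerivAt_iff.1 hA) hi
    (hc0.trans (congrArg φ hA0.symm)) hc (by
      intro N hN
      have h5 := eventually_exists_factorization (α := α) hT
        (fun ξ hξ t => cotAct_oneParam_of_mem_stab hQ hB hξ t) h₁ h₂ hN
      have h6 : Tendsto (fun t => φ.symm (c t)) (𝓝 0) (𝓝 α) := by
        have h7 := hc.continuousAt.tendsto
        rw [hc0] at h7
        have h8 := (continuousAt_extChartAt_symm (I := cotModel F) α).tendsto.comp h7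
        rwa [extChartAt_to_inv] at h8
      filter_upwards [h, h6.eventually h5] with t ⟨ht, g, hg⟩ ht'
      obtain ⟨p, hp, hpt⟩ := ht' g hg
      exact ⟨p, hp, by rw [hpt, φ.right_inv ht]⟩)
  exact ⟨_, hy⟩

variable (B) in
/-- The points of `T*(G ⧸ H)` whose moment, transported to the base point, is generic. -/
def IsGenPt (α : Cotangent F (G ⧸ H)) : Prop :=
  ∃ g : G, g • base H = α.1 ∧ IsGen H F B (momentVec B (cotAct g⁻¹ α))

theorem IsGenPt.cotAct {α : Cotangent F (G ⧸ H)} (h : IsGenPt B α) (g : G) :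
    IsGenPt B (cotAct g α) := by
  obtain ⟨k, hk, hgen⟩ := h
  refine ⟨g * k, by rw [mul_smul, hk, cotAct_fst], ?_⟩
  rwa [mul_inv_rev, cotAct_mul (E := E), cotAct_inv_cotAct (E := E)]

theorem IsGenPt.eventually (hQ : IsQuotientStructure E H F) {α : Cotangent F (G ⧸ H)}
    (h : IsGenPt B α) : ∀ᶠ β in 𝓝 α, IsGenPt B β := by
  obtain ⟨g, hg, hgen⟩ := h
  obtain ⟨σ, h1, h2, h3⟩ := hQ.exists_section_smul g
  rw [hg] at h1 h2 h3
  have hp : ContinuousAt (fun β : Cotangent F (G ⧸ H) => β.1) α :=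
    (Bundle.contMDiffAt_proj (n := ∞) (IB := 𝓘(ℝ, F)) (F := F →L[ℝ] ℝ)
      (fun q : G ⧸ H => TangentSpace 𝓘(ℝ, F) q →L[ℝ] Trivial (G ⧸ H) ℝ q)).continuousAt
  have h4 : ContinuousAt (fun β : Cotangent F (G ⧸ H) =>
      momentVec B (NormalMetric.cotAct (σ β.1)⁻¹ β)) α :=
    ((contMDiff_momentVec (B := B)).contMDiffAt.comp α (contMDiffAt_cotAct_section h1)).continuousAt
  have h5 : IsGen H F B (momentVec B (NormalMetric.cotAct (σ α.1)⁻¹ α)) := by rw [h2]; exact hgen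
  filter_upwards [h4.eventually h5.eventually, hp.eventually h3] with β hβ hβ'
  exact ⟨σ β.1, hβ', hβ (exists_eq_cotAct_lift hQ β hβ').1⟩

theorem exists_isGenPt (hQ : IsQuotientStructure E H F)
    {α : Cotangent F (G ⧸ H)} {O : Set (Cotangent F (G ⧸ H))} (hO : O ∈ 𝓝 α) :
    ∃ β ∈ O, IsGenPt B β := by
  obtain ⟨g, hg⟩ := exists_smul_base α.1
  obtain ⟨h1, h2⟩ := exists_eq_cotAct_lift (B := B) hQ α hg
  have h3 : Continuous fun u => cotAct g (lift hQ B u) :=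
    (contMDiff_cotAct_left (E := E) g).continuous.comp (contMDiff_lift hQ).continuous
  have h4 : (fun u => cotAct g (lift hQ B u)) ⁻¹' O ∈ 𝓝 (momentVec B (cotAct g⁻¹ α)) :=
    h3.continuousAt (by rw [h2]; exact hO)
  obtain ⟨u, hu, hgen⟩ := dense_isGen h1 h4
  exact ⟨_, hu, g, rfl, by rwa [cotAct_inv_cotAct (E := E), momentVec_lift hQ hgen.1]⟩

/-- At generic points, the dimensions of the stabilizer and of the centralizer of the moment are
those of a generic element. -/
theorem IsGenPt.finrank_eq (hQ : IsQuotientStructure E H F) (hB : IsBiinvariant B)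
    {α : Cotangent F (G ⧸ H)} (h : IsGenPt B α) {v : E} (hv : IsGen H F B v) :
    Module.finrank ℝ (cent G (momentVec B α)) = Module.finrank ℝ (cent G v) ∧
    Module.finrank ℝ (stab (E := E) G α) = Module.finrank ℝ ↥(cent G v ⊓ iso H F) := by
  obtain ⟨g, hg, hgen⟩ := h
  obtain ⟨h1, h2⟩ := exists_eq_cotAct_lift (B := B) hQ α hg
  set u := momentVec B (NormalMetric.cotAct g⁻¹ α)
  have h3 := hgen.2 v hv.1
  have h4 := hv.2 u hgen.1
  rw [← h2, hB.momentVec_cotAct, momentVec_lift hQ h1, ← map_Ad_cent, finrank_map_Ad,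
    ← map_Ad_stab, finrank_map_Ad, stab_lift hQ hB h1]
  exact ⟨le_antisymm h3.1 h4.1, le_antisymm h3.2 h4.2⟩

theorem finrank_range_cotOrbit (α : Cotangent F (G ⧸ H)) :
    Module.finrank ℝ (LinearMap.range (cotOrbit (E := E) G α).toLinearMap) +
      Module.finrank ℝ (stab (E := E) G α) = Module.finrank ℝ E :=
  LinearMap.finrank_range_add_finrank_ker _

theorem range_cotOrbit_le (α : Cotangent F (G ⧸ H)) :
    LinearMap.range (cotOrbit (E := E) G α).toLinearMap ≤
      kSpace (invariantAlgebra G F (G ⧸ H)) α := by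
  rintro _ ⟨ξ, rfl⟩ f hf
  exact diffl_invariant hf α ξ

variable (B) in
/-- The regular points: the generic points where the differentials of the invariant functions
determine the tangent space of the orbit. -/
def IsRegPt (α : Cotangent F (G ⧸ H)) : Prop :=
  IsGenPt B α ∧ kSpace (invariantAlgebra G F (G ⧸ H)) α =
    LinearMap.range (cotOrbit (E := E) G α).toLinearMap

theorem IsRegPt.cotAct {α : Cotangent F (G ⧸ H)} (h : IsRegPt B α) (g : G) :
    IsRegPt B (cotAct g α) := by
  refine ⟨h.1.cotAct g, le_antisymm ?_ (range_cotOrbit_le _)⟩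
  intro Y hY
  obtain ⟨X, rfl⟩ := cotActDeriv_surjective (E := E) g α Y
  have h1 : X ∈ kSpace (invariantAlgebra G F (G ⧸ H)) α := fun f hf => by
    rw [← diffl_cotAct (E := E) hf g α]
    exact hY f hf
  rw [h.2] at h1
  obtain ⟨ξ, rfl⟩ := h1
  exact ⟨Ad g ξ, cotOrbit_cotAct g α ξ⟩

/-- On generic points the dimension of the orbits is constant, while the rank of the differentials
of the invariant functions is lower semicontinuous. -/
theorem isOpen_isRegPt (hQ : IsQuotientStructure E H F) (hB : IsBiinvariant B) :
    IsOpen {α : Cotangent F (G ⧸ H) | IsRegPt B α} := by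
  refine isOpen_iff_mem_nhds.2 fun α hα => ?_
  filter_upwards [hα.1.eventually hQ,
    eventually_finrank_dSpace_le (invariantAlgebra G F (G ⧸ H)) α] with β hβ hβ'
  refine ⟨hβ, (Submodule.eq_of_le_of_finrank_le (range_cotOrbit_le β) ?_).symm⟩
  obtain ⟨v, hv⟩ := exists_isGen (E := E) (H := H) (F := F) (B := B)
  have h1 := (hα.1.finrank_eq hQ hB hv).2
  have h2 := (hβ.finrank_eq hQ hB hv).2
  have h3 := finrank_range_cotOrbit (E := E) α
  have h4 := finrank_range_cotOrbit (E := E) β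
  have h5 := finrank_dSpace_add (invariantAlgebra G F (G ⧸ H)) α
  have h6 := finrank_dSpace_add (invariantAlgebra G F (G ⧸ H)) β
  have h7 := congrArg (fun S : Submodule ℝ (CotSpace F) => Module.finrank ℝ S) hα.2
  omega

/-- Regular points are dense. At a generic point where the rank of the differentials of the
invariant functions is locally maximal, a vector killed by these differentials is the velocity of a
curve along which the invariant functions are constant. Since they separate orbits, the curve lies
in an orbit. -/
theorem dense_isRegPt [CompactSpace G] [T2Space (Cotangent F (G ⧸ H))]
    (hH : IsClosed (H : Set G)) (hQ : IsQuotientStructure E H F)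
    (hB : IsBiinvariant B) : Dense {α : Cotangent F (G ⧸ H) | IsRegPt B α} := by
  refine dense_iff_inter_open.2 ?_
  rintro O hO ⟨α₀, hα₀⟩
  set A := invariantAlgebra G F (G ⧸ H)
  obtain ⟨α₁, hα₁, hgen⟩ := exists_isGenPt hQ (hO.mem_nhds hα₀)
  -- The point `α` maximizes the rank of the differentials on the generic points in `O`.
  set W : Set (Cotangent F (G ⧸ H)) := {β | β ∈ O ∧ IsGenPt B β}
  have hW : ∀ β ∈ W, W ∈ 𝓝 β := fun β hβ => by
    filter_upwards [hO.mem_nhds hβ.1, hβ.2.eventually hQ] with γ h1 h2 using ⟨h1, h2⟩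
  have hfin : ((fun β => Module.finrank ℝ (dSpace A β)) '' W).Finite :=
    (finite_Iic (Module.finrank ℝ (CotSpace F →L[ℝ] ℝ))).subset (by
      rintro _ ⟨u, -, rfl⟩
      exact Submodule.finrank_le _)
  obtain ⟨_, ⟨α, hα, rfl⟩, hmax⟩ := hfin.exists_maximal ⟨_, α₁, ⟨hα₁, hgen⟩, rfl⟩
  have hmax' : ∀ᶠ β in 𝓝 α, Module.finrank ℝ (dSpace A β) ≤ Module.finrank ℝ (dSpace A α) := by
    filter_upwards [hW α hα] with β hβ
    by_contra hlt
    exact hlt (hmax ⟨β, hβ, rfl⟩ (le_of_lt (not_le.1 hlt)))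
  refine ⟨α, hα.1, hα.2, le_antisymm (fun X hX => ?_) (range_cotOrbit_le α)⟩
  obtain ⟨c, hc0, hc, hcl⟩ := exists_curve_of_mem_kSpace hmax' hX
  obtain ⟨ξ, hξ⟩ := exists_cotOrbit_of_curve hQ hB hc0 hc (hcl.mono fun t ht =>
    ⟨ht.1, exists_cotAct_eq hH hQ hB fun f hf => (ht.2 f hf).symm⟩)
  exact ⟨ξ, modelDeriv_chart_injective (mem_extChartAt_source α) hξ⟩

end Regular

/-! ### Differential dimension and index -/

section Rank

variable {F : Type*} [NormedAddCommGroup F] [NormedSpace ℝ F] [FiniteDimensional ℝ F]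
  {Q : Type*} [TopologicalSpace Q] [ChartedSpace F Q] [IsManifold 𝓘(ℝ, F) ∞ Q]
  {A : Submodule ℝ (SmoothFun F Q)}

/-- If the Hamiltonian fields of the functions in `A` span a coisotropic subspace, that is, if the
common kernel of the differentials consists of such fields, then the dimension of this kernel is the
corank of the matrix of Poisson brackets. -/
theorem rank_poissonBracket {l : ℕ} {f : Fin l → SmoothFun F Q} (hf : ∀ i, f i ∈ A)
    {β : Cotangent F Q} (hind : LinearIndependent ℝ fun i => diffl (f i) β)
    (hspan : Submodule.span ℝ (range fun i => diffl (f i) β) = dSpace A β)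
    (hk : ∀ X ∈ kSpace A β, ∃ q ∈ A, hamField q β = X) :
    (Matrix.of fun i j => poissonBracket (f i) (f j) β).rank + Module.finrank ℝ (kSpace A β) =
      l := by
  set τ : (Fin l → ℝ) →ₗ[ℝ] CotSpace F := Fintype.linearCombination ℝ fun j => hamField (f j) β
  have hτ : ∀ c, τ c = ∑ j, c j • hamField (f j) β := fun c => rfl
  have hsτ : ∀ c Y, sympl β (τ c) Y = -∑ j, c j * diffl (f j) β Y := by
    intro c Y
    rw [sympl_skew, hτ, map_sum]
    congr 1
    refine Finset.sum_congr rfl fun j _ => ?_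
    rw [map_smul, sympl_skew, sympl_hamField, neg_apply, neg_neg, smul_eq_mul]
  have hinj : LinearMap.ker τ = ⊥ := by
    refine (Submodule.eq_bot_iff _).2 fun c hc => funext fun i => ?_
    refine linearIndependent_functionals_iff.1 hind c (fun X => ?_) i
    have h1 := hsτ c X
    rw [LinearMap.mem_ker.1 hc, map_zero, zero_apply] at h1
    linarith
  set M : Matrix (Fin l) (Fin l) ℝ := Matrix.of fun i j => poissonBracket (f i) (f j) β
  have hM : ∀ c i, M.mulVecLin c i = diffl (f i) β (τ c) := by
    intro c i
    have h1 : diffl (f i) β (τ c) = ∑ j, c j * diffl (f i) β (hamField (f j) β) := by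
      rw [hτ, map_sum]
      exact Finset.sum_congr rfl fun j _ => map_smul _ _ _
    rw [h1]
    change ∑ j, diffl (f i) β (hamField (f j) β) * c j = _
    exact Finset.sum_congr rfl fun j _ => mul_comm (diffl (f i) β (hamField (f j) β)) (c j)
  have hker : (LinearMap.ker M.mulVecLin).map τ = kSpace A β := by
    apply le_antisymm
    · rintro _ ⟨c, hc, rfl⟩ q hq
      have h1 := diffl_mem_dSpace hq β
      rw [← hspan] at h1
      refine Submodule.span_induction (p := fun l _ => l (τ c) = 0) ?_ rfl ?_ ?_ h1
      · rintro _ ⟨i, rfl⟩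
        rw [← hM, LinearMap.mem_ker.1 hc]
        rfl
      · intro a b _ _ ha hb
        rw [add_apply, ha, hb, add_zero]
      · intro a l _ hl
        change a * l (τ c) = 0
        rw [hl, mul_zero]
    · intro X hX
      obtain ⟨q, hq, rfl⟩ := hk X hX
      have h1 := diffl_mem_dSpace hq β
      rw [← hspan, Submodule.mem_span_range_iff_exists_fun] at h1
      obtain ⟨c, hc⟩ := h1
      have h2 : hamField q β = τ c := hamField_unique fun Y => by
        rw [hsτ, ← hc, sum_apply]
        rfl
      refine ⟨c, ?_, h2.symm⟩
      refine LinearMap.mem_ker.2 (funext fun i => ?_)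
      rw [hM, ← h2]
      exact hX (f i) (hf i)
  have h1 : Module.finrank ℝ (kSpace A β) = Module.finrank ℝ (LinearMap.ker M.mulVecLin) := by
    rw [← hker]
    exact (LinearEquiv.finrank_eq (Submodule.equivMapOfInjective τ
      (LinearMap.ker_eq_bot.1 hinj) _)).symm
  have h2 := LinearMap.finrank_range_add_finrank_ker M.mulVecLin
  rw [Module.finrank_fin_fun] at h2
  rw [h1]
  exact h2

end Rank

section Index

variable {E : Type*} [NormedAddCommGroup E] [NormedSpace ℝ E] [FiniteDimensional ℝ E]
  {G : Type*} [TopologicalSpace G] [Group G] [ChartedSpace E G] [LieGroup 𝓘(ℝ, E) ∞ G] [T2Space G]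
  {H : Subgroup G}
  {F : Type*} [NormedAddCommGroup F] [NormedSpace ℝ F] [FiniteDimensional ℝ F]
  [ChartedSpace F (G ⧸ H)] [IsManifold 𝓘(ℝ, F) ∞ (G ⧸ H)]
  [ContMDiffSMul 𝓘(ℝ, E) 𝓘(ℝ, F) ∞ G (G ⧸ H)] [T2Space (G ⧸ H)]
  {B : Metric E G}

variable (E G H F) in
/-- The algebra `F₁ + F₂`. -/
abbrev integrals : Submodule ℝ (SmoothFun F (G ⧸ H)) :=
  pullbackAlgebra E G F (G ⧸ H) ⊔ invariantAlgebra G F (G ⧸ H)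

theorem momentFun_mem (ξ : E) : momentFun G F (G ⧸ H) ξ ∈ pullbackAlgebra E G F (G ⧸ H) :=
  mem_pullbackAlgebra_iff.2
    ⟨fun μ => μ ξ, (ContinuousLinearMap.apply ℝ ℝ ξ).contDiff, fun _ => rfl⟩

/-- At a regular point, the common kernel of the differentials of all integrals is tangent to the
orbit of the centralizer of the moment. -/
theorem IsRegPt.kSpace_eq (hB : IsBiinvariant B) {α : Cotangent F (G ⧸ H)} (h : IsRegPt B α) :
    kSpace (integrals E G H F) α =
      (cent G (momentVec B α)).map (cotOrbit (E := E) G α).toLinearMap := by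
  have hbr : ∀ ξ ζ : E, momentDeriv (E := E) G α (cotOrbit G α ξ) ζ =
      inn B ζ (lieBr G ξ (momentVec B α)) := fun ξ ζ => by
    rw [momentDeriv_cotOrbit, ← inn_momentVec (B := B), inn_symm, hB.inn_lieBr, neg_neg]
  apply le_antisymm
  · intro X hX
    have h1 : X ∈ kSpace (invariantAlgebra G F (G ⧸ H)) α := fun f hf =>
      hX f (Submodule.mem_sup_right hf)
    rw [h.2] at h1
    obtain ⟨ξ, rfl⟩ := h1
    refine ⟨ξ, ?_, rfl⟩
    rw [SetLike.mem_coe, mem_cent]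
    refine eq_zero_of_inn (B := B) fun ζ => ?_
    have h2 := hX _ (Submodule.mem_sup_left (momentFun_mem ζ))
    rw [diffl_momentFun] at h2
    rw [inn_symm, ← hbr]
    exact h2
  · rintro _ ⟨ξ, hξ, rfl⟩ f hf
    obtain ⟨f₁, hf₁, f₂, hf₂, rfl⟩ := Submodule.mem_sup.1 hf
    obtain ⟨k, hk, hfk⟩ := mem_pullbackAlgebra_iff.1 hf₁
    rw [diffl_add, add_apply, diffl_pullback hk hfk, diffl_momentFun]
    have h1 := diffl_invariant hf₂ α ξ
    have h2 := hbr ξ ((bidual E).symm (fderiv ℝ k (moment G α)))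
    rw [mem_cent.1 hξ, map_zero] at h2
    exact (congrArg₂ (· + ·) h2 h1).trans (add_zero 0)

theorem stab_le_cent (hB : IsBiinvariant B) (α : Cotangent F (G ⧸ H)) :
    stab (E := E) G α ≤ cent G (momentVec B α) := fun _ h => cent_of_mem_stab hB h

theorem IsRegPt.finrank_kSpace (hB : IsBiinvariant B) {α : Cotangent F (G ⧸ H)}
    (h : IsRegPt B α) : Module.finrank ℝ (kSpace (integrals E G H F) α) +
      Module.finrank ℝ (stab (E := E) G α) = Module.finrank ℝ (cent G (momentVec B α)) := by
  rw [h.kSpace_eq hB]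
  have h1 : cent G (momentVec B α) ⊓ stab G α = stab G α := inf_eq_right.2 (stab_le_cent hB α)
  rw [← h1]
  exact finrank_map_add_finrank_inf_ker (cotOrbit (E := E) G α).toLinearMap _

/-- At regular points, the common kernel of the differentials of the integrals is spanned by
Hamiltonian fields of components of the moment map, so that its dimension is both the codimension
of the span of the differentials and the corank of the matrix of Poisson brackets. -/
theorem hasDimIndexOn (hQ : IsQuotientStructure E H F) (hB : IsBiinvariant B) {v : E}
    (hv : IsGen H F B v) {l r : ℕ} (hl : l + r = Module.finrank ℝ (CotSpace F))
    (hr : r + Module.finrank ℝ ↥(cent G v ⊓ iso H F) = Module.finrank ℝ (cent G v)) :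
    HasDimIndexOn (integrals E G H F) {α : Cotangent F (G ⧸ H) | IsRegPt B α} l r := by
  have hdim : ∀ β : Cotangent F (G ⧸ H), IsRegPt B β →
      Module.finrank ℝ (kSpace (integrals E G H F) β) = r ∧
      Module.finrank ℝ (dSpace (integrals E G H F) β) = l := by
    intro β hβ
    have h1 := hβ.finrank_kSpace hB
    have h2 := hβ.1.finrank_eq hQ hB hv
    have h3 := finrank_dSpace_add (integrals E G H F) β
    omega
  intro α hα
  obtain ⟨f, hf, hind⟩ := exists_independent (integrals E G H F) α
  have hl' := (hdim α hα).2
  subst hl'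
  refine ⟨f, hf, ?_⟩
  filter_upwards [hind, (isOpen_isRegPt hQ hB).mem_nhds hα] with β hβ hβr
  have hspan := span_eq_dSpace hf hβ (hdim β hβr).2.le
  refine ⟨hβ, fun g hg => ?_, ?_⟩
  · have h1 := diffl_mem_dSpace hg β
    rw [← hspan] at h1
    exact h1
  · have h1 := rank_poissonBracket hf hβ hspan (fun X hX => by
      rw [hβr.kSpace_eq hB] at hX
      obtain ⟨ξ, -, rfl⟩ := hX
      exact ⟨_, Submodule.mem_sup_left (momentFun_mem ξ), hamField_momentFun ξ β⟩)
    rw [(hdim β hβr).1] at h1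
    exact h1

end Index

/-! ### Lattices and recurrence -/

section Lattice

/-- A discrete subgroup spanning a finite-dimensional space is `ℤⁿ` in suitable coordinates. -/
theorem exists_lattice_coordinates {V : Type*} [NormedAddCommGroup V] [NormedSpace ℝ V]
    [FiniteDimensional ℝ V] (Λ : AddSubgroup V) {N : Set V} (hN : N ∈ 𝓝 (0 : V))
    (hdisc : ∀ s ∈ Λ, s ∈ N → s = 0)
    (hspan : ∀ f : V →ₗ[ℝ] ℝ, (∀ s ∈ Λ, f s = 0) → f = 0) {r : ℕ}
    (hr : Module.finrank ℝ V = r) :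
    ∃ e : (Fin r → ℝ) ≃ₗ[ℝ] V, ∀ x, e x ∈ Λ ↔ ∀ i, ∃ n : ℤ, x i = n := by
  let L : Submodule ℤ V := AddSubgroup.toIntSubmodule Λ
  have hL : ∀ s, s ∈ L ↔ s ∈ Λ := fun s => Iff.rfl
  have hd : DiscreteTopology L := by
    refine discreteTopology_of_isOpen_singleton_zero ?_
    have h1 : ({0} : Set L) = (fun x : L => (x : V)) ⁻¹' interior N := by
      ext x
      rw [mem_singleton_iff, mem_preimage]
      constructor
      · rintro rfl
        exact mem_interior_iff_mem_nhds.2 hN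
      · intro hx
        exact Subtype.ext (hdisc x x.2 (interior_subset hx))
    rw [h1]
    exact isOpen_interior.preimage continuous_subtype_val
  have hz : IsZLattice ℝ L := by
    refine ⟨?_⟩
    by_contra hne
    obtain ⟨f, hf, hfs⟩ := Submodule.exists_dual_map_eq_bot_of_lt_top (lt_top_iff_ne_top.2 hne)
      inferInstance
    exact hf (hspan f fun s hs =>
      (Submodule.eq_bot_iff _).1 hfs _ (Submodule.mem_map_of_mem (Submodule.subset_span hs)))
  have hfree : Module.Free ℤ L := ZLattice.module_free ℝ L
  have hfin : Module.Finite ℤ L := ZLattice.module_finite ℝ L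
  let b := Module.finBasisOfFinrankEq ℤ L ((ZLattice.rank ℝ L).trans hr)
  let b' := b.ofZLatticeBasis ℝ L
  have hspanb : Submodule.span ℤ (range b') = L := b.ofZLatticeBasis_span ℝ
  refine ⟨b'.equivFun.symm, fun x => ?_⟩
  rw [← hL, ← hspanb, b'.mem_span_iff_repr_mem ℤ]
  refine forall_congr' fun i => ?_
  have h2 : b'.repr (b'.equivFun.symm x) i = x i := by
    rw [← b'.equivFun_apply, LinearEquiv.apply_symm_apply]
  rw [h2]
  exact ⟨fun ⟨n, hn⟩ => ⟨n, hn.symm⟩, fun ⟨n, hn⟩ => ⟨n, hn.symm⟩⟩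

/-- Recurrence in compact groups. -/
theorem exists_pow_mem_nhds_one {K : Type*} [TopologicalSpace K] [Group K] [IsTopologicalGroup K]
    [CompactSpace K] (g : K) {N : Set K} (hN : N ∈ 𝓝 (1 : K)) : ∃ n : ℕ, 1 ≤ n ∧ g ^ n ∈ N := by
  obtain ⟨x, hx⟩ := exists_clusterPt_of_compactSpace (map (fun n : ℕ => g ^ n) atTop)
  have h1 : Tendsto (fun p : K × K => p.1⁻¹ * p.2) (𝓝 x ×ˢ 𝓝 x) (𝓝 1) := by
    have h2 : Continuous fun p : K × K => p.1⁻¹ * p.2 := by fun_prop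
    have h3 := h2.tendsto (x, x)
    rwa [inv_mul_cancel, nhds_prod_eq] at h3
  obtain ⟨V, hV, hVN⟩ := mem_prod_same_iff.1 (h1 hN)
  have hfreq : ∃ᶠ n : ℕ in atTop, g ^ n ∈ V := MapClusterPt.frequently hx hV
  obtain ⟨n, -, hn⟩ := frequently_atTop.1 hfreq 0
  obtain ⟨m, hm, hmV⟩ := frequently_atTop.1 hfreq (n + 1)
  refine ⟨m - n, by omega, ?_⟩
  have h4 : (g ^ n)⁻¹ * g ^ m ∈ N := hVN (mk_mem_prod hn hmV)
  rwa [← Nat.sub_add_cancel (show n ≤ m by omega), add_comm, pow_add, inv_mul_cancel_left] at h4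

end Lattice

/-! ### The invariant tori -/

section Torus

variable {E : Type*} [NormedAddCommGroup E] [NormedSpace ℝ E] [FiniteDimensional ℝ E]
  {G : Type*} [TopologicalSpace G] [Group G] [ChartedSpace E G] [LieGroup 𝓘(ℝ, E) ∞ G] [T2Space G]
  {H : Subgroup G}
  {F : Type*} [NormedAddCommGroup F] [NormedSpace ℝ F] [FiniteDimensional ℝ F]
  [ChartedSpace F (G ⧸ H)] [IsManifold 𝓘(ℝ, F) ∞ (G ⧸ H)]
  [ContMDiffSMul 𝓘(ℝ, E) 𝓘(ℝ, F) ∞ G (G ⧸ H)] [T2Space (G ⧸ H)]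
  {B : Metric E G}

/-- The orthogonal complement of a subspace of the Lie algebra. -/
def orthCompl (B : Metric E G) (S : Submodule ℝ E) : Submodule ℝ E where
  carrier := {u | ∀ ξ ∈ S, inn B ξ u = 0}
  add_mem' := fun ha hb ξ hξ => by rw [map_add, ha ξ hξ, hb ξ hξ, add_zero]
  zero_mem' := fun ξ _ => map_zero _
  smul_mem' := fun c a ha ξ hξ => by rw [map_smul, ha ξ hξ, smul_zero]

theorem eq_zero_of_mem_orthCompl {S : Submodule ℝ E} {x : E} (h : x ∈ S)
    (h' : x ∈ orthCompl B S) : x = 0 := eq_zero_of_inn_self (h' x h)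

theorem sup_orthCompl (S : Submodule ℝ E) : orthCompl B S ⊔ S = ⊤ := by
  refine eq_top_iff.2 fun x _ => ?_
  obtain ⟨a, ha, b, hb, rfl⟩ := exists_orthogonal_decomp B S x
  exact Submodule.mem_sup.2 ⟨b, hb, a, ha, add_comm _ _⟩

variable (B) in
/-- The Lie algebra of the invariant torus through `α`: the orthogonal complement of the stabilizer
algebra in the centralizer of the moment. -/
def torusAlg (α : Cotangent F (G ⧸ H)) : Submodule ℝ E :=
  cent G (momentVec B α) ⊓ orthCompl B (stab G α)

theorem torusAlg_sup_stab (hB : IsBiinvariant B) (α : Cotangent F (G ⧸ H)) :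
    torusAlg B α ⊔ stab G α = cent G (momentVec B α) := by
  apply le_antisymm
  · exact sup_le inf_le_left (stab_le_cent hB α)
  · intro x hx
    obtain ⟨a, ha, b, hb, rfl⟩ := exists_orthogonal_decomp B (stab G α) x
    refine Submodule.mem_sup.2 ⟨b, ⟨?_, hb⟩, a, ha, add_comm _ _⟩
    simpa using Submodule.sub_mem _ hx (stab_le_cent hB α ha)

theorem eq_zero_of_mem_torusAlg {α : Cotangent F (G ⧸ H)} {ξ : E} (h : ξ ∈ torusAlg B α)
    (h' : cotOrbit G α ξ = 0) : ξ = 0 := eq_zero_of_mem_orthCompl (mem_stab.2 h') h.2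

theorem finrank_torusAlg (hB : IsBiinvariant B) (α : Cotangent F (G ⧸ H)) :
    Module.finrank ℝ (torusAlg B α) + Module.finrank ℝ (stab (E := E) G α) =
      Module.finrank ℝ (cent G (momentVec B α)) := by
  have h1 := Submodule.finrank_sup_add_finrank_inf_eq (torusAlg B α) (stab G α)
  have h2 : torusAlg B α ⊓ stab G α = ⊥ :=
    (Submodule.eq_bot_iff _).2 fun x hx => eq_zero_of_mem_torusAlg hx.1 hx.2
  rw [torusAlg_sup_stab hB, h2, finrank_bot] at h1
  exact h1.symm

/-- At a generic point, brackets of elements of the centralizer of the moment lie in the stabilizer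
algebra. -/
theorem IsGenPt.lieBr_mem_stab (hQ : IsQuotientStructure E H F) (hB : IsBiinvariant B)
    {α : Cotangent F (G ⧸ H)} (h : IsGenPt B α) {ξ η : E} (hξ : ξ ∈ cent G (momentVec B α))
    (hη : η ∈ cent G (momentVec B α)) : lieBr G ξ η ∈ stab G α := by
  obtain ⟨g, hg, hgen⟩ := h
  obtain ⟨h1, h2⟩ := exists_eq_cotAct_lift (B := B) hQ α hg
  set u := momentVec B (NormalMetric.cotAct g⁻¹ α)
  rw [← h2, hB.momentVec_cotAct, momentVec_lift hQ h1, ← map_Ad_cent] at hξ hη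
  obtain ⟨ξ, hξ, rfl⟩ := hξ
  obtain ⟨η, hη, rfl⟩ := hη
  rw [← h2, ← map_Ad_stab, stab_lift hQ hB h1]
  exact ⟨_, ⟨lieBr_mem_cent hξ hη, hgen.lieBr_mem_iso hB hξ hη⟩, (lieBr_Ad g ξ η).symm⟩

/-- Since `[ξ, η]` and `[ξ, [ξ, η]]` lie in the stabilizer algebra, `|[ξ, η]|² = -⟨η, [ξ, [ξ, η]]⟩`
vanishes. -/
theorem IsGenPt.lieBr_torusAlg (hQ : IsQuotientStructure E H F) (hB : IsBiinvariant B)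
    {α : Cotangent F (G ⧸ H)} (h : IsGenPt B α) {ξ η : E} (hξ : ξ ∈ torusAlg B α)
    (hη : η ∈ torusAlg B α) : lieBr G ξ η = 0 := by
  have h1 := h.lieBr_mem_stab hQ hB hξ.1 hη.1
  have h2 := h.lieBr_mem_stab hQ hB hξ.1 (stab_le_cent hB α h1)
  refine eq_zero_of_inn_self (B := B) ?_
  rw [hB.inn_lieBr, inn_symm, hη.2 _ h2, neg_zero]

/-- The common level set through `α` is the orbit of `α` under the stabilizer of its moment. -/
theorem mem_levelSet_iff [CompactSpace G] (hH : IsClosed (H : Set G))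
    (hQ : IsQuotientStructure E H F) (hB : IsBiinvariant B) {α β : Cotangent F (G ⧸ H)} :
    β ∈ levelSet (integrals E G H F) α ↔
      ∃ g : G, cotAct g α = β ∧ Ad g (momentVec B α) = momentVec B α := by
  constructor
  · intro h
    obtain ⟨g, hg⟩ := exists_cotAct_eq hH hQ hB fun f hf => (h f (Submodule.mem_sup_right hf)).symm
    refine ⟨g, hg, ?_⟩
    have h1 : moment (E := E) G β = moment G α := ContinuousLinearMap.ext fun ξ =>
      h _ (Submodule.mem_sup_left (momentFun_mem ξ))
    rw [← hB.momentVec_cotAct, hg, momentVec, h1, momentVec]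
  · rintro ⟨g, rfl, hg⟩ f hf
    obtain ⟨f₁, hf₁, f₂, hf₂, rfl⟩ := Submodule.mem_sup.1 hf
    obtain ⟨k, -, hfk⟩ := mem_pullbackAlgebra_iff.1 hf₁
    have h1 : moment (E := E) G (cotAct g α) = moment G α :=
      moment_eq_of_momentVec_eq (B := B) (by rw [hB.momentVec_cotAct, hg])
    refine congrArg₂ (· + ·) ?_ ((mem_invariantAlgebra_iff (E := E)).1 hf₂ g α)
    rw [hfk, hfk, h1]

/-- The subgroup of the elements fixing `v` under the adjoint representation. -/
def adStabilizer (v : E) : Subgroup G where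
  carrier := {g | Ad g v = v}
  mul_mem' := fun {a b} ha hb => by
    change Ad (a * b) v = v
    rw [Ad_mul_apply, show Ad b v = v from hb, show Ad a v = v from ha]
  one_mem' := by
    change Ad (1 : G) v = v
    rw [Ad_one]; rfl
  inv_mem' := fun {a} ha => by
    change Ad a⁻¹ v = v
    conv_lhs => rw [← show Ad a v = v from ha]
    exact Ad_inv_Ad a v

theorem IsSubspaceParam.Ad_eq {S : Submodule ℝ E} {ψ : S → G} (h : IsSubspaceParam S ψ) {v : E}
    (hS : S ≤ cent G v) (s : S) : Ad (ψ s) v = v :=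
  h.mem_subgroup (K := adStabilizer v) (fun _ hξ t => Ad_oneParam_of_mem_cent (hS hξ) t) s

/-- Elements near the identity transversal to the centralizer of `v` move `v`. -/
theorem IsSubspaceParam.eventually_Ad_ne {S : Submodule ℝ E} {ψ : S → G}
    (h : IsSubspaceParam S ψ) {v : E} (hS : ∀ ξ ∈ S, ξ ∈ cent G v → ξ = 0) :
    ∀ᶠ y in 𝓝 (0 : S), Ad (ψ y) v = v → y = 0 := by
  have hsm : ContDiff ℝ ∞ fun y : S => Ad (ψ y) v :=
    (((contMDiff_Ad (E := E) (G := G)).comp h.contMDiff).contDiff).clm_apply contDiff_const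
  have hd : ∀ y : S, fderiv ℝ (fun y : S => Ad (ψ y) v) 0 y = lieBr G (y : E) v := by
    intro y
    have hline : HasDerivAt (fun t : ℝ => t • y) y 0 := by
      simpa using (hasDerivAt_id (0 : ℝ)).smul_const y
    have h1 := (NormalMetric.HasDerivAt.hasVelocity hline).comp h.deriv (zero_smul ℝ y)
    have h2 := hasDerivAt_Ad (G := G) (γ := fun t : ℝ => ψ (t • y))
      (by rw [zero_smul, h.zero]) h1 v
    have h3 := (hsm.differentiable (by simp)).differentiableAt (x := (0 : ℝ) • y)
      |>.hasFDerivAt.comp_hasDerivAt (0 : ℝ) hline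
    rw [zero_smul] at h3
    exact h3.unique h2
  have hi : Function.Injective (fderiv ℝ (fun y : S => Ad (ψ y) v) 0) := by
    refine (injective_iff_map_eq_zero _).2 fun y hy => ?_
    rw [hd] at hy
    exact Subtype.ext (hS y y.2 hy)
  obtain ⟨Λ, -, hΛ⟩ := exists_leftInverse_of_injective hsm.contDiffAt
    ((hsm.differentiable (by simp)).differentiableAt.hasFDerivAt) hi
  have h0 := hΛ.self_of_nhds
  filter_upwards [hΛ] with y hy hyv
  rw [← hy, ← h0]
  simp only [hyv, h.zero, Ad_one]
  rfl

section Param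

variable {α : Cotangent F (G ⧸ H)} {ψ : torusAlg (E := E) B α → G}

theorem hasModelDerivAt_torus (hα : IsGenPt B α) (hQ : IsQuotientStructure E H F)
    (hB : IsBiinvariant B) (h : IsSubspaceParam (torusAlg B α) ψ) (s : torusAlg (E := E) B α) :
    HasModelDerivAt 𝓘(ℝ, torusAlg (E := E) B α) (cotModel F) (fun t => cotAct (ψ t) α) s
      ((cotActDeriv (ψ s) α).comp ((cotOrbit G α).comp (torusAlg B α).subtypeL)) := by
  have hhom := h.hom fun ξ hξ η hη => hα.lieBr_torusAlg hQ hB hξ hη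
  have h1 := HasModelDerivAt.comp (f := ψ) (g := fun t => t - s) (x := s) h.deriv (sub_self s)
    (hasModelDerivAt_iff.2 ((hasFDerivAt_id (𝕜 := ℝ) s).sub_const s))
  have h2 := HasModelDerivAt.comp (f := fun g : G => cotAct g α) (g := fun t => ψ (t - s)) (x := s)
    (hasModelDerivAt_cotOrbit (E := E) α) (by rw [sub_self, h.zero]) h1
  have h3 := HasModelDerivAt.comp (f := fun β : Cotangent F (G ⧸ H) => cotAct (ψ s) β)
    (g := fun t => cotAct (ψ (t - s)) α) (x := s)
    (hasModelDerivAt_cotAct (E := E) (ψ s) α) (by rw [sub_self, h.zero, cotAct_one]) h2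
  refine h3.congr (Eventually.of_forall fun t => ?_)
  dsimp only
  rw [← cotAct_mul (E := E), ← hhom, add_sub_cancel]

theorem injective_torus (s : torusAlg (E := E) B α) : Function.Injective
    ((cotActDeriv (ψ s) α).comp ((cotOrbit G α).comp (torusAlg (E := E) B α).subtypeL)) := by
  refine (injective_iff_map_eq_zero _).2 fun x hx => ?_
  exact Subtype.ext (eq_zero_of_mem_torusAlg x.2 ((cotActDeriv_cotOrbit_eq_zero_iff (ψ s) α).1 hx))

/-- On an orbit the symplectic form is the moment of the bracket, which vanishes for the torus
algebra. -/
theorem sympl_torus (hα : IsGenPt B α) (hQ : IsQuotientStructure E H F)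
    (hB : IsBiinvariant B) (s x y : torusAlg (E := E) B α) :
    sympl (cotAct (ψ s) α) (cotActDeriv (ψ s) α (cotOrbit G α (x : E)))
      (cotActDeriv (ψ s) α (cotOrbit G α (y : E))) = 0 := by
  rw [sympl_cotActDeriv (E := E), sympl_cotOrbit, diffl_momentFun, momentDeriv_cotOrbit,
    hα.lieBr_torusAlg hQ hB y.2 x.2, map_zero, neg_zero, neg_zero]

/-- The torus is locally injectively parametrized. -/
theorem eventually_torus_injective (hα : IsGenPt B α) (hQ : IsQuotientStructure E H F)
    (hB : IsBiinvariant B) (h : IsSubspaceParam (torusAlg B α) ψ) :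
    ∀ᶠ s in 𝓝 (0 : torusAlg (E := E) B α), cotAct (ψ s) α = α → s = 0 := by
  set φ := cotChart α
  have hαs : α ∈ φ.source := mem_extChartAt_source α
  have h0 : cotAct (ψ 0) α = α := by rw [h.zero, cotAct_one]
  have h1 := HasModelDerivAt.comp (f := φ) (g := fun t => cotAct (ψ t) α) (x := 0)
    (hasModelDerivAt_extChartAt (I := cotModel F) hαs) h0 (hasModelDerivAt_torus hα hQ hB h 0)
  have h2 : ContMDiffAt (cotModel F) 𝓘(ℝ, CotSpace F) ∞ φ (cotAct (ψ 0) α) := by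
    rw [h0]
    exact contMDiffAt_extChartAt' (by rw [← extChartAt_source (cotModel F)]; exact hαs)
  have h3 : ContMDiffAt 𝓘(ℝ, torusAlg (E := E) B α) (cotModel F) ∞ (fun t => cotAct (ψ t) α) 0 :=
    ((contMDiff_cotAct_right (E := E) α).comp h.contMDiff).contMDiffAt
  have h4 := (ContMDiffAt.comp (0 : torusAlg (E := E) B α) h2 h3).contDiffAt
  obtain ⟨Λ, -, hΛ⟩ := exists_leftInverse_of_injective h4 (hasModelDerivAt_iff.1 h1) (by
    exact (modelDeriv_chart_injective hαs).comp (injective_torus 0))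
  have h5 := hΛ.self_of_nhds
  filter_upwards [hΛ] with s hs hsα
  rw [← hs, ← h5]
  simp only [Function.comp_apply, hsα, h0]

variable [CompactSpace G] [T2Space (Cotangent F (G ⧸ H))]

theorem torus_mem_levelSet (hH : IsClosed (H : Set G))
    (hQ : IsQuotientStructure E H F) (hB : IsBiinvariant B) (h : IsSubspaceParam (torusAlg B α) ψ)
    (s : torusAlg (E := E) B α) : cotAct (ψ s) α ∈ levelSet (integrals E G H F) α :=
  (mem_levelSet_iff hH hQ hB).2 ⟨_, rfl, h.Ad_eq inf_le_left s⟩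

/-- Near `α`, the level set is the torus: a point of the orbit near `α` is `(ψ₁ y * ψ z) • α` with `y`
in the orthogonal complement of the centralizer of the moment, and `y` vanishes on the level set. -/
theorem eventually_mem_torus (hH : IsClosed (H : Set G))
    (hQ : IsQuotientStructure E H F) (hB : IsBiinvariant B) (h : IsSubspaceParam (torusAlg B α) ψ)
    {N : Set (torusAlg (E := E) B α)} (hN : N ∈ 𝓝 0) :
    ∀ᶠ β in 𝓝 α, β ∈ levelSet (integrals E G H F) α → ∃ z ∈ N, cotAct (ψ z) α = β := by
  set v := momentVec B α
  obtain ⟨ψ₁, h₁⟩ := exists_isSubspaceParam (G := G) (orthCompl B (cent G v))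
  have h2 := h₁.eventually_Ad_ne (v := v) fun ξ hξ hξ' => eq_zero_of_mem_orthCompl hξ' hξ
  have hS : orthCompl B (cent G v) ⊔ torusAlg B α ⊔ stab G α = ⊤ := by
    rw [sup_assoc, torusAlg_sup_stab hB, sup_orthCompl]
  have hN' : {p : orthCompl B (cent G v) × torusAlg (E := E) B α |
      (Ad (ψ₁ p.1) v = v → p.1 = 0) ∧ p.2 ∈ N} ∈ 𝓝 0 :=
    (continuous_fst.tendsto (0 : orthCompl B (cent G v) × torusAlg (E := E) B α)).eventually h2
      |>.and ((continuous_snd.tendsto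
        (0 : orthCompl B (cent G v) × torusAlg (E := E) B α)).eventually hN)
  filter_upwards [eventually_exists_factorization (α := α) hS
    (fun ξ hξ t => cotAct_oneParam_of_mem_stab hQ hB hξ t) h₁ h hN'] with β hβ hlev
  obtain ⟨g, hg, hgv⟩ := (mem_levelSet_iff hH hQ hB).1 hlev
  obtain ⟨⟨y, z⟩, ⟨hy, hz⟩, hyz⟩ := hβ g hg
  refine ⟨z, hz, ?_⟩
  have h3 : momentVec B β = v := by rw [← hg, hB.momentVec_cotAct, hgv]
  have h4 : Ad (ψ₁ y) v = v := by
    rw [← hyz, hB.momentVec_cotAct, Ad_mul_apply] at h3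
    change Ad (ψ₁ y) (Ad (ψ z) v) = v at h3
    rwa [h.Ad_eq inf_le_left] at h3
  have h5 : y = 0 := hy h4
  rw [← hyz, h5, h₁.zero, one_mul]

/-- The orbit of `α` under the abelian group generated by the torus algebra is parametrized by a
vector space modulo the lattice of periods. It is compact, connected and relatively open in the
level set, so it is a connected component. -/
theorem exists_torus (hα : IsGenPt B α) (hH : IsClosed (H : Set G))
    (hQ : IsQuotientStructure E H F) (hB : IsBiinvariant B) {r : ℕ}
    (hr : Module.finrank ℝ (torusAlg (E := E) B α) = r) :
    IsIsotropicTorus (connectedComponentIn (levelSet (integrals E G H F) α) α) r := by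
  have : IsTopologicalGroup G := topologicalGroup_of_lieGroup 𝓘(ℝ, E) ∞
  obtain ⟨ψ, h⟩ := exists_isSubspaceParam (G := G) (torusAlg (E := E) B α)
  have hhom := h.hom fun ξ hξ η hη => hα.lieBr_torusAlg hQ hB hξ hη
  have hact : ∀ s t, cotAct (ψ (s + t)) α = cotAct (ψ s) (cotAct (ψ t) α) := fun s t => by
    rw [hhom, cotAct_mul (E := E)]
  have hpow : ∀ (s : torusAlg (E := E) B α) (n : ℕ), ψ (n • s) = ψ s ^ n := by
    intro s n
    induction n with
    | zero => rw [zero_smul, h.zero, pow_zero]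
    | succ n ih => rw [succ_nsmul, hhom, ih, pow_succ]
  have hneg : ∀ s t, cotAct (ψ s) α = cotAct (ψ t) α ↔ cotAct (ψ (s - t)) α = α := by
    intro s t
    have h1 : cotAct (ψ (s - t)) α = cotAct (ψ (-t)) (cotAct (ψ s) α) := by
      rw [← hact, neg_add_eq_sub]
    have h2 : ∀ t, cotAct (ψ (-t)) (cotAct (ψ t) α) = α := fun t => by
      rw [← hact, neg_add_cancel, h.zero, cotAct_one]
    constructor
    · intro h3
      rw [h1, h3, h2]
    · intro h3
      rw [← add_sub_cancel t s, hact, h3]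
  -- The lattice of periods.
  let Λ : AddSubgroup (torusAlg (E := E) B α) :=
    { carrier := {s | cotAct (ψ s) α = α}
      add_mem' := fun {a b} ha hb => by
        change cotAct (ψ (a + b)) α = α
        rw [hact, show cotAct (ψ b) α = α from hb, show cotAct (ψ a) α = α from ha]
      zero_mem' := by
        change cotAct (ψ 0) α = α
        rw [h.zero, cotAct_one]
      neg_mem' := fun {a} ha => by
        change cotAct (ψ (-a)) α = α
        rw [← zero_sub, ← hneg, h.zero, cotAct_one, show cotAct (ψ a) α = α from ha] }
  have hιc : Continuous fun s => cotAct (ψ s) α :=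
    ((contMDiff_cotAct_right (E := E) α).comp h.contMDiff).continuous
  -- The lattice spans. By recurrence, a positive multiple `n • s` of any `s` returns close to `α`, where
  -- the torus is the image of a small neighbourhood of `0`; so `n • s` differs from a period by a small
  -- vector `z`, and a functional vanishing on the periods cannot be nonzero at `s`.
  have hspan : ∀ f : torusAlg (E := E) B α →ₗ[ℝ] ℝ, (∀ s ∈ Λ, f s = 0) → f = 0 := by
    intro f hf
    by_contra hne
    obtain ⟨s, hs⟩ : ∃ s, f s ≠ 0 := by
      by_contra! hz
      exact hne (LinearMap.ext hz)
    have hfc : Continuous f := f.continuous_of_finiteDimensional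
    have hN : {z | |f z| < |f s|} ∈ 𝓝 (0 : torusAlg (E := E) B α) :=
      (isOpen_lt hfc.abs continuous_const).mem_nhds (by
        rw [mem_ofPred_eq, map_zero, abs_zero]; exact abs_pos.2 hs)
    have h1 : Tendsto (fun g : G => cotAct g α) (𝓝 1) (𝓝 α) := by
      have := (contMDiff_cotAct_right (E := E) (G := G) α).continuous.tendsto 1
      rwa [cotAct_one] at this
    obtain ⟨n, hn, hnm⟩ := exists_pow_mem_nhds_one (ψ s)
      (h1.eventually (eventually_mem_torus hH hQ hB h hN))
    rw [mem_ofPred_eq, ← hpow] at hnm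
    obtain ⟨z, hz, hzn⟩ := hnm (torus_mem_levelSet hH hQ hB h _)
    have h2 := hf _ ((hneg _ _).1 hzn.symm)
    rw [map_sub, map_nsmul, sub_eq_zero, nsmul_eq_mul] at h2
    rw [mem_ofPred_eq, ← h2, abs_mul, Nat.abs_cast] at hz
    have h3 : (1 : ℝ) ≤ n := by exact_mod_cast hn
    nlinarith [abs_nonneg (f s)]
  obtain ⟨e, he⟩ := exists_lattice_coordinates Λ (eventually_torus_injective hα hQ hB h)
    (fun s hs hsN => hsN hs) hspan hr
  set e' : (Fin r → ℝ) →L[ℝ] torusAlg (E := E) B α := e.toLinearMap.toContinuousLinearMap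
  have hd : ∀ x, HasModelDerivAt 𝓘(ℝ, Fin r → ℝ) (cotModel F) (fun x => cotAct (ψ (e' x)) α) x
      (((cotActDeriv (ψ (e' x)) α).comp ((cotOrbit G α).comp (torusAlg B α).subtypeL)).comp e') :=
    fun x => HasModelDerivAt.comp (f := fun s => cotAct (ψ s) α) (g := e') (x := x)
      (hasModelDerivAt_torus hα hQ hB h (e' x)) rfl (hasModelDerivAt_iff.2 e'.hasFDerivAt)
  have hper : ∀ x y, cotAct (ψ (e' x)) α = cotAct (ψ (e' y)) α ↔ ∀ i, ∃ n : ℤ, x i - y i = n := by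
    intro x y
    rw [hneg, ← map_sub]
    exact he (x - y)
  set R := range fun x => cotAct (ψ (e' x)) α
  have hRm : ∀ s, cotAct (ψ s) α ∈ R := fun s => ⟨e.symm s, by
    dsimp only
    rw [show e' (e.symm s) = s from e.apply_symm_apply s]⟩
  have hαR : α ∈ R := by
    have := hRm 0
    rwa [h.zero, cotAct_one] at this
  have hRl : R ⊆ levelSet (integrals E G H F) α := by
    rintro _ ⟨x, rfl⟩
    exact torus_mem_levelSet hH hQ hB h _
  have hRc : IsCompact R := by
    have h1 : R = (fun x => cotAct (ψ (e' x)) α) '' Icc 0 1 := by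
      refine Subset.antisymm ?_ (image_subset_range _ _)
      rintro _ ⟨x, rfl⟩
      refine ⟨fun i => Int.fract (x i), ⟨fun i => Int.fract_nonneg _,
        fun i => (Int.fract_lt_one _).le⟩, (hper _ _).2 fun i => ⟨-⌊x i⌋, ?_⟩⟩
      rw [Int.cast_neg, ← Int.self_sub_floor]
      ring
    rw [h1]
    exact isCompact_Icc.image (hιc.comp e'.continuous)
  -- The torus is relatively open in the level set, being homogeneous.
  obtain ⟨O, hOW, hO, hαO⟩ := mem_nhds_iff.1 (eventually_mem_torus hH hQ hB h univ_mem)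
  set O' : Set (Cotangent F (G ⧸ H)) := ⋃ s, (fun β => cotAct (ψ s) β) ⁻¹' O
  have hO' : IsOpen O' := isOpen_iUnion fun s =>
    hO.preimage (contMDiff_cotAct_left (E := E) (ψ s)).continuous
  have hO'R : ∀ β ∈ O', β ∈ levelSet (integrals E G H F) α → β ∈ R := by
    intro β hβ hlev
    obtain ⟨s, hs⟩ := mem_iUnion.1 hβ
    obtain ⟨g, hg, hgv⟩ := (mem_levelSet_iff hH hQ hB).1 hlev
    obtain ⟨z, -, hz⟩ := hOW hs ((mem_levelSet_iff hH hQ hB).2 ⟨ψ s * g, by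
      rw [cotAct_mul (E := E), hg], by rw [Ad_mul_apply, hgv, h.Ad_eq inf_le_left]⟩)
    have h1 : β = cotAct (ψ (-s + z)) α := by
      rw [hact, hz, ← cotAct_mul (E := E), ← hhom, neg_add_cancel, h.zero, cotAct_one]
    rw [h1]
    exact hRm _
  have hRO' : R ⊆ O' := by
    rintro _ ⟨x, rfl⟩
    refine mem_iUnion.2 ⟨-e' x, ?_⟩
    rw [mem_preimage, ← hact, neg_add_cancel, h.zero, cotAct_one]
    exact hαO
  have hN : R = connectedComponentIn (levelSet (integrals E G H F) α) α := by
    apply Subset.antisymm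
    · have h1 : IsPreconnected R := isPreconnected_range (hιc.comp e'.continuous)
      exact h1.subset_connectedComponentIn hαR hRl
    · intro β hβ
      by_contra hβR
      have hαN : α ∈ connectedComponentIn (levelSet (integrals E G H F) α) α :=
        mem_connectedComponentIn (hRl hαR)
      obtain ⟨γ, hγ, hγO, hγR⟩ := isPreconnected_connectedComponentIn O' Rᶜ hO'
        hRc.isClosed.isOpen_compl (fun γ _ => (em (γ ∈ R)).imp (fun h => hRO' h) id)
        ⟨α, hαN, hRO' hαR⟩ ⟨β, hβ, hβR⟩
      exact hγR (hO'R γ hγO (connectedComponentIn_subset _ _ hγ))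
  refine ⟨fun x => cotAct (ψ (e' x)) α, ?_, hper, hN, fun x => ?_, fun x u w => ?_⟩
  · exact ((contMDiff_cotAct_right (E := E) α).comp h.contMDiff).comp e'.contDiff.contMDiff
  · change Function.Injective (modelDeriv 𝓘(ℝ, Fin r → ℝ) (cotModel F)
      (fun x => cotAct (ψ (e' x)) α) x)
    rw [(hd x).modelDeriv_eq]
    exact (injective_torus (e' x)).comp e.injective
  · change sympl (cotAct (ψ (e' x)) α)
      (modelDeriv 𝓘(ℝ, Fin r → ℝ) (cotModel F) (fun x => cotAct (ψ (e' x)) α) x u)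
      (modelDeriv 𝓘(ℝ, Fin r → ℝ) (cotModel F) (fun x => cotAct (ψ (e' x)) α) x w) = 0
    rw [(hd x).modelDeriv_eq]
    exact sympl_torus hα hQ hB (e' x) (e' u) (e' w)

end Param

/-- A trajectory is connected and stays in its level set. -/
theorem isFlowInvariant_connectedComponentIn {A : Submodule ℝ (SmoothFun F (G ⧸ H))}
    {Ham : Cotangent F (G ⧸ H) → ℝ} (hA : ∀ f ∈ A, IsFirstIntegral Ham f)
    (α : Cotangent F (G ⧸ H)) :
    IsFlowInvariant Ham (connectedComponentIn (levelSet A α) α) := by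
  intro γ a b hγ s hs hsN t ht
  have h1 : γ '' Ioo a b ⊆ levelSet A α := by
    rintro _ ⟨x, hx, rfl⟩ f hf
    rw [hA f hf γ a b hγ x hx s hs]
    exact connectedComponentIn_subset _ _ hsN f hf
  have h2 : IsPreconnected (γ '' Ioo a b) := isPreconnected_Ioo.image γ hγ.continuousOn
  rw [connectedComponentIn_eq hsN]
  exact h2.subset_connectedComponentIn ⟨s, hs, rfl⟩ h1 ⟨t, ht, rfl⟩

end Torus

/-! ### The dimension of the projected centralizer -/

section Transfer

variable {E : Type*} [NormedAddCommGroup E] [NormedSpace ℝ E] [FiniteDimensional ℝ E]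
  {G : Type*} [TopologicalSpace G] [Group G] [ChartedSpace E G] [LieGroup 𝓘(ℝ, E) ∞ G] [T2Space G]
  {H : Subgroup G}
  {F : Type*} [NormedAddCommGroup F] [NormedSpace ℝ F] [FiniteDimensional ℝ F]
  [ChartedSpace F (G ⧸ H)] [IsManifold 𝓘(ℝ, F) ∞ (G ⧸ H)]
  [ContMDiffSMul 𝓘(ℝ, E) 𝓘(ℝ, F) ∞ G (G ⧸ H)] [T2Space (G ⧸ H)]
  {B : Metric E G}

theorem isotropyAlgebra_eq_iso : isotropyAlgebra (E := E) H F = iso (E := E) H F := by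
  rw [iso, baseOrbit_base]
  rfl

theorem mem_complement_iff (v : E) : v ∈ complement (E := E) H F B ↔ v ∈ hor (E := E) H F B := by
  change (∀ ξ ∈ isotropyAlgebra (E := E) H F, inn B ξ v = 0) ↔ _
  rw [isotropyAlgebra_eq_iso]
  rfl

theorem finrank_ann_inf (v : E) :
    Module.finrank ℝ ↥(ann (E := E) (G := G) v ⊓ isotropyAlgebra (E := E) H F) =
      Module.finrank ℝ ↥(cent G v ⊓ iso (E := E) H F) := by
  rw [← isotropyAlgebra_eq_iso]
  rfl

theorem isGeneric_iff (v : E) : IsGeneric (E := E) H F B v ↔ IsGen (E := E) H F B v := by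
  refine and_congr (mem_complement_iff v) (forall_congr' fun w => ?_)
  refine imp_congr (mem_complement_iff (E := E) w) (and_congr Iff.rfl ?_)
  exact iff_of_eq (congrArg₂ (· ≤ ·) (finrank_ann_inf v) (finrank_ann_inf (E := E) w))

/-- The kernel of the projection to `𝔳` is `𝔥`. -/
theorem finrank_prAnn (v : E) : Module.finrank ℝ (prAnn (E := E) H F B v) +
    Module.finrank ℝ ↥(cent G v ⊓ iso (E := E) H F) = Module.finrank ℝ (cent G v) := by
  have : FiniteDimensional ℝ (GroupLieAlgebra 𝓘(ℝ, E) G) :=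
    inferInstanceAs (FiniteDimensional ℝ E)
  have h1 := finrank_map_add_finrank_inf_ker
    (Submodule.projection _ _ (isCompl_complement (E := E) H (F := F) B)) (ann (E := E) (G := G) v)
  rw [Submodule.ker_projection, finrank_ann_inf] at h1
  exact h1

end Transfer

end NormalMetric

end

theorem mainTheorem2
    {E : Type*} [NormedAddCommGroup E] [NormedSpace ℝ E] [FiniteDimensional ℝ E]
    {G : Type*} [TopologicalSpace G] [Group G] [ChartedSpace E G] [LieGroup 𝓘(ℝ, E) ∞ G]
    [T2Space G] [CompactSpace G]
    (H : Subgroup G) (hH : IsClosed (H : Set G))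
    {F : Type*} [NormedAddCommGroup F] [NormedSpace ℝ F] [FiniteDimensional ℝ F]
    [ChartedSpace F (G ⧸ H)] [IsManifold 𝓘(ℝ, F) ∞ (G ⧸ H)]
    (hQ : NormalMetric.IsQuotientStructure E H F)
    (B : NormalMetric.Metric E G) (hB : NormalMetric.IsBiinvariant B)
    (ds₀ : NormalMetric.Metric F (G ⧸ H)) (hds₀ : NormalMetric.IsInducedMetric H B ds₀) :
    let Ham : NormalMetric.Cotangent F (G ⧸ H) → ℝ := NormalMetric.kineticEnergy ds₀
    let F₁ := NormalMetric.pullbackAlgebra E G F (G ⧸ H)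
    let F₂ := NormalMetric.invariantAlgebra G F (G ⧸ H)
    NormalMetric.IsCompletelyIntegrable Ham ∧
    ∃ (U : Set (NormalMetric.Cotangent F (G ⧸ H))) (l r : ℕ),
      NormalMetric.IsCompleteAlgebraOfIntegrals Ham (F₁ ⊔ F₂) U l r ∧
      (∃ v, NormalMetric.IsGeneric H F B v) ∧
      (∀ v, NormalMetric.IsGeneric H F B v →
        Module.finrank ℝ (NormalMetric.prAnn H F B v) = r) ∧
      ∀ α ∈ U,
        let N := connectedComponentIn (NormalMetric.levelSet (F₁ ⊔ F₂) α) α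
        N ⊆ U ∧ NormalMetric.IsIsotropicTorus N r ∧ NormalMetric.IsFlowInvariant Ham N := by
  intro Ham F₁ F₂
  have : IsTopologicalGroup G := topologicalGroup_of_lieGroup 𝓘(ℝ, E) ∞
  have : ContMDiffSMul 𝓘(ℝ, E) 𝓘(ℝ, F) ∞ G (G ⧸ H) := hQ.contMDiffSMul
  have : T2Space (G ⧸ H) := NormalMetric.t2Space_quotient hH
  have : T2Space (NormalMetric.Cotangent F (G ⧸ H)) := NormalMetric.t2Space_cotangent hQ
  have hint : ∀ f ∈ F₁ ⊔ F₂, NormalMetric.IsFirstIntegral Ham f := by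
    rw [show Ham = NormalMetric.energyFun G F (G ⧸ H) B from
      funext (NormalMetric.kineticEnergy_eq_energyFun hQ hB hds₀)]
    exact fun f hf => NormalMetric.isFirstIntegral_energyFun hB hf
  obtain ⟨v, hv⟩ := NormalMetric.exists_isGen (E := E) (H := H) (F := F) (B := B)
  have hrank : ∀ v, NormalMetric.IsGen (E := E) H F B v → ∀ α : NormalMetric.Cotangent F (G ⧸ H),
      NormalMetric.IsGenPt B α → Module.finrank ℝ (NormalMetric.torusAlg (E := E) B α) =
        Module.finrank ℝ (NormalMetric.prAnn (E := E) H F B v) := by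
    intro v hv α hα
    have h1 := NormalMetric.finrank_prAnn (G := G) (H := H) (F := F) (B := B) v
    have h2 := NormalMetric.finrank_torusAlg hB α
    have h3 := hα.finrank_eq hQ hB hv
    omega
  set U : Set (NormalMetric.Cotangent F (G ⧸ H)) := {α | NormalMetric.IsRegPt (E := E) B α}
  have hdense : Dense U := NormalMetric.dense_isRegPt hH hQ hB
  have hr := NormalMetric.finrank_prAnn (G := G) (H := H) (F := F) (B := B) v
  set r := Module.finrank ℝ (NormalMetric.prAnn (E := E) H F B v)
  -- Regular points exist, being dense in a nonempty space; the bound is read off at any of them.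
  have hle : r ≤ Module.finrank ℝ (NormalMetric.CotSpace F) := by
    obtain ⟨α, hα⟩ := hdense.nonempty_iff.2 ⟨⟨NormalMetric.base H, 0⟩⟩
    have h1 := hα.finrank_kSpace hB
    have h2 := hα.1.finrank_eq hQ hB hv
    have h3 := Submodule.finrank_le (NormalMetric.kSpace (NormalMetric.integrals E G H F) α)
    omega
  have hcomplete : NormalMetric.IsCompleteAlgebraOfIntegrals Ham (F₁ ⊔ F₂) U
      (Module.finrank ℝ (NormalMetric.CotSpace F) - r) r :=
    { firstIntegral := hint
      poissonClosed := NormalMetric.isPoissonClosed_sup E G F (G ⧸ H)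
      isOpen := NormalMetric.isOpen_isRegPt hQ hB
      dense := hdense
      dimIndex := NormalMetric.hasDimIndexOn hQ hB hv (Nat.sub_add_cancel hle) hr
      complete := Nat.sub_add_cancel hle }
  refine ⟨⟨_, _, _, _, hcomplete⟩, U, _, r, hcomplete,
    ⟨v, (NormalMetric.isGeneric_iff v).2 hv⟩, fun w hw => ?_, fun α hα => ⟨?_, ?_, ?_⟩⟩
  · obtain ⟨α, hα⟩ := hdense.nonempty_iff.2 ⟨⟨NormalMetric.base H, 0⟩⟩
    exact (hrank w ((NormalMetric.isGeneric_iff (E := E) w).1 hw) α hα.1).symm.trans (hrank v hv α hα.1)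
  · intro β hβ
    obtain ⟨g, rfl, -⟩ := (NormalMetric.mem_levelSet_iff hH hQ hB).1
      (connectedComponentIn_subset _ _ hβ)
    exact hα.cotAct g
  · exact NormalMetric.exists_torus hα.1 hH hQ hB (hrank v hv α hα.1)
  · exact NormalMetric.isFlowInvariant_connectedComponentIn hint α
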